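/- Let $(V,Y,\mathbf 1,\omega)$ be a vertex operator algebra over $\mathbb C$ (with $\mathbb Z$-grading $V=\bigoplus_n V_n$ by the eigenvalues of $L(0)$, $\dim V_n<\infty$, $V_n=0$ for $n\ll 0$), and let $g$ be an automorphism of $V$ of finite order $T$. For $0\le r\le T-1$ put $V^r=\{v\in V: gv=e^{2\pi i r/T}v\}$, and put $\delta_r=1$ if $r=0$ and $\delta_r=0$ otherwise. For homogeneous $u\in V^r$ and $v\in V$ let $$u\circ_g v=\operatorname{Res}_z\frac{(1+z)^{\operatorname{wt}u-1+\delta_r+r/T}}{z^{1+\delta_r}}\,Y(u,z)v ,$$ let $O_g(V)$ be the linear span of all such $u\circ_g v$, and let $A_g(V)=V/O_g(V)$. A weak $g$-twisted $V$-module is a complex vector space $M$ with a linear map $v\mapsto Y_M(v,z)=\sum_{n\in\mathbb Q}v_nz^{-n-1}$, $v_n\in\operatorname{End}M$, such that for $u\in V^r$, $v\in V$, $w\in M$: $u_n=0$ unless $n\in\frac rT+\mathbb Z$; $v_lw=0$ for $l\gg0$; $Y_M(\mathbf 1,z)=1$; and the twisted Jacobi identity holds: $$z_0^{-1}\delta\Big(\tfrac{z_1-z_2}{z_0}\Big)Y_M(u,z_1)Y_M(v,z_2)-z_0^{-1}\delta\Big(\tfrac{z_2-z_1}{-z_0}\Big)Y_M(v,z_2)Y_M(u,z_1)=z_2^{-1}\Big(\tfrac{z_1-z_0}{z_2}\Big)^{-r/T}\delta\Big(\tfrac{z_1-z_0}{z_2}\Big)Y_M(Y(u,z_0)v,z_2).$$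 An (ordinary) $g$-twisted $V$-module is a weak $g$-twisted $V$-module $M$ that is the direct sum of the eigenspaces $M_\lambda$ ($\lambda\in\mathbb C$) of $L(0)=\omega_1$, with every $M_\lambda$ finite-dimensional and, for each fixed $\lambda$, $M_{\lambda+n/T}=0$ for all sufficiently small integers $n$. It is simple if it is nonzero and has no submodules other than $0$ and itself. **Theorem.** If $A_g(V)$ is finite-dimensional and nonzero, then there is at least one simple (ordinary) $g$-twisted $V$-module. -/

import Mathlib

universe u

open scoped BigOperators

noncomputable section

/-- A vertex operator algebra over `ℂ`, in the sense of Borcherds and Frenkel-Lepowsky-Meurman.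
The vertex operators are `Y(u,z) = ∑ₙ uₙ z^{-n-1}`, where
`uₙ = VertexOperator.ncoeff (Y u) n` for `n : ℤ`.  That `Y(u,z)v` has only finitely many negative
powers of `z` is part of `VertexOperator`.  The modes of `ω` are `L(n) = ω_{n+1}`.
The `ℤ`-grading is the one by the eigenspaces of `L(0)`: the weight-`n` space is
`{v | L(0) v = n v}`. -/
class VertexOperatorAlgebra (V : Type u) [AddCommGroup V] [Module ℂ V] where
  /-- The vertex operator map `u ↦ Y(u,z)`. -/
  Y : V →ₗ[ℂ] VertexOperator ℂ V
  /-- The vacuum vector `𝟏`. -/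
  vacuum : V
  /-- The Virasoro vector `ω`. -/
  omega : V
  /-- The central charge (rank). -/
  rank : ℂ
  /-- `Y(𝟏,z) = 1`. -/
  vacuum_mode (n : ℤ) : VertexOperator.ncoeff (Y vacuum) n = if n = -1 then 1 else 0
  /-- `Y(u,z)𝟏` has no negative powers of `z`. -/
  creation_of_nonneg (u : V) (n : ℤ) (hn : 0 ≤ n) : VertexOperator.ncoeff (Y u) n vacuum = 0
  /-- The constant term of `Y(u,z)𝟏` is `u`. -/
  creation (u : V) : VertexOperator.ncoeff (Y u) (-1) vacuum = u
  /-- The Jacobi identity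
  `z₀⁻¹δ((z₁-z₂)/z₀) Y(u,z₁)Y(v,z₂)w - z₀⁻¹δ((z₂-z₁)/(-z₀)) Y(v,z₂)Y(u,z₁)w
    = z₂⁻¹δ((z₁-z₀)/z₂) Y(Y(u,z₀)v,z₂)w`:
  equality of the coefficients of `z₀^{-l-1} z₁^{-m-1} z₂^{-n-1}`.  All three sums have only
  finitely many nonzero terms. -/
  jacobi (u v w : V) (l m n : ℤ) :
    (∑ᶠ i : ℕ, ((-1 : ℂ) ^ i * ((Ring.choose l i : ℤ) : ℂ)) •
        VertexOperator.ncoeff (Y u) (m + l - i) (VertexOperator.ncoeff (Y v) (n + i) w))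
      - (∑ᶠ i : ℕ, ((-1 : ℂ) ^ (l + i) * ((Ring.choose l i : ℤ) : ℂ)) •
        VertexOperator.ncoeff (Y v) (n + l - i) (VertexOperator.ncoeff (Y u) (m + i) w))
      = ∑ᶠ i : ℕ, ((Ring.choose m i : ℤ) : ℂ) •
        VertexOperator.ncoeff (Y (VertexOperator.ncoeff (Y u) (l + i) v)) (m + n - i) w
  /-- The Virasoro relations
  `[L(m),L(n)] = (m-n) L(m+n) + (m³-m)/12 δ_{m+n,0} rank`, where `L(n) = ω_{n+1}`. -/
  virasoro (m n : ℤ) (v : V) :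
    VertexOperator.ncoeff (Y omega) (m + 1) (VertexOperator.ncoeff (Y omega) (n + 1) v)
      - VertexOperator.ncoeff (Y omega) (n + 1) (VertexOperator.ncoeff (Y omega) (m + 1) v)
      = ((m : ℂ) - n) • VertexOperator.ncoeff (Y omega) (m + n + 1) v
        + (if m + n = 0 then ((m : ℂ) ^ 3 - m) / 12 * rank else 0) • v
  /-- `Y(L(-1)u,z) = d/dz Y(u,z)`. -/
  derivative (u : V) (n : ℤ) :
    VertexOperator.ncoeff (Y (VertexOperator.ncoeff (Y omega) 0 u)) n
      = (-(n : ℂ)) • VertexOperator.ncoeff (Y u) (n - 1)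
  /-- `V` is the direct sum of its weight spaces, all weights being integers. -/
  grading : DirectSum.IsInternal
    (fun n : ℤ => Module.End.eigenspace (VertexOperator.ncoeff (Y omega) 1) (n : ℂ))
  /-- The weight spaces are finite-dimensional. -/
  finite_weight (n : ℤ) :
    FiniteDimensional ℂ (Module.End.eigenspace (VertexOperator.ncoeff (Y omega) 1) (n : ℂ))
  /-- The weights are bounded below. -/
  weight_bounded_below : ∃ N : ℤ, ∀ n < N,
    Module.End.eigenspace (VertexOperator.ncoeff (Y omega) 1) (n : ℂ) = ⊥

namespace VertexOperatorAlgebra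

variable {V : Type u} [AddCommGroup V] [Module ℂ V] [VertexOperatorAlgebra V]

/-- The mode `uₙ` in `Y(u,z) = ∑ₙ uₙ z^{-n-1}`. -/
def mode (u : V) (n : ℤ) : Module.End ℂ V := VertexOperator.ncoeff (Y u) n

/-- The homogeneous subspace of vectors of weight `d`, i.e. `{v | L(0) v = d v}`. -/
def weightSpace (V : Type u) [AddCommGroup V] [Module ℂ V] [VertexOperatorAlgebra V] (d : ℤ) :
    Submodule ℂ V :=
  Module.End.eigenspace (mode (omega : V) 1) (d : ℂ)

/-- A linear automorphism `g` of `V` is an automorphism of the vertex operator algebra if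
`g Y(u,z) g⁻¹ = Y(g u,z)` for all `u`, and `g` fixes `𝟏` and `ω`. -/
structure IsAutomorphism (g : V ≃ₗ[ℂ] V) : Prop where
  map_mode (u v : V) (n : ℤ) : g (mode u n v) = mode (g u) n (g v)
  map_vacuum : g vacuum = vacuum
  map_omega : g omega = omega

/-- The eigenspace `V^r = {v | g v = e^{2πir/T} v}`, where `T` is the order of `g`. -/
def twistedSector (g : V ≃ₗ[ℂ] V) (r : ℕ) : Submodule ℂ V :=
  Module.End.eigenspace (g : Module.End ℂ V)
    (Complex.exp (2 * Real.pi * Complex.I * r / orderOf g))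

/-- For `u` of weight `d` in `V^r` (`0 ≤ r < T`) the product
`u ∘_g v = Res_z (1+z)^{d-1+δ_r+r/T} z^{-1-δ_r} Y(u,z)v`, that is
`∑_{i ≥ 0} (d-1+δ_r+r/T choose i) u_{i-1-δ_r} v` (finitely many nonzero terms), where
`δ_r = 1` if `r = 0` and `δ_r = 0` otherwise. -/
def circ (g : V ≃ₗ[ℂ] V) (d : ℤ) (r : ℕ) (u v : V) : V :=
  ∑ᶠ i : ℕ, Ring.choose ((d : ℂ) - 1 + (if r = 0 then 1 else 0) + (r : ℂ) / orderOf g) i •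
    mode u ((i : ℤ) - 1 - (if r = 0 then 1 else 0)) v

/-- The subspace `O_g(V)`, spanned by all `u ∘_g v` with `u ∈ V^r` homogeneous, `0 ≤ r < T`. -/
def twistedO (g : V ≃ₗ[ℂ] V) : Submodule ℂ V :=
  Submodule.span ℂ {x | ∃ (r : ℕ) (d : ℤ) (u v : V), r < orderOf g ∧
    u ∈ twistedSector g r ∧ u ∈ weightSpace V d ∧ x = circ g d r u v}

/-- The vector space `A_g(V) = V / O_g(V)` underlying the twisted Zhu algebra. -/
abbrev TwistedZhu (g : V ≃ₗ[ℂ] V) : Type u := V ⧸ twistedO g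

/-- A weak `g`-twisted `V`-module structure on `M`: a linear map
`v ↦ Y_M(v,z) = ∑_{n ∈ ℚ} vₙ z^{-n-1}` with values in formal series of endomorphisms of `M`,
where `vₙ = mode v n`; `T` denotes the order of `g`. -/
structure WeakTwistedModule (g : V ≃ₗ[ℂ] V) (M : Type u) [AddCommGroup M] [Module ℂ M] where
  /-- The linear map sending `v` to the family of its modes `vₙ`, `n ∈ ℚ`. -/
  mode : V →ₗ[ℂ] (ℚ → Module.End ℂ M)
  /-- For `u ∈ V^r`, only the modes `uₙ` with `n ∈ r/T + ℤ` occur. -/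
  mode_eq_zero (r : ℕ) (hr : r < orderOf g) (u : V) (hu : u ∈ twistedSector g r) (n : ℚ)
    (hn : ∀ k : ℤ, n ≠ (r : ℚ) / orderOf g + k) : mode u n = 0
  /-- `v_l w = 0` for `l` sufficiently large. -/
  truncation (v : V) (w : M) : ∃ N : ℚ, ∀ l : ℚ, N ≤ l → mode v l w = 0
  /-- `Y_M(𝟏,z) = 1`. -/
  vacuum_mode (n : ℚ) : mode vacuum n = if n = -1 then 1 else 0
  /-- The twisted Jacobi identity, for `u ∈ V^r`,
  `z₀⁻¹δ((z₁-z₂)/z₀) Y_M(u,z₁)Y_M(v,z₂)w - z₀⁻¹δ((z₂-z₁)/(-z₀)) Y_M(v,z₂)Y_M(u,z₁)w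
    = z₂⁻¹((z₁-z₀)/z₂)^{-r/T} δ((z₁-z₀)/z₂) Y_M(Y(u,z₀)v,z₂)w`:
  equality of the coefficients of `z₀^{-l-1} z₁^{-m-1} z₂^{-n-1}`, where `m = r/T + k`.
  (No power of `z₁` with `m ∉ r/T + ℤ` occurs on either side.)
  All three sums have only finitely many nonzero terms. -/
  jacobi (r : ℕ) (hr : r < orderOf g) (u : V) (hu : u ∈ twistedSector g r) (v : V) (w : M)
    (l k : ℤ) (m n : ℚ) (hm : m = (r : ℚ) / orderOf g + k) :
    (∑ᶠ i : ℕ, ((-1 : ℂ) ^ i * ((Ring.choose l i : ℤ) : ℂ)) •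
        mode u (m + l - i) (mode v (n + i) w))
      - (∑ᶠ i : ℕ, ((-1 : ℂ) ^ (l + i) * ((Ring.choose l i : ℤ) : ℂ)) •
        mode v (n + l - i) (mode u (m + i) w))
      = ∑ᶠ i : ℕ, Ring.choose (m : ℂ) i •
        mode (VertexOperatorAlgebra.mode u (l + i) v) (m + n - i) w

namespace WeakTwistedModule

variable {g : V ≃ₗ[ℂ] V} {M : Type u} [AddCommGroup M] [Module ℂ M]

/-- The subspace `M_c = {w | L(0) w = c w}`, where `L(0) = ω₁`. -/
def weightSpace (X : WeakTwistedModule g M) (c : ℂ) : Submodule ℂ M :=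
  Module.End.eigenspace (X.mode omega 1) c

/-- A weak `g`-twisted module is an (ordinary) `g`-twisted module if it is the direct sum of the
eigenspaces `M_c` of `L(0)`, each `M_c` is finite-dimensional, and for each fixed `c` one has
`M_{n/T+c} = 0` for all sufficiently small integers `n`. -/
structure IsOrdinary (X : WeakTwistedModule g M) : Prop where
  grading : DirectSum.IsInternal (fun c : ℂ => X.weightSpace c)
  finite_weight (c : ℂ) : FiniteDimensional ℂ (X.weightSpace c)
  bounded_below (c : ℂ) : ∃ N : ℤ, ∀ n : ℤ, n < N →
    X.weightSpace ((n : ℂ) / orderOf g + c) = ⊥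

/-- A module is simple if it is nonzero and its only subspaces stable under all modes `vₙ` are
`0` and the whole space.  (In an ordinary module a stable subspace is stable under `L(0)`, hence
graded and itself an ordinary module.) -/
structure IsSimple (X : WeakTwistedModule g M) : Prop where
  nontrivial : Nontrivial M
  eq_bot_or_eq_top (W : Submodule ℂ M) (hW : ∀ (v : V) (n : ℚ), ∀ w ∈ W, X.mode v n w ∈ W) :
    W = ⊥ ∨ W = ⊤

end WeakTwistedModule

end VertexOperatorAlgebra

end

/-! The module is found inside the dual of V. Consider functionals f for which, whenever a lies in
an eigenspace of g, the forms f(Y(a,z)v) have poles at z = -1 and at infinity bounded uniformly in v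
(`regularDual`); at z = -1 a fractional power determined by the eigenvalue is allowed. Expanding
such a form in powers of y = 1+z defines functionals aₙf (`dualMode`), and these make `regularDual`
a weak g-twisted module (`regularModule`). The twisted Jacobi identity is the Jacobi identity of V
read at another point: z₁-z₂ = y₁-y₂, and the residue theorem moves residues from z = 0 to z = -1.
No rational functions are used: a form is represented by its residues `bra` against (1+z)^α z^q, and
`exists_expansion` recovers the expansion at y = 0 from them.

The dual of A_g(V), that is, the functionals killing O_g(V), lies in `regularDual`, because the
exponents in u ∘_g v express exactly the required pole bounds (`apply_bra_of_le`,
`isBounded_of_mem`). These functionals are killed by all weight-lowering modes, and L(0) acts on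
them as the transpose of v ↦ Res (1+z) z⁻¹ Y(ω,z)v. As A_g(V) is finite-dimensional and nonzero,
there is an eigenvector f; its eigenvalue c is chosen with maximal real part. A simple subquotient M
in which f survives is generated by a lowest weight vector of weight c, so its weights are of the
form c + k/T with k ≥ 0.

It remains to bound the weight spaces. The lowest one is the image of A_g(V) under v ↦ o(v)s, with
o(v) the zero mode. For k > 0 suppose that all lower levels are finite-dimensional and level k is
not. Fix φ ≠ 0 supported on M_c. The functionals φ ∘ uₙ span a space stable under composition with
modes (`dualOrbit`). By simplicity it restricts onto the full dual of every finite-dimensional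
subspace, but it has countable dimension, so it cannot restrict onto the dual of level k. Hence some
ξ on the dual of level k kills these restrictions but not a certain ψ. The functional v ↦ ξ(ψ ∘
o(v)) then kills O_g(V), is an eigenvector for c + k/T, and is nonzero at the vacuum, contradicting
the choice of c (`finiteDimensional_level_of_lt`). -/

noncomputable section

namespace VertexOperatorAlgebra

/-! ### Power series acting on sequences that vanish for large index. -/

section

section PowerSeriesAction

/-- The binomial series `(1+X)^α`. -/
def bin (α : ℂ) : PowerSeries ℂ := PowerSeries.mk (Ring.choose α)

/-- The series `(1-X)^(-j)`. -/
def negBin (j : ℂ) : PowerSeries ℂ := PowerSeries.rescale (-1) (bin (-j))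

@[simp] lemma coeff_bin (α : ℂ) (i : ℕ) : PowerSeries.coeff i (bin α) = Ring.choose α i :=
  PowerSeries.coeff_mk _ _

@[simp] lemma coeff_negBin (j : ℂ) (i : ℕ) :
    PowerSeries.coeff i (negBin j) = (-1) ^ i * Ring.choose (-j) i := by
  simp [negBin, PowerSeries.coeff_rescale]

lemma bin_add (α β : ℂ) : bin (α + β) = bin α * bin β := by
  ext n
  rw [PowerSeries.coeff_mul, coeff_bin, Ring.add_choose_eq n (Commute.all α β)]
  simp

lemma bin_zero : bin 0 = 1 := by
  ext n
  rw [coeff_bin, Ring.choose_zero_ite, PowerSeries.coeff_one]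

lemma bin_one : bin 1 = 1 + PowerSeries.X := by
  ext n
  have h := Ring.choose_natCast (R := ℂ) 1 n
  rw [Nat.cast_one] at h
  rw [coeff_bin, h, map_add, PowerSeries.coeff_one, PowerSeries.coeff_X]
  match n with
  | 0 => simp
  | 1 => simp
  | n + 2 => simp [Nat.choose_eq_zero_of_lt]

lemma negBin_add (j k : ℂ) : negBin (j + k) = negBin j * negBin k := by
  rw [negBin, neg_add, bin_add, map_mul]; rfl

lemma negBin_zero : negBin 0 = 1 := by
  rw [negBin, neg_zero, bin_zero, map_one]

/-- Both sides equal (i+p choose i)(α choose i+p). This exchanges the two binomial expansions in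
`apply_bra_bra`. -/
lemma choose_mul_choose_sub (α : ℂ) (i p : ℕ) :
    Ring.choose α i * Ring.choose (α - i) p = Ring.choose α p * Ring.choose (α - p) i := by
  have h1 := Ring.choose_add_smul_choose (α - p - i) i p
  have h2 := Ring.choose_smul_choose α (n := i + p) (k := i) (Nat.le_add_right _ _)
  have h3 := Ring.choose_smul_choose α (n := i + p) (k := p) (Nat.le_add_left _ _)
  simp only [Nat.add_sub_cancel_left, Nat.add_sub_cancel] at h2 h3
  rw [← h2, ← h3, Nat.choose_symm_add]

/-- The expansion of the divided derivative of `x^p (x-1)^α`. -/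
lemma mk_choose_mul_choose (α p : ℂ) (i : ℕ) :
    PowerSeries.mk (fun c : ℕ => Ring.choose α c * Ring.choose (p + c) i) =
      ∑ x ∈ Finset.HasAntidiagonal.antidiagonal i, PowerSeries.C (Ring.choose α x.1 * Ring.choose p x.2) *
        (PowerSeries.X ^ x.1 * bin (α - x.1)) := by
  ext c
  -- Vandermonde splits (p+c choose i); then (α choose c)(c choose x₁) = (α choose x₁)(α-x₁ choose
  -- c-x₁).
  rw [PowerSeries.coeff_mk, map_sum, add_comm p, Ring.add_choose_eq i (Commute.all (c : ℂ) p),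
    Finset.mul_sum]
  refine Finset.sum_congr rfl fun x _ => ?_
  rw [PowerSeries.coeff_C_mul, PowerSeries.coeff_X_pow_mul', Ring.choose_natCast]
  split_ifs with h
  · have := Ring.choose_smul_choose α h
    rw [nsmul_eq_mul] at this
    rw [coeff_bin]
    linear_combination Ring.choose p x.2 * this
  · rw [Nat.choose_eq_zero_of_lt (not_le.mp h)]; simp

lemma finsum_eq_sum_range {E : Type*} [AddCommGroup E] {x : ℕ → E} {N : ℕ} (h : ∀ i, N ≤ i → x i = 0) :
    ∑ᶠ i, x i = ∑ i ∈ Finset.range N, x i := by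
  refine finsum_eq_sum_of_support_subset _ fun i hi => ?_
  by_contra h'
  exact hi (h i (by simpa using h'))

lemma exists_bound {E : Type*} [AddCommGroup E] {x : ℤ → E} (hx : ∃ P, ∀ n, P ≤ n → x n = 0) (p : ℤ) :
    ∃ N₀ : ℕ, ∀ N, N₀ ≤ N → ∀ n, p + (N : ℤ) ≤ n → x n = 0 := by
  obtain ⟨P, hP⟩ := hx
  exact ⟨(P - p).toNat, fun N hN n hn => hP n (by omega)⟩

variable {E : Type*} [AddCommGroup E] [Module ℂ E]

/-- The action of a power series on sequences, with `X` acting as a shift. -/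
def act (c : PowerSeries ℂ) (x : ℤ → E) (p : ℤ) : E :=
  ∑ᶠ i : ℕ, PowerSeries.coeff i c • x (p + i)

lemma act_eq_sum (c : PowerSeries ℂ) {x : ℤ → E} {p : ℤ} {N : ℕ} (h : ∀ n, p + N ≤ n → x n = 0) :
    act c x p = ∑ i ∈ Finset.range N, PowerSeries.coeff i c • x (p + i) :=
  finsum_eq_sum_range fun i hi => by rw [h _ (by omega), smul_zero]

lemma act_eq_zero (c : PowerSeries ℂ) {x : ℤ → E} {p : ℤ} (h : ∀ n, p ≤ n → x n = 0) :
    act c x p = 0 := by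
  rw [act_eq_sum c (N := 0) (by simpa using h)]; simp

lemma act_add_left (c d : PowerSeries ℂ) {x : ℤ → E} (hx : ∃ P, ∀ n, P ≤ n → x n = 0) (p : ℤ) :
    act (c + d) x p = act c x p + act d x p := by
  obtain ⟨N, hN⟩ := exists_bound hx p
  simp only [act_eq_sum _ (hN N le_rfl), map_add, add_smul, Finset.sum_add_distrib]

lemma act_sum_left {ι : Type*} (s : Finset ι) (c : ι → PowerSeries ℂ) {x : ℤ → E}
    (hx : ∃ P, ∀ n, P ≤ n → x n = 0) (p : ℤ) :
    act (∑ k ∈ s, c k) x p = ∑ k ∈ s, act (c k) x p := by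
  obtain ⟨N, hN⟩ := exists_bound hx p
  simp only [act_eq_sum _ (hN N le_rfl), map_sum, Finset.sum_smul]
  rw [Finset.sum_comm]

lemma act_C_mul (a : ℂ) (c : PowerSeries ℂ) {x : ℤ → E} (hx : ∃ P, ∀ n, P ≤ n → x n = 0) (p : ℤ) :
    act (PowerSeries.C a * c) x p = a • act c x p := by
  obtain ⟨N, hN⟩ := exists_bound hx p
  simp only [act_eq_sum _ (hN N le_rfl), PowerSeries.coeff_C_mul, mul_smul, Finset.smul_sum]

lemma act_X_pow_mul (k : ℕ) (c : PowerSeries ℂ) {x : ℤ → E} (hx : ∃ P, ∀ n, P ≤ n → x n = 0)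
    (p : ℤ) : act (PowerSeries.X ^ k * c) x p = act c x (p + k) := by
  obtain ⟨N, hN⟩ := exists_bound hx p
  rw [act_eq_sum _ (hN (k + N) (by omega)), act_eq_sum (N := N) _ fun n hn => hN N le_rfl n (by omega),
    Finset.sum_range_add, Finset.sum_eq_zero, zero_add]
  · refine Finset.sum_congr rfl fun i _ => ?_
    rw [PowerSeries.coeff_X_pow_mul']
    simp [add_assoc]
  · intro i hi
    rw [PowerSeries.coeff_X_pow_mul', if_neg (by simpa using hi), zero_smul]

lemma act_one (x : ℤ → E) (hx : ∃ P, ∀ n, P ≤ n → x n = 0) (p : ℤ) : act 1 x p = x p := by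
  obtain ⟨N, hN⟩ := exists_bound hx p
  rw [act_eq_sum _ (hN (N + 1) (by omega)), Finset.sum_range_succ']
  simp [PowerSeries.coeff_one]

lemma act_bounded (c : PowerSeries ℂ) {x : ℤ → E} (hx : ∃ P, ∀ n, P ≤ n → x n = 0) :
    ∃ P, ∀ n, P ≤ n → act c x n = 0 := by
  obtain ⟨P, hP⟩ := hx
  exact ⟨P, fun n hn => act_eq_zero c fun m hm => hP m (hn.trans hm)⟩

lemma act_mul (c d : PowerSeries ℂ) {x : ℤ → E} (hx : ∃ P, ∀ n, P ≤ n → x n = 0) (p : ℤ) :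
    act (c * d) x p = act c (act d x) p := by
  obtain ⟨P, hP⟩ := hx
  set N := (P - p).toNat with hN
  have h0 : ∀ n, p + (N : ℤ) ≤ n → x n = 0 := fun n hn => hP n (by omega)
  rw [act_eq_sum _ h0, act_eq_sum _ (N := N) fun n hn => act_eq_zero _ fun m hm => h0 m (by omega)]
  have h1 : ∀ i ∈ Finset.range N, PowerSeries.coeff i c • act d x (p + i) =
      ∑ j ∈ Finset.range (N - i),
        (PowerSeries.coeff i c * PowerSeries.coeff j d) • x (p + ((i + j : ℕ) : ℤ)) := by
    intro i hi
    rw [act_eq_sum d (N := N - i) fun n hn => h0 n (by rw [Finset.mem_range] at hi; omega),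
      Finset.smul_sum]
    refine Finset.sum_congr rfl fun j _ => ?_
    rw [smul_smul, Nat.cast_add, add_assoc]
  rw [Finset.sum_congr rfl h1]
  simp only [PowerSeries.coeff_mul, Finset.sum_smul]
  rw [Finset.sum_sigma', Finset.sum_sigma']
  refine Finset.sum_nbij' (fun y => ⟨y.2.1, y.2.2⟩) (fun y => ⟨y.1 + y.2, (y.1, y.2)⟩) ?_ ?_ ?_ ?_ ?_
  · rintro ⟨k, i, j⟩ h
    simp at h ⊢; omega
  · rintro ⟨i, j⟩ h
    simp at h ⊢; omega
  · rintro ⟨k, i, j⟩ h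
    simp at h ⊢; simp [h.2]
  · rintro ⟨i, j⟩ h; rfl
  · rintro ⟨k, i, j⟩ h
    simp at h; simp [h.2]

lemma map_act {F : Type*} [AddCommGroup F] [Module ℂ F] (φ : E →ₗ[ℂ] F) (c : PowerSeries ℂ)
    {x : ℤ → E} (hx : ∃ P, ∀ n, P ≤ n → x n = 0) (p : ℤ) :
    φ (act c x p) = act c (fun n => φ (x n)) p := by
  obtain ⟨N, hN⟩ := exists_bound hx p
  rw [act_eq_sum c (hN N le_rfl), act_eq_sum c (N := N) fun n hn => by rw [hN N le_rfl n hn, map_zero]]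
  simp

end PowerSeriesAction

end

/-! ### Residues of vertex operators against (1+z)^α z^q. -/

section

lemma act_add_right {E : Type*} [AddCommGroup E] [Module ℂ E] (c : PowerSeries ℂ) {x y : ℤ → E}
    (hx : ∃ P, ∀ n, P ≤ n → x n = 0) (hy : ∃ P, ∀ n, P ≤ n → y n = 0) (p : ℤ) :
    act c (fun n => x n + y n) p = act c x p + act c y p := by
  obtain ⟨N, hN⟩ := exists_bound hx p
  obtain ⟨M, hM⟩ := exists_bound hy p
  have h1 := hN (max N M) (le_max_left _ _)
  have h2 := hM (max N M) (le_max_right _ _)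
  rw [act_eq_sum c h1, act_eq_sum c h2, act_eq_sum c (N := max N M)
    fun n hn => by rw [h1 n hn, h2 n hn, add_zero]]
  simp [Finset.sum_add_distrib]

variable {V : Type u} [AddCommGroup V] [Module ℂ V] [VertexOperatorAlgebra V]

section Modes

lemma mode_add_left (a b : V) (n : ℤ) : mode (a + b) n = mode a n + mode b n := by
  simp [mode]

lemma mode_smul_left (c : ℂ) (a : V) (n : ℤ) : mode (c • a) n = c • mode a n := by
  simp [mode]

lemma mode_truncation (a v : V) : ∃ P : ℤ, ∀ n, P ≤ n → mode a n v = 0 := by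
  refine ⟨-HahnSeries.order ((HahnModule.of ℂ).symm (Y a v)), fun n hn => ?_⟩
  exact VertexOperator.ncoeff_eq_zero_of_lt_order _ _ _ (by omega)

/-- Only finitely many k ≥ q have b_k v ≠ 0, so finitely many truncation bounds have to be combined.
-/
lemma mode_mode_truncation (a b v : V) (q : ℤ) :
    ∃ P : ℤ, ∀ k, q ≤ k → ∀ n, P ≤ n → mode a n (mode b k v) = 0 := by
  obtain ⟨K, hK⟩ := mode_truncation b v
  have : ∀ m : ℕ, ∃ P : ℤ, ∀ k, K - m ≤ k → ∀ n, P ≤ n → mode a n (mode b k v) = 0 := by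
    intro m
    induction m with
    | zero => exact ⟨0, fun k hk n _ => by rw [hK k (by simpa using hk), map_zero]⟩
    | succ m ih =>
      obtain ⟨P, hP⟩ := ih
      obtain ⟨Q, hQ⟩ := mode_truncation a (mode b (K - (m + 1)) v)
      refine ⟨max P Q, fun k hk n hn => ?_⟩
      rcases eq_or_ne k (K - (m + 1)) with rfl | hne
      · exact hQ n (le_trans (le_max_right _ _) hn)
      · exact hP k (by push_cast at hk; omega) n (le_trans (le_max_left _ _) hn)
  obtain ⟨P, hP⟩ := this (K - q).toNat
  exact ⟨P, fun k hk => hP k (by omega)⟩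

lemma intCast_choose (l : ℤ) (i : ℕ) : ((Ring.choose l i : ℤ) : ℂ) = Ring.choose (l : ℂ) i :=
  Ring.map_choose (Int.castRingHom ℂ) l i

lemma jacobi_sum (u v w : V) (l m n : ℤ) (N : ℕ) (h1 : ∀ k, n + (N : ℤ) ≤ k → mode v k w = 0)
    (h2 : ∀ k, m + (N : ℤ) ≤ k → mode u k w = 0) (h3 : ∀ k, l + (N : ℤ) ≤ k → mode u k v = 0) :
    (∑ i ∈ Finset.range N, ((-1 : ℂ) ^ i * Ring.choose (l : ℂ) i) •
        mode u (m + l - i) (mode v (n + i) w))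
      - (∑ i ∈ Finset.range N, ((-1 : ℂ) ^ (l + i) * Ring.choose (l : ℂ) i) •
        mode v (n + l - i) (mode u (m + i) w))
      = ∑ i ∈ Finset.range N, Ring.choose (m : ℂ) i • mode (mode u (l + i) v) (m + n - i) w := by
  have h := jacobi u v w l m n
  simp only [intCast_choose] at h
  rw [finsum_eq_sum_range (N := N), finsum_eq_sum_range (N := N), finsum_eq_sum_range (N := N)] at h
  · exact h
  · intro i hi
    have : mode u (l + i) v = 0 := h3 _ (by omega)
    change _ • mode (mode u (l + i) v) (m + n - i) w = 0
    rw [this]; simp [mode]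
  · intro i hi
    have : mode u (m + i) w = 0 := h2 _ (by omega)
    change _ • mode v (n + l - i) (mode u (m + i) w) = 0
    rw [this]; simp
  · intro i hi
    have : mode v (n + i) w = 0 := h1 _ (by omega)
    change _ • mode u (m + l - i) (mode v (n + i) w) = 0
    rw [this]; simp

/-- `Res_z (1+z)^α z^q Y(a,z)v`. -/
def bra (a : V) (α : ℂ) (q : ℤ) : Module.End ℂ V where
  toFun v := act (bin α) (fun n => mode a n v) q
  map_add' v w := by
    simp only [map_add]
    exact act_add_right _ (mode_truncation a v) (mode_truncation a w) q
  map_smul' c v := by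
    simp only [map_smul, RingHom.id_apply]
    exact (map_act (c • LinearMap.id) _ (mode_truncation a v) q).symm

lemma bra_apply (a : V) (α : ℂ) (q : ℤ) (v : V) :
    bra a α q v = act (bin α) (fun n => mode a n v) q := rfl

lemma bra_add_left (a b : V) (α : ℂ) (q : ℤ) : bra (a + b) α q = bra a α q + bra b α q := by
  ext v
  simp only [bra_apply, mode_add_left, LinearMap.add_apply]
  exact act_add_right _ (mode_truncation a v) (mode_truncation b v) q

lemma bra_smul_left (c : ℂ) (a : V) (α : ℂ) (q : ℤ) : bra (c • a) α q = c • bra a α q := by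
  ext v
  simp only [bra_apply, mode_smul_left, LinearMap.smul_apply]
  exact (map_act (c • LinearMap.id) _ (mode_truncation a v) q).symm

/-- `a ↦ Res_z (1+z)^α z^q Y(a,z)` as a linear map. -/
def braLin (α : ℂ) (q : ℤ) : V →ₗ[ℂ] Module.End ℂ V where
  toFun a := bra a α q
  map_add' a b := bra_add_left a b α q
  map_smul' c a := bra_smul_left c a α q

lemma bra_zero_left (α : ℂ) (q : ℤ) : bra (0 : V) α q = 0 := (braLin α q).map_zero

lemma bra_eq_zero {a v : V} {q : ℤ} (h : ∀ n, q ≤ n → mode a n v = 0) (α : ℂ) :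
    bra a α q v = 0 := act_eq_zero _ h

/-- Expanding a factor `(1+z)^l`. -/
lemma bra_add_exponent (a : V) (l α : ℂ) (q : ℤ) (v : V) :
    bra a (l + α) q v = act (bin l) (fun n => bra a α n v) q := by
  rw [bra_apply, bin_add, act_mul _ _ (mode_truncation a v)]; rfl

lemma bra_one_add_exponent (a : V) (α : ℂ) (q : ℤ) :
    bra a (1 + α) q = bra a α q + bra a α (q + 1) := by
  ext v
  have h : ∃ P, ∀ n, P ≤ n → bra a α n v = 0 := act_bounded (bin α) (mode_truncation a v)
  rw [bra_add_exponent, bin_one, act_add_left _ _ h, act_one _ h]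
  have := act_X_pow_mul 1 1 h q
  rw [pow_one, mul_one, act_one _ h] at this
  rw [LinearMap.add_apply]
  exact congrArg _ this

/-- The Jacobi identity, paired with the functions `(1+z)^α z^p` and `(1+z)^β z^q`. -/
lemma bra_jacobi (a b v : V) (l p q : ℤ) (α β : ℂ) :
    (∑ᶠ i : ℕ, ((-1 : ℂ) ^ i * Ring.choose (l : ℂ) i) • bra a α (p + l - i) (bra b β (q + i) v))
      - (∑ᶠ i : ℕ, ((-1 : ℂ) ^ (l + i) * Ring.choose (l : ℂ) i) •
        bra b β (q + l - i) (bra a α (p + i) v))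
      = ∑ᶠ i : ℕ, ∑ x ∈ Finset.HasAntidiagonal.antidiagonal i,
        (Ring.choose α x.1 * Ring.choose (p : ℂ) x.2) •
          bra (mode a (l + i) b) (α + β - x.1) (p + q - x.2) v := by
  -- N cuts off the three sums over i; M below cuts off the binomial expansions of the powers of
  -- 1+z, uniformly for i < N.
  obtain ⟨N, hN1, hN2, hN3⟩ : ∃ N : ℕ, (∀ k, q + (N : ℤ) ≤ k → mode b k v = 0) ∧
      (∀ k, p + (N : ℤ) ≤ k → mode a k v = 0) ∧ (∀ k, l + (N : ℤ) ≤ k → mode a k b = 0) := by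
    obtain ⟨P1, h1⟩ := mode_truncation b v
    obtain ⟨P2, h2⟩ := mode_truncation a v
    obtain ⟨P3, h3⟩ := mode_truncation a b
    refine ⟨(P1 - q).toNat + (P2 - p).toNat + (P3 - l).toNat, ?_, ?_, ?_⟩
    · intro k hk; exact h1 k (by omega)
    · intro k hk; exact h2 k (by omega)
    · intro k hk; exact h3 k (by omega)
  obtain ⟨M, hM1, hM2, hM3, hM4⟩ : ∃ M : ℕ, N ≤ M ∧
      (∀ k, q ≤ k → ∀ n, p + l - N + (M : ℤ) ≤ n → mode a n (mode b k v) = 0) ∧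
      (∀ k, p ≤ k → ∀ n, q + l - N + (M : ℤ) ≤ n → mode b n (mode a k v) = 0) ∧
      (∀ k, l ≤ k → ∀ n, p + q - N + (M : ℤ) ≤ n → mode (mode a k b) n v = 0) := by
    obtain ⟨P1, h1⟩ := mode_mode_truncation a b v q
    obtain ⟨P2, h2⟩ := mode_mode_truncation b a v p
    have h3 : ∃ P : ℤ, ∀ i < N, ∀ n, P ≤ n → mode (mode a (l + i) b) n v = 0 := by
      clear hN1 hN2 hN3
      induction N with
      | zero => exact ⟨0, fun i hi => absurd hi (by omega)⟩
      | succ N ih =>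
        obtain ⟨P, hP⟩ := ih
        obtain ⟨Q, hQ⟩ := mode_truncation (mode a (l + N) b) v
        refine ⟨max P Q, fun i hi n hn => ?_⟩
        rcases Nat.lt_succ_iff_lt_or_eq.mp hi with h | rfl
        · exact hP i h n (le_trans (le_max_left _ _) hn)
        · exact hQ n (le_trans (le_max_right _ _) hn)
    obtain ⟨P3, h3⟩ := h3
    refine ⟨N + (P1 - (p + l - N)).toNat + (P2 - (q + l - N)).toNat + (P3 - (p + q - N)).toNat,
      by omega, ?_, ?_, ?_⟩
    · intro k hk n hn; exact h1 k hk n (by omega)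
    · intro k hk n hn; exact h2 k hk n (by omega)
    · intro k hk n hn
      by_cases hkN : k < l + N
      · obtain ⟨i, rfl⟩ : ∃ i : ℕ, k = l + i := ⟨(k - l).toNat, by omega⟩
        exact h3 i (by omega) n (by omega)
      · rw [hN3 k (by omega)]; simp [mode]
  rw [finsum_eq_sum_range (N := N) fun i hi => by
        rw [bra_eq_zero (a := b) (v := v) fun n hn => hN1 n (by omega), map_zero, smul_zero],
    finsum_eq_sum_range (N := N) fun i hi => by
        rw [bra_eq_zero (a := a) (v := v) fun n hn => hN2 n (by omega), map_zero, smul_zero],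
    finsum_eq_sum_range (N := N) fun i hi => Finset.sum_eq_zero fun x _ => by
        rw [hN3 _ (by omega), bra_zero_left, LinearMap.zero_apply, smul_zero]]
  have hb : ∀ i : ℕ, bra b β (q + i) v =
      ∑ d ∈ Finset.range M, Ring.choose β d • mode b (q + i + d) v := fun i => by
    rw [bra_apply, act_eq_sum _ (N := M) fun n hn => hN1 n (by omega)]; simp
  have ha : ∀ i : ℕ, bra a α (p + i) v =
      ∑ c ∈ Finset.range M, Ring.choose α c • mode a (p + i + c) v := fun i => by
    rw [bra_apply, act_eq_sum _ (N := M) fun n hn => hN2 n (by omega)]; simp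
  have hab : ∀ i ∈ Finset.range N, ∀ d : ℕ, bra a α (p + l - i) (mode b (q + i + d) v) =
      ∑ c ∈ Finset.range M, Ring.choose α c • mode a (p + l - i + c) (mode b (q + i + d) v) := by
    intro i hi d
    rw [Finset.mem_range] at hi
    rw [bra_apply, act_eq_sum _ (N := M) fun n hn => hM2 _ (by omega) n (by omega)]; simp
  have hba : ∀ i ∈ Finset.range N, ∀ c : ℕ, bra b β (q + l - i) (mode a (p + i + c) v) =
      ∑ d ∈ Finset.range M, Ring.choose β d • mode b (q + l - i + d) (mode a (p + i + c) v) := by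
    intro i hi d
    rw [Finset.mem_range] at hi
    rw [bra_apply, act_eq_sum _ (N := M) fun n hn => hM3 _ (by omega) n (by omega)]; simp
  have e1 : ∑ i ∈ Finset.range N, ((-1 : ℂ) ^ i * Ring.choose (l : ℂ) i) •
        bra a α (p + l - i) (bra b β (q + i) v) =
      ∑ c ∈ Finset.range M, ∑ d ∈ Finset.range M, (Ring.choose α c * Ring.choose β d) •
        ∑ i ∈ Finset.range N, ((-1 : ℂ) ^ i * Ring.choose (l : ℂ) i) •
          mode a (p + c + l - i) (mode b (q + d + i) v) := by
    simp only [Finset.smul_sum]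
    rw [Finset.sum_congr rfl fun c _ => Finset.sum_comm, Finset.sum_comm]
    refine Finset.sum_congr rfl fun i hi => ?_
    rw [hb, map_sum, Finset.smul_sum, Finset.sum_comm]
    refine Finset.sum_congr rfl fun d _ => ?_
    rw [map_smul, hab i hi, Finset.smul_sum, Finset.smul_sum]
    refine Finset.sum_congr rfl fun c _ => ?_
    rw [smul_smul, smul_smul, smul_smul, show p + l - (i : ℤ) + c = p + c + l - i by ring,
      show q + (i : ℤ) + d = q + d + i by ring]
    congr 1; ring
  have e2 : ∑ i ∈ Finset.range N, ((-1 : ℂ) ^ (l + i) * Ring.choose (l : ℂ) i) •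
        bra b β (q + l - i) (bra a α (p + i) v) =
      ∑ c ∈ Finset.range M, ∑ d ∈ Finset.range M, (Ring.choose α c * Ring.choose β d) •
        ∑ i ∈ Finset.range N, ((-1 : ℂ) ^ (l + i) * Ring.choose (l : ℂ) i) •
          mode b (q + d + l - i) (mode a (p + c + i) v) := by
    simp only [Finset.smul_sum]
    rw [Finset.sum_congr rfl fun c _ => Finset.sum_comm, Finset.sum_comm]
    refine Finset.sum_congr rfl fun i hi => ?_
    rw [ha, map_sum, Finset.smul_sum]
    refine Finset.sum_congr rfl fun c _ => ?_
    rw [map_smul, hba i hi, Finset.smul_sum, Finset.smul_sum]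
    refine Finset.sum_congr rfl fun d _ => ?_
    rw [smul_smul, smul_smul, smul_smul, show q + l - (i : ℤ) + d = q + d + l - i by ring,
      show p + (i : ℤ) + c = p + c + i by ring]
    congr 1; ring
  have e3 : ∀ i ∈ Finset.range N, ∑ x ∈ Finset.HasAntidiagonal.antidiagonal i,
        (Ring.choose α x.1 * Ring.choose (p : ℂ) x.2) •
          bra (mode a (l + i) b) (α + β - x.1) (p + q - x.2) v =
      ∑ c ∈ Finset.range M, ∑ d ∈ Finset.range M, (Ring.choose α c * Ring.choose β d) •
        Ring.choose ((p + c : ℤ) : ℂ) i • mode (mode a (l + i) b) (p + c + (q + d) - i) v := by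
    intro i hi
    rw [Finset.mem_range] at hi
    have ht := mode_truncation (mode a (l + i) b) v
    -- The factor (p+c choose i) couples i to the expansion of (1+z)^α; collecting it into one
    -- series gives a divided derivative of z^p (1+z)^α, which the product rule splits over the
    -- antidiagonal.
    trans act (PowerSeries.mk (fun c : ℕ => Ring.choose α c * Ring.choose ((p : ℂ) + c) i) * bin β)
      (fun n => mode (mode a (l + i) b) n v) (p + q - i)
    · rw [mk_choose_mul_choose, Finset.sum_mul, act_sum_left _ _ ht]
      refine Finset.sum_congr rfl fun x hx => ?_
      rw [mul_assoc, act_C_mul _ _ ht, mul_assoc, act_X_pow_mul _ _ ht, ← bin_add, bra_apply]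
      rw [Finset.HasAntidiagonal.mem_antidiagonal] at hx
      rw [show α - (x.1 : ℂ) + β = α + β - x.1 by ring,
        show p + q - (i : ℤ) + (x.1 : ℤ) = p + q - x.2 by rw [← hx]; push_cast; ring]
    · have hv : ∀ n, p + q - (i : ℤ) + M ≤ n → mode (mode a (l + i) b) n v = 0 :=
        fun n hn => hM4 _ (by omega) n (by omega)
      rw [act_mul _ _ ht, act_eq_sum _ (N := M) fun n hn => act_eq_zero _ fun m hm => hv m (by omega)]
      refine Finset.sum_congr rfl fun c _ => ?_
      rw [act_eq_sum _ (N := M) fun n hn => hv n (by omega), Finset.smul_sum]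
      refine Finset.sum_congr rfl fun d _ => ?_
      rw [PowerSeries.coeff_mk, coeff_bin, smul_smul, smul_smul,
        show p + c + (q + d) - (i : ℤ) = p + q - i + c + d by ring]
      push_cast
      congr 1; ring
  rw [e1, e2, Finset.sum_congr rfl e3, ← Finset.sum_sub_distrib, Finset.sum_comm]
  refine Finset.sum_congr rfl fun c _ => ?_
  rw [← Finset.sum_sub_distrib, Finset.sum_comm]
  refine Finset.sum_congr rfl fun d _ => ?_
  rw [← smul_sub, ← Finset.smul_sum]
  congr 1
  -- For fixed c and d the coefficients are those of the Jacobi identity with indices p+c and q+d.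
  exact jacobi_sum a b v l (p + c) (q + d) N (fun k hk => hN1 k (by omega))
    (fun k hk => hN2 k (by omega)) hN3

end Modes

end

/-! ### Recovering an expansion from its residues. -/

section

section Expansion

variable {E : Type*} [AddCommGroup E] [Module ℂ E]

lemma negBin_neg_one : negBin (-1) = 1 - PowerSeries.X := by
  ext n
  have h := Ring.choose_natCast (R := ℂ) 1 n
  rw [Nat.cast_one] at h
  rw [coeff_negBin, neg_neg, h, map_sub, PowerSeries.coeff_one, PowerSeries.coeff_X]
  match n with
  | 0 => simp
  | 1 => simp
  | n + 2 => simp [Nat.choose_eq_zero_of_lt]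

lemma act_sub_left (c d : PowerSeries ℂ) {x : ℤ → E} (hx : ∃ P, ∀ n, P ≤ n → x n = 0) (p : ℤ) :
    act (c - d) x p = act c x p - act d x p := by
  have h := act_add_left (c - d) d hx p
  rw [sub_add_cancel] at h
  rw [h, add_sub_cancel_right]

lemma act_negBin_eq_sub (j : ℤ) {x : ℤ → E} (hx : ∃ P, ∀ n, P ≤ n → x n = 0) (p : ℤ) :
    act (negBin j) x p = act (negBin (j + 1 : ℤ)) x p - act (negBin (j + 1 : ℤ)) x (p + 1) := by
  have h1 : negBin (j : ℂ) = negBin (j + 1 : ℤ) - PowerSeries.X ^ 1 * negBin (j + 1 : ℤ) := by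
    have h : (j : ℂ) = -1 + (j + 1 : ℤ) := by push_cast; ring
    conv_lhs => rw [h, negBin_add, negBin_neg_one]
    ring
  rw [h1, act_sub_left _ _ hx, act_X_pow_mul _ _ hx, Nat.cast_one]

lemma act_negBin_neg_act (j : ℂ) {x : ℤ → E} (hx : ∃ P, ∀ n, P ≤ n → x n = 0) (p : ℤ) :
    act (negBin (-j)) (act (negBin j) x) p = x p := by
  rw [← act_mul _ _ hx, ← negBin_add, neg_add_cancel, negBin_zero, act_one _ hx]

/-- Multiplication by (1-X)^(-j) is invertible, and the single exponent j = N + max P Q suffices: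
for p ≤ max P Q the hypothesis applies, and for larger p both sequences vanish. -/
lemma act_negBin_injective {x y : ℤ → E} (hx : ∃ P, ∀ n, P ≤ n → x n = 0)
    (hy : ∃ P, ∀ n, P ≤ n → y n = 0) (N : ℤ)
    (h : ∀ p j : ℤ, N ≤ j - p → act (negBin j) x p = act (negBin j) y p) : x = y := by
  obtain ⟨P, hP⟩ := hx
  obtain ⟨Q, hQ⟩ := hy
  have h1 : act (negBin (N + max P Q : ℤ)) x = act (negBin (N + max P Q : ℤ)) y := by
    funext p
    by_cases hp : p ≤ max P Q
    · exact h p _ (by omega)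
    · rw [act_eq_zero _ fun n hn => hP n (by omega), act_eq_zero _ fun n hn => hQ n (by omega)]
  funext p
  rw [← act_negBin_neg_act ((N + max P Q : ℤ) : ℂ) ⟨P, hP⟩ p, h1, act_negBin_neg_act _ ⟨Q, hQ⟩]

/-- A family `μ p j` that behaves like the residues of `y^p (1-y)^(-j)` against a form which is
regular at the boundary points comes from the expansion of that form at `y = 0`. -/
lemma exists_expansion (μ : ℤ → ℤ → E) (hμ : ∀ p j, μ p j = μ p (j + 1) - μ (p + 1) (j + 1))
    (P J : ℤ) (h0 : ∀ p j, P ≤ p → J ≤ j - p → μ p j = 0) :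
    ∃ e : ℤ → E, (∀ k, P ≤ k → e k = 0) ∧
      ∀ p j : ℤ, J ≤ j - p → μ p j = act (negBin j) e p := by
  -- The row j = J + P lies in the permitted range for every p < P. Multiplying it by (1-y)^(J+P)
  -- gives the only possible candidate for e.
  set x : ℤ → E := fun p => if p < P then μ p (J + P) else 0 with hxdef
  have hx0 : ∀ k, P ≤ k → x k = 0 := fun k hk => if_neg (not_lt.mpr hk)
  have hx : ∃ P, ∀ n, P ≤ n → x n = 0 := ⟨P, hx0⟩
  set e : ℤ → E := act (negBin (-(J + P : ℤ))) x with hedef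
  have he0 : ∀ k, P ≤ k → e k = 0 := fun k hk => act_eq_zero _ fun m hm => hx0 m (hk.trans hm)
  have he : ∃ P, ∀ n, P ≤ n → e n = 0 := ⟨P, he0⟩
  have hex : ∀ p, act (negBin (J + P : ℤ)) e p = x p := fun p => by
    have := act_negBin_neg_act (-((J + P : ℤ) : ℂ)) hx p
    rwa [neg_neg] at this
  refine ⟨e, he0, ?_⟩
  have key : ∀ k : ℕ, ∀ p, P - k ≤ p → ∀ j : ℤ, J ≤ j - p → μ p j = act (negBin j) e p := by
    intro k
    induction k with
    | zero =>
      intro p hp j hj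
      rw [h0 p j (by simpa using hp) hj, act_eq_zero _ fun m hm => he0 m (by push_cast at hp; omega)]
    | succ k ih =>
      intro p hp j hj
      by_cases hpk : P - k ≤ p
      · exact ih p hpk j hj
      -- Both sides satisfy the same recursion and agree at p+1, so their difference at p does not
      -- depend on j; at j = J + P it is zero by the choice of e.
      have hstep : ∀ j : ℤ, p + J ≤ j → μ p j - act (negBin j) e p =
          μ p (p + J) - act (negBin (p + J : ℤ)) e p := by
        intro j hj
        induction j, hj using Int.leInduction with
        | base => rfl
        | succ j hj ih' =>
          rw [← ih', hμ p j, act_negBin_eq_sub j he p,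
            ih (p + 1) (by push_cast at hp; omega) (j + 1) (by omega)]
          abel
      have h1 := hstep j (by omega)
      rw [← hstep (J + P) (by omega), hex, hxdef] at h1
      simp only at h1
      rw [if_pos (by omega), sub_self] at h1
      exact sub_eq_zero.mp h1
  intro p j hj
  exact key (P - p).toNat p (by omega) j hj

end Expansion

end

/-! ### Eigenspaces of g and the projections onto them. -/

section

/-- The number `e^{2πin}`. -/
def root (n : ℚ) : ℂ := Complex.exp (2 * Real.pi * Complex.I * (n : ℂ))

lemma root_add (m n : ℚ) : root (m + n) = root m * root n := by
  rw [root, root, root, ← Complex.exp_add]; push_cast; ring_nf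

lemma root_intCast (k : ℤ) : root k = 1 := by
  rw [root, Complex.exp_eq_one_iff]; exact ⟨k, by push_cast; ring⟩

lemma root_zero : root 0 = 1 := by simp [root]

lemma root_eq_one_iff (n : ℚ) : root n = 1 ↔ ∃ k : ℤ, n = k := by
  rw [root, Complex.exp_eq_one_iff]
  constructor
  · rintro ⟨k, hk⟩
    refine ⟨k, ?_⟩
    have : (2 * Real.pi * Complex.I : ℂ) ≠ 0 := Complex.two_pi_I_ne_zero
    have h : (n : ℂ) = (k : ℂ) := by
      apply mul_left_cancel₀ this; rw [hk]; ring
    exact_mod_cast h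
  · rintro ⟨k, rfl⟩; exact ⟨k, by push_cast; ring⟩

lemma root_pow (n : ℚ) (k : ℕ) : root n ^ k = root (n * k) := by
  rw [root, root, ← Complex.exp_nat_mul]; push_cast; ring_nf

lemma root_add_int (n : ℚ) (k : ℤ) : root (n + k) = root n := by
  rw [root_add, root_intCast, mul_one]

section Sectors

variable {V : Type u} [AddCommGroup V] [Module ℂ V]

/-- The eigenspace of `g` for the eigenvalue `e^{2πin}`. -/
def sector (g : V ≃ₗ[ℂ] V) (n : ℚ) : Submodule ℂ V :=
  Module.End.eigenspace (g : Module.End ℂ V) (root n)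

variable {g : V ≃ₗ[ℂ] V}

lemma mem_sector {n : ℚ} {a : V} : a ∈ sector g n ↔ g a = root n • a := by
  rw [sector, Module.End.mem_eigenspace_iff]; rfl

lemma sector_add_int (n : ℚ) (k : ℤ) : sector g (n + k) = sector g n := by
  rw [sector, sector, root_add_int]

lemma twistedSector_eq (r : ℕ) : twistedSector g r = sector g ((r : ℚ) / orderOf g) := by
  rw [twistedSector, sector, root]
  congr 2
  push_cast
  ring

lemma pow_apply_of_mem {n : ℚ} {a : V} (ha : a ∈ sector g n) (j : ℕ) :
    (g ^ j) a = root (n * j) • a := by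
  induction j with
  | zero => simp [root_zero]
  | succ j ih =>
    rw [pow_succ', LinearEquiv.mul_apply, ih, map_smul, mem_sector.mp ha, smul_smul, ← root_add]
    congr 2; push_cast; ring

lemma eq_zero_or_of_mem_sector {n : ℚ} {a : V} (ha : a ∈ sector g n) :
    a = 0 ∨ ∃ k : ℤ, n * orderOf g = k := by
  have h := pow_apply_of_mem ha (orderOf g)
  rw [pow_orderOf_eq_one, LinearEquiv.coe_one, id] at h
  rw [← root_eq_one_iff, or_iff_not_imp_left]
  intro h0
  by_contra h1
  have : (root (n * orderOf g) - 1) • a = 0 := by rw [sub_smul, ← h, one_smul, sub_self]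
  rcases smul_eq_zero.mp this with h2 | h2
  · exact h1 (sub_eq_zero.mp h2)
  · exact h0 h2

lemma exists_eq_of_mem_sector (hT : IsOfFinOrder g) {m : ℚ} {u : V} (hu : u ∈ sector g m) :
    u = 0 ∨ ∃ (r : ℕ) (k : ℤ), r < orderOf g ∧ u ∈ twistedSector g r ∧
      m = (r : ℚ) / orderOf g + k := by
  refine (eq_zero_or_of_mem_sector hu).imp_right ?_
  rintro ⟨k, hk⟩
  have hpos : (0 : ℤ) < orderOf g := by exact_mod_cast hT.orderOf_pos
  have h0 : (orderOf g : ℚ) ≠ 0 := Nat.cast_ne_zero.mpr hT.orderOf_pos.ne'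
  have hm : m = ((k % orderOf g).toNat : ℚ) / orderOf g + (k / orderOf g : ℤ) := by
    have h1 : (((k % orderOf g).toNat : ℤ) : ℚ) = ((k - orderOf g * (k / orderOf g) : ℤ) : ℚ) := by
      rw [Int.toNat_of_nonneg (Int.emod_nonneg _ hpos.ne'), Int.emod_def]
    push_cast at h1
    rw [h1, eq_comm]
    field_simp
    rw [← hk]
    ring
  refine ⟨(k % orderOf g).toNat, k / orderOf g, ?_, ?_, hm⟩
  · have := Int.emod_lt_of_pos k hpos
    have := Int.emod_nonneg k hpos.ne'
    omega
  · rw [twistedSector_eq, ← sector_add_int _ (k / orderOf g), ← hm]; exact hu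

open Classical in
/-- The projection of `V` onto the eigenspace of `g` for `e^{2πin}`. -/
def proj (g : V ≃ₗ[ℂ] V) (n : ℚ) : Module.End ℂ V :=
  if ∃ k : ℤ, n * orderOf g = k then
    (orderOf g : ℂ)⁻¹ • ∑ j ∈ Finset.range (orderOf g), root (-(n * j)) •
      ((g ^ j : V ≃ₗ[ℂ] V) : Module.End ℂ V)
  else 0

lemma proj_apply {n : ℚ} (hn : ∃ k : ℤ, n * orderOf g = k) (a : V) :
    proj g n a = (orderOf g : ℂ)⁻¹ • ∑ j ∈ Finset.range (orderOf g), root (-(n * j)) • (g ^ j) a := by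
  rw [proj, if_pos hn]
  simp [LinearMap.sum_apply]

lemma proj_mem (n : ℚ) (a : V) : proj g n a ∈ sector g n := by
  by_cases hn : ∃ k : ℤ, n * orderOf g = k
  · rw [mem_sector, proj_apply hn, map_smul, map_sum, smul_comm]
    congr 1
    set x : ℕ → V := fun j => root (-(n * j)) • (g ^ j) a with hx
    have h1 : ∀ j, g (x j) = root n • x (j + 1) := fun j => by
      rw [hx]; simp only
      rw [map_smul, smul_smul, ← root_add, pow_succ', LinearEquiv.mul_apply]
      congr 2; push_cast; ring
    have h2 : x (orderOf g) = x 0 := by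
      rw [hx]; simp only
      obtain ⟨k, hk⟩ := hn
      rw [pow_orderOf_eq_one, hk, show (-(k : ℚ)) = ((-k : ℤ) : ℚ) by push_cast; rfl, root_intCast]
      simp [root_zero]
    change ∑ j ∈ Finset.range (orderOf g), g (x j) = root n • ∑ j ∈ Finset.range (orderOf g), x j
    rw [Finset.sum_congr rfl fun j _ => h1 j, ← Finset.smul_sum]
    congr 1
    have := (Finset.sum_range_succ' x (orderOf g)).symm.trans (Finset.sum_range_succ x (orderOf g))
    rw [h2] at this
    exact add_right_cancel this
  · rw [proj, if_neg hn]; exact Submodule.zero_mem _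

lemma proj_add_int (n : ℚ) (k : ℤ) : proj g (n + k) = proj g n := by
  have hiff : (∃ l : ℤ, (n + k) * orderOf g = l) ↔ ∃ l : ℤ, n * orderOf g = l := by
    constructor
    · rintro ⟨l, hl⟩; exact ⟨l - k * orderOf g, by push_cast; rw [← hl]; ring⟩
    · rintro ⟨l, hl⟩; exact ⟨l + k * orderOf g, by push_cast; rw [← hl]; ring⟩
  by_cases hn : ∃ l : ℤ, n * orderOf g = l
  · ext a
    rw [proj_apply hn, proj_apply (hiff.mpr hn)]
    congr 1
    refine Finset.sum_congr rfl fun j _ => ?_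
    rw [show -((n + k) * (j : ℚ)) = -(n * j) + ((-k * j : ℤ) : ℚ) by push_cast; ring, root_add_int]
  · rw [proj, if_neg (hiff.not.mpr hn), proj, if_neg hn]

lemma proj_of_mem (hT : IsOfFinOrder g) {n : ℚ} {a : V} (ha : a ∈ sector g n) : proj g n a = a := by
  rcases eq_zero_or_of_mem_sector ha with rfl | hn
  · rw [map_zero]
  · rw [proj_apply hn, Finset.sum_congr rfl fun j _ => by
      rw [pow_apply_of_mem ha, smul_smul, ← root_add, neg_add_cancel, root_zero, one_smul]]
    rw [Finset.sum_const, Finset.card_range, ← Nat.cast_smul_eq_nsmul ℂ, smul_smul,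
      inv_mul_cancel₀ (Nat.cast_ne_zero.mpr hT.orderOf_pos.ne'), one_smul]

lemma proj_of_mem_of_ne {m n : ℚ} {a : V} (ha : a ∈ sector g m)
    (h : ∀ k : ℤ, n ≠ m + k) : proj g n a = 0 := by
  by_cases hn : ∃ k : ℤ, n * orderOf g = k
  · rcases eq_zero_or_of_mem_sector ha with rfl | hm
    · rw [map_zero]
    obtain ⟨k, hk⟩ := hn
    obtain ⟨l, hl⟩ := hm
    have h1 : root (m - n) ≠ 1 := by
      rw [Ne, root_eq_one_iff]
      rintro ⟨k, hk⟩
      exact h (-k) (by push_cast; linarith)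
    rw [proj_apply ⟨k, hk⟩, Finset.sum_congr rfl fun j _ => by
      rw [pow_apply_of_mem ha, smul_smul, ← root_add, show -(n * (j : ℚ)) + m * j = (m - n) * j by ring,
        ← root_pow], ← Finset.sum_smul, geom_sum_eq h1, root_pow, sub_mul, hl, hk]
    rw [show (l : ℚ) - k = ((l - k : ℤ) : ℚ) by push_cast; rfl, root_intCast]
    simp
  · rw [proj, if_neg hn]; rfl

/-- After exchanging the sums, the geometric sums of e^{-2πirj/T} over r vanish for 0 < j < T, and
only j = 0 remains. -/
lemma sum_proj (hT : IsOfFinOrder g) (a : V) :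
    ∑ r ∈ Finset.range (orderOf g), proj g ((r : ℚ) / orderOf g) a = a := by
  have h0 : (orderOf g : ℚ) ≠ 0 := Nat.cast_ne_zero.mpr hT.orderOf_pos.ne'
  have h0' : (orderOf g : ℂ) ≠ 0 := Nat.cast_ne_zero.mpr hT.orderOf_pos.ne'
  rw [Finset.sum_congr rfl fun (r : ℕ) _ =>
    proj_apply (n := (r : ℚ) / orderOf g) ⟨(r : ℕ), by rw [div_mul_cancel₀ _ h0]; simp⟩ a]
  rw [← Finset.smul_sum, Finset.sum_comm, Finset.sum_eq_single 0]
  · simp only [Nat.cast_zero, mul_zero, neg_zero, root_zero, one_smul, pow_zero]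
    rw [Finset.sum_const, Finset.card_range, ← Nat.cast_smul_eq_nsmul ℂ, smul_smul,
      inv_mul_cancel₀ h0']
    simp
  · intro j hj hj0
    rw [Finset.mem_range] at hj
    rw [← Finset.sum_smul, Finset.sum_congr rfl fun (r : ℕ) _ => show
      root (-((r : ℚ) / orderOf g * j)) = root (-(j / orderOf g)) ^ r by
        rw [root_pow]; congr 1; ring]
    have h1 : root (-((j : ℚ) / orderOf g)) ≠ 1 := by
      rw [Ne, root_eq_one_iff]
      rintro ⟨k, hk⟩
      have h2 : ((j : ℤ) : ℚ) = ((-k * orderOf g : ℤ) : ℚ) := by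
        push_cast; rw [← hk]; field_simp
      have h3 : (j : ℤ) = -k * orderOf g := by exact_mod_cast h2
      have h4 : (orderOf g : ℤ) ∣ j := ⟨-k, by rw [h3]; ring⟩
      have h5 := Nat.le_of_dvd (Nat.pos_of_ne_zero hj0) (Int.natCast_dvd_natCast.mp h4)
      omega
    rw [geom_sum_eq h1, root_pow, show -((j : ℚ) / orderOf g) * orderOf g = ((-j : ℤ) : ℚ) by
      push_cast; field_simp, root_intCast]
    simp
  · intro h; exact absurd (Finset.mem_range.mpr hT.orderOf_pos) h

/-- An additive property that holds on all sectors holds everywhere. -/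
lemma sector_induction (hT : IsOfFinOrder g) (P : Submodule ℂ V) (h : ∀ n : ℚ, sector g n ≤ P)
    (a : V) : a ∈ P := by
  rw [← sum_proj hT a]
  exact Submodule.sum_mem _ fun r _ => h _ (proj_mem _ _)

end Sectors

variable {V : Type u} [AddCommGroup V] [Module ℂ V] [VertexOperatorAlgebra V]
  {g : V ≃ₗ[ℂ] V}

lemma mode_mem_sector (hg : IsAutomorphism g) {m n : ℚ} {a b : V} (ha : a ∈ sector g m)
    (hb : b ∈ sector g n) (i : ℤ) : mode a i b ∈ sector g (m + n) := by
  rw [mem_sector] at *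
  rw [hg.map_mode, ha, hb, mode_smul_left, map_smul, LinearMap.smul_apply, smul_smul, root_add,
    mul_comm]

end

/-! ### The regular dual and its modes. -/

section

variable {V : Type u} [AddCommGroup V] [Module ℂ V] [VertexOperatorAlgebra V]
  {g : V ≃ₗ[ℂ] V}

/-- The functional `f` kills `Res_z (1+z)^(n+p) z^(-j) Y(a,z)v` for all `p ≥ P` and `j-p ≥ J`, i.e.
the form `f(Y(a,z)v)` has bounded poles at `z = -1` and at infinity, uniformly in `v`. -/
def IsBounded (f : Module.Dual ℂ V) (a : V) (n : ℚ) (P J : ℤ) : Prop :=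
  ∀ p j : ℤ, P ≤ p → J ≤ j - p → f ∘ₗ bra a ((n : ℂ) + p) (-j) = 0

lemma IsBounded.mono {f : Module.Dual ℂ V} {a : V} {n : ℚ} {P J P' J' : ℤ}
    (h : IsBounded f a n P J) (hP : P ≤ P') (hJ : J ≤ J') : IsBounded f a n P' J' :=
  fun p j hp hj => h p j (hP.trans hp) (hJ.trans hj)

lemma IsBounded.add {f f' : Module.Dual ℂ V} {a : V} {n : ℚ} {P J : ℤ}
    (h : IsBounded f a n P J) (h' : IsBounded f' a n P J) : IsBounded (f + f') a n P J :=
  fun p j hp hj => by rw [LinearMap.add_comp, h p j hp hj, h' p j hp hj, add_zero]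

lemma IsBounded.add_vector {f : Module.Dual ℂ V} {a b : V} {n : ℚ} {P J : ℤ}
    (h : IsBounded f a n P J) (h' : IsBounded f b n P J) : IsBounded f (a + b) n P J :=
  fun p j hp hj => by
    rw [bra_add_left, LinearMap.comp_add, h p j hp hj, h' p j hp hj, add_zero]

lemma IsBounded.smul {f : Module.Dual ℂ V} {a : V} {n : ℚ} {P J : ℤ} (c : ℂ)
    (h : IsBounded f a n P J) : IsBounded (c • f) a n P J :=
  fun p j hp hj => by rw [LinearMap.smul_comp, h p j hp hj, smul_zero]

lemma exists_uniform_isBounded {f : Module.Dual ℂ V} {n : ℚ} {a : ℕ → V}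
    (h : ∀ i, ∃ P J, IsBounded f (a i) n P J) (I : ℕ) :
    ∃ P J, ∀ i < I, IsBounded f (a i) n P J := by
  induction I with
  | zero => exact ⟨0, 0, fun i hi => absurd hi (by omega)⟩
  | succ I ih =>
    obtain ⟨P, J, hPJ⟩ := ih
    obtain ⟨P', J', hPJ'⟩ := h I
    refine ⟨max P P', max J J', fun i hi => ?_⟩
    rcases Nat.lt_succ_iff_lt_or_eq.mp hi with hi | rfl
    · exact (hPJ i hi).mono (le_max_left _ _) (le_max_left _ _)
    · exact hPJ'.mono (le_max_right _ _) (le_max_right _ _)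

/-- The functionals `f` on `V` for which all forms `f(Y(a,z)v)` have uniformly bounded poles. -/
def regularDual (g : V ≃ₗ[ℂ] V) : Submodule ℂ (Module.Dual ℂ V) where
  carrier := {f | ∀ n : ℚ, ∀ a ∈ sector g n, ∃ P J, IsBounded f a n P J}
  zero_mem' := fun n a _ => ⟨0, 0, fun p j _ _ => LinearMap.zero_comp _⟩
  add_mem' := by
    intro f f' h h' n a ha
    obtain ⟨P, J, h1⟩ := h n a ha
    obtain ⟨P', J', h2⟩ := h' n a ha
    exact ⟨max P P', max J J', (h1.mono (le_max_left _ _) (le_max_left _ _)).add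
      (h2.mono (le_max_right _ _) (le_max_right _ _))⟩
  smul_mem' := by
    intro c f h n a ha
    obtain ⟨P, J, h1⟩ := h n a ha
    exact ⟨P, J, h1.smul c⟩

lemma bra_commutator (a b v : V) (p q : ℤ) (α β : ℂ) :
    bra a α p (bra b β q v) - bra b β q (bra a α p v)
      = ∑ᶠ i : ℕ, ∑ x ∈ Finset.HasAntidiagonal.antidiagonal i,
        (Ring.choose α x.1 * Ring.choose (p : ℂ) x.2) •
          bra (mode a i b) (α + β - x.1) (p + q - x.2) v := by
  have h := bra_jacobi a b v 0 p q α β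
  rw [finsum_eq_single _ 0, finsum_eq_single _ 0] at h
  · simpa using h
  · intro i hi
    rw [Int.cast_zero, Ring.choose_zero_pos ℂ (Nat.pos_of_ne_zero hi)]; simp
  · intro i hi
    rw [Int.cast_zero, Ring.choose_zero_pos ℂ (Nat.pos_of_ne_zero hi)]; simp

/-- In f(Y(a)Y(b)v) the operator of b can be moved next to f, where the bounds for f and b apply;
the commutator involves only the finitely many nonzero a_i b with i ≥ 0. -/
lemma comp_bra_mem_regularDual (hg : IsAutomorphism g) {f : Module.Dual ℂ V}
    (hf : f ∈ regularDual g) {m : ℚ} {a : V} (ha : a ∈ sector g m) (s q : ℤ) :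
    f ∘ₗ bra a ((m : ℂ) + s) q ∈ regularDual g := by
  intro n b hb
  obtain ⟨P, J, h1⟩ := hf n b hb
  obtain ⟨I, hI⟩ := mode_truncation a b
  obtain ⟨P', J', h2⟩ := exists_uniform_isBounded (a := fun i : ℕ => mode a i b)
    (fun i => hf (m + n) _ (mode_mem_sector hg ha hb i)) I.toNat
  -- In the commutator the exponent of 1+z drops by x.1 ≤ i < I, and that of z is shifted by q.
  refine ⟨max P (P' - s + I.toNat), max J (J' + q + s), fun p j hp hj => ?_⟩
  ext v
  have hc := congrArg f (bra_commutator a b v q (-j) ((m : ℂ) + s) ((n : ℂ) + p))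
  have h3 := LinearMap.congr_fun (h1 p j (by omega) (by omega)) (bra a ((m : ℂ) + s) q v)
  simp only [LinearMap.comp_apply, LinearMap.zero_apply] at h3 ⊢
  rw [map_sub, h3, sub_zero] at hc
  rw [hc, finsum_eq_sum_range (N := I.toNat), map_sum]
  · refine Finset.sum_eq_zero fun i hi => ?_
    rw [map_sum]
    refine Finset.sum_eq_zero fun x hx => ?_
    rw [Finset.mem_range] at hi
    rw [Finset.HasAntidiagonal.mem_antidiagonal] at hx
    rw [map_smul]
    have h4 := LinearMap.congr_fun (h2 i hi (s + p - x.1) (j + x.2 - q) (by omega) (by omega)) v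
    rw [show (m : ℂ) + s + (n + p) - x.1 = ((m + n : ℚ) : ℂ) + (s + p - x.1 : ℤ) by push_cast; ring,
      show q + -j - (x.2 : ℤ) = -(j + x.2 - q) by ring]
    rw [LinearMap.comp_apply] at h4
    rw [h4, LinearMap.zero_apply, smul_zero]
  · intro i hi
    refine Finset.sum_eq_zero fun x _ => ?_
    rw [hI i (by omega), bra_zero_left, LinearMap.zero_apply, smul_zero]

/-- `e` is the family of coefficients of the expansion at `z = -1`, in powers of `y = 1+z`, of the
form `-f(Y(a,z)v)`. -/
def IsExpansion (f : Module.Dual ℂ V) (a : V) (n : ℚ) (e : ℤ → Module.Dual ℂ V) : Prop :=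
  (∃ P, ∀ k, P ≤ k → e k = 0) ∧ ∃ N : ℤ, ∀ p j : ℤ, N ≤ j - p →
    f ∘ₗ bra a ((n : ℂ) + p) (-j) = (-(-1 : ℂ) ^ j) • act (negBin j) e p

/-- The sign in `IsExpansion` has two sources: z^(-j) = (-1)^j (1-y)^(-j) with y = 1+z, and the
residue at z = 0 is minus the residue at y = 0 once N ≤ j - p removes the pole at infinity. -/
lemma neg_neg_one_zpow_ne_zero (j : ℤ) : (-(-1 : ℂ) ^ j) ≠ 0 :=
  neg_ne_zero.mpr (zpow_ne_zero _ (by norm_num))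

lemma IsExpansion.unique {f : Module.Dual ℂ V} {a : V} {n : ℚ} {e e' : ℤ → Module.Dual ℂ V}
    (h : IsExpansion f a n e) (h' : IsExpansion f a n e') : e = e' := by
  obtain ⟨he, N, hN⟩ := h
  obtain ⟨he', N', hN'⟩ := h'
  refine act_negBin_injective he he' (max N N') fun p j hj => ?_
  have := (hN p j (by omega)).symm.trans (hN' p j (by omega))
  exact smul_right_injective _ (neg_neg_one_zpow_ne_zero j) this

lemma IsExpansion.zero_vector (f : Module.Dual ℂ V) (n : ℚ) : IsExpansion f (0 : V) n 0 := by
  refine ⟨⟨0, fun _ _ => rfl⟩, 0, fun p j _ => ?_⟩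
  rw [bra_zero_left, LinearMap.comp_zero, act_eq_zero _ (x := 0) fun _ _ => rfl, smul_zero]

lemma IsExpansion.add {f f' : Module.Dual ℂ V} {a : V} {n : ℚ} {e e' : ℤ → Module.Dual ℂ V}
    (h : IsExpansion f a n e) (h' : IsExpansion f' a n e') :
    IsExpansion (f + f') a n (fun k => e k + e' k) := by
  obtain ⟨⟨P, hP⟩, N, hN⟩ := h
  obtain ⟨⟨P', hP'⟩, N', hN'⟩ := h'
  refine ⟨⟨max P P', fun k hk => by simp only; rw [hP k (by omega), hP' k (by omega), add_zero]⟩,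
    max N N', fun p j hj => ?_⟩
  rw [LinearMap.add_comp, hN p j (by omega), hN' p j (by omega), act_add_right _ ⟨P, hP⟩ ⟨P', hP'⟩,
    smul_add]

lemma IsExpansion.add_vector {f : Module.Dual ℂ V} {a b : V} {n : ℚ} {e e' : ℤ → Module.Dual ℂ V}
    (h : IsExpansion f a n e) (h' : IsExpansion f b n e') :
    IsExpansion f (a + b) n (fun k => e k + e' k) := by
  obtain ⟨⟨P, hP⟩, N, hN⟩ := h
  obtain ⟨⟨P', hP'⟩, N', hN'⟩ := h'
  refine ⟨⟨max P P', fun k hk => by simp only; rw [hP k (by omega), hP' k (by omega), add_zero]⟩,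
    max N N', fun p j hj => ?_⟩
  rw [bra_add_left, LinearMap.comp_add, hN p j (by omega), hN' p j (by omega),
    act_add_right _ ⟨P, hP⟩ ⟨P', hP'⟩, smul_add]

lemma act_smul_right {E : Type*} [AddCommGroup E] [Module ℂ E] (b : ℂ) (c : PowerSeries ℂ)
    {x : ℤ → E} (hx : ∃ P, ∀ n, P ≤ n → x n = 0) (p : ℤ) :
    act c (fun n => b • x n) p = b • act c x p :=
  (map_act (b • LinearMap.id) c hx p).symm

lemma IsExpansion.smul {f : Module.Dual ℂ V} {a : V} {n : ℚ} {e : ℤ → Module.Dual ℂ V}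
    (c : ℂ) (h : IsExpansion f a n e) : IsExpansion (c • f) a n (fun k => c • e k) := by
  obtain ⟨⟨P, hP⟩, N, hN⟩ := h
  refine ⟨⟨P, fun k hk => by simp only; rw [hP k hk, smul_zero]⟩, N, fun p j hj => ?_⟩
  rw [LinearMap.smul_comp, hN p j hj, act_smul_right c _ ⟨P, hP⟩, smul_comm]

lemma IsExpansion.smul_vector {f : Module.Dual ℂ V} {a : V} {n : ℚ} {e : ℤ → Module.Dual ℂ V}
    (c : ℂ) (h : IsExpansion f a n e) : IsExpansion f (c • a) n (fun k => c • e k) := by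
  obtain ⟨⟨P, hP⟩, N, hN⟩ := h
  refine ⟨⟨P, fun k hk => by simp only; rw [hP k hk, smul_zero]⟩, N, fun p j hj => ?_⟩
  rw [bra_smul_left, LinearMap.comp_smul, hN p j hj, act_smul_right c _ ⟨P, hP⟩, smul_comm]

lemma IsExpansion.shift {f : Module.Dual ℂ V} {a : V} {n : ℚ} {e : ℤ → Module.Dual ℂ V}
    (h : IsExpansion f a n e) (l : ℤ) : IsExpansion f a (n + l) (fun k => e (l + k)) := by
  obtain ⟨⟨P, hP⟩, N, hN⟩ := h
  refine ⟨⟨P - l, fun k hk => hP _ (by omega)⟩, N + l, fun p j hj => ?_⟩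
  have := hN (l + p) j (by omega)
  rw [show ((n + l : ℚ) : ℂ) + p = (n : ℂ) + (l + p : ℤ) by push_cast; ring, this]
  simp only [act, add_assoc]

/-- Up to sign the residues satisfy the recursion required by
`VertexOperatorAlgebra.exists_expansion`, because multiplying by 1+z adds two consecutive powers of
z. The explicit bounds P and J are kept because they identify individual modes later. -/
lemma IsBounded.exists_expansion {f : Module.Dual ℂ V} {a : V} {n : ℚ} {P J : ℤ}
    (h : IsBounded f a n P J) : ∃ e, IsExpansion f a n e ∧ (∀ k, P ≤ k → e k = 0) ∧
      ∀ p j : ℤ, J ≤ j - p →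
        f ∘ₗ bra a ((n : ℂ) + p) (-j) = (-(-1 : ℂ) ^ j) • act (negBin j) e p := by
  have hsq : ∀ j : ℤ, (-(-1 : ℂ) ^ j) * (-(-1 : ℂ) ^ j) = 1 := fun j => by
    rw [neg_mul_neg, ← zpow_add₀ (by norm_num), ← two_mul, zpow_mul]; norm_num
  obtain ⟨e, he, h2⟩ := VertexOperatorAlgebra.exists_expansion
    (fun p j => (-(-1 : ℂ) ^ j) • (f ∘ₗ bra a ((n : ℂ) + p) (-j)))
    (fun p j => by
      have h1 := bra_one_add_exponent a ((n : ℂ) + p) (-(j + 1))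
      rw [show -(j + 1) + 1 = -j by ring] at h1
      rw [show (n : ℂ) + (p + 1 : ℤ) = 1 + (n + p) by push_cast; ring, h1, LinearMap.comp_add,
        zpow_add_one₀ (by norm_num : (-1 : ℂ) ≠ 0)]
      module) P J
    (fun p j hp hj => by rw [h p j hp hj, smul_zero])
  have h3 : ∀ p j : ℤ, J ≤ j - p →
        f ∘ₗ bra a ((n : ℂ) + p) (-j) = (-(-1 : ℂ) ^ j) • act (negBin j) e p := fun p j hj => by
    rw [← h2 p j hj, smul_smul, hsq, one_smul]
  exact ⟨e, ⟨⟨P, he⟩, J, h3⟩, he, h3⟩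

open Classical in
/-- The functional `aₙ f`: the coefficient of `y^(-n-1)` in the expansion of `-f(Y(a,y-1)⬝)`. -/
def dualMode (g : V ≃ₗ[ℂ] V) (a : V) (n : ℚ) (f : Module.Dual ℂ V) : Module.Dual ℂ V :=
  if h : ∃ e, IsExpansion f (proj g n a) n e then h.choose 0 else 0

/-- Uniqueness makes the choice in `dualMode` harmless, and replacing n by n+k only shifts the
index, so one expansion yields all modes in the class of n. -/
lemma IsExpansion.dualMode_eq {f : Module.Dual ℂ V} {a : V} {n : ℚ} {e : ℤ → Module.Dual ℂ V}
    (h : IsExpansion f (proj g n a) n e) (k : ℤ) : dualMode g a (n + k) f = e k := by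
  have h1 : IsExpansion f (proj g (n + k) a) (n + k) (fun l => e (k + l)) := by
    rw [proj_add_int]; exact h.shift k
  have h2 : ∃ e, IsExpansion f (proj g (n + k) a) (n + k) e := ⟨_, h1⟩
  rw [dualMode, dif_pos h2, h2.choose_spec.unique h1]
  simp only [add_zero]

lemma isExpansion_dualMode {f : Module.Dual ℂ V} (hf : f ∈ regularDual g) (a : V) (n : ℚ) :
    IsExpansion f (proj g n a) n (fun k => dualMode g a (n + k) f) := by
  obtain ⟨P, J, h⟩ := hf n _ (proj_mem n a)
  obtain ⟨e, he, -⟩ := h.exists_expansion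
  rwa [show (fun k : ℤ => dualMode g a (n + k) f) = e from funext fun k => he.dualMode_eq k]

lemma IsExpansion.dualMode_eq_zero {f : Module.Dual ℂ V} {a : V} {n : ℚ} {e : ℤ → Module.Dual ℂ V}
    (h : IsExpansion f (proj g n a) n e) : dualMode g a n f = e 0 := by
  have := h.dualMode_eq 0
  rwa [Int.cast_zero, add_zero] at this

lemma dualMode_add {f f' : Module.Dual ℂ V} (hf : f ∈ regularDual g) (hf' : f' ∈ regularDual g)
    (a : V) (n : ℚ) : dualMode g a n (f + f') = dualMode g a n f + dualMode g a n f' := by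
  have h := ((isExpansion_dualMode hf a n).add (isExpansion_dualMode hf' a n)).dualMode_eq_zero
  simpa using h

lemma dualMode_smul {f : Module.Dual ℂ V} (hf : f ∈ regularDual g) (c : ℂ)
    (a : V) (n : ℚ) : dualMode g a n (c • f) = c • dualMode g a n f := by
  have h := ((isExpansion_dualMode hf a n).smul c).dualMode_eq_zero
  simpa using h

lemma dualMode_add_vector {f : Module.Dual ℂ V} (hf : f ∈ regularDual g)
    (a b : V) (n : ℚ) : dualMode g (a + b) n f = dualMode g a n f + dualMode g b n f := by
  have h := (isExpansion_dualMode hf a n).add_vector (isExpansion_dualMode hf b n)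
  rw [← map_add] at h
  simpa using h.dualMode_eq_zero

lemma dualMode_smul_vector {f : Module.Dual ℂ V} (hf : f ∈ regularDual g) (c : ℂ)
    (a : V) (n : ℚ) : dualMode g (c • a) n f = c • dualMode g a n f := by
  have h := (isExpansion_dualMode hf a n).smul_vector c
  rw [← map_smul] at h
  simpa using h.dualMode_eq_zero

lemma dualMode_eq_zero {a : V} {m n : ℚ} (ha : a ∈ sector g m) (h : ∀ k : ℤ, n ≠ m + k)
    (f : Module.Dual ℂ V) : dualMode g a n f = 0 := by
  have h1 := IsExpansion.zero_vector f n
  rw [← proj_of_mem_of_ne ha h] at h1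
  exact h1.dualMode_eq_zero

/-- The residue f ∘ `bra` is, up to sign, the mode at p plus a combination of modes of higher index.
As residues stay in `regularDual`, so do the modes, by descending induction from the index where
they vanish. -/
lemma dualMode_mem (hg : IsAutomorphism g) {f : Module.Dual ℂ V} (hf : f ∈ regularDual g)
    (a : V) (n : ℚ) : dualMode g a n f ∈ regularDual g := by
  obtain ⟨⟨P, hP⟩, N, hN⟩ := isExpansion_dualMode hf a n
  have key : ∀ k : ℕ, ∀ p, P - k ≤ p → dualMode g a (n + p) f ∈ regularDual g := by
    intro k
    induction k with
    | zero =>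
      intro p hp
      have h0 : dualMode g a (n + p) f = 0 := hP p (by simpa using hp)
      rw [h0]; exact Submodule.zero_mem _
    | succ k ih =>
      intro p hp
      have h1 := hN p (p + N) (by omega)
      have h2 : act (negBin ((p + N : ℤ) : ℂ)) (fun k : ℤ => dualMode g a (n + k) f) p ∈
          regularDual g := by
        have h3 := comp_bra_mem_regularDual hg hf (proj_mem n a) p (-(p + N))
        rw [h1] at h3
        exact (Submodule.smul_mem_iff _ (neg_neg_one_zpow_ne_zero _)).mp h3
      rw [act_eq_sum _ (N := k + 1) fun m hm => hP m (by omega), Finset.sum_range_succ'] at h2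
      have h3 := (Submodule.add_mem_iff_right _ (Submodule.sum_mem _ fun i _ =>
        Submodule.smul_mem _ _ (ih (p + (i + 1 : ℕ)) (by push_cast at hp ⊢; omega)))).mp h2
      simpa using h3
  have := key P.toNat 0 (by omega)
  simpa using this

end

/-! ### Double sequences and products of two modes. -/

section

section DoubleAction

variable {E : Type*} [AddCommGroup E]

/-- In the quadrant above `(m,n)`, the double sequence `x` vanishes outside a finite square. -/
def VanishesBeyond (x : ℤ → ℤ → E) (m n : ℤ) (M : ℕ) : Prop :=
  ∀ k l : ℤ, m ≤ k → n ≤ l → (m + M ≤ k ∨ n + M ≤ l) → x k l = 0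

lemma VanishesBeyond.mono {x : ℤ → ℤ → E} {m n : ℤ} {M M' : ℕ} (h : VanishesBeyond x m n M)
    (hM : M ≤ M') : VanishesBeyond x m n M' :=
  fun k l hk hl h' => h k l hk hl (by omega)

variable [Module ℂ E]

/-- The action of a pair of power series on a double sequence. -/
def act₂ (c d : PowerSeries ℂ) (x : ℤ → ℤ → E) (m n : ℤ) : E := act c (fun k => act d (x k) n) m

lemma act₂_eq_sum (c d : PowerSeries ℂ) {x : ℤ → ℤ → E} {m n : ℤ} {M : ℕ}
    (h : VanishesBeyond x m n M) : act₂ c d x m n = ∑ i ∈ Finset.range M, ∑ k ∈ Finset.range M,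
      (PowerSeries.coeff i c * PowerSeries.coeff k d) • x (m + i) (n + k) := by
  rw [act₂, act_eq_sum (N := M)]
  · refine Finset.sum_congr rfl fun i _ => ?_
    rw [act_eq_sum (N := M) _ fun l hl => h _ _ (by omega) (by omega) (Or.inr hl), Finset.smul_sum]
    exact Finset.sum_congr rfl fun k _ => smul_smul _ _ _
  · exact fun k hk => act_eq_zero _ fun l hl => h _ _ (by omega) hl (Or.inl hk)

lemma act₂_swap (c d : PowerSeries ℂ) {x : ℤ → ℤ → E} {m n : ℤ} {M : ℕ}
    (h : VanishesBeyond x m n M) : act₂ c d x m n = act₂ d c (fun k l => x l k) n m := by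
  have h' : VanishesBeyond (fun k l => x l k) n m M := fun k l hk hl h1 => h l k hl hk h1.symm
  rw [act₂_eq_sum c d h, act₂_eq_sum d c h', Finset.sum_comm]
  simp only [mul_comm]

/-- The series `negBin` have constant term 1, so the action is unitriangular: descending induction
on k + l starts where x vanishes. The exponents j, j' may therefore vary with the position. -/
lemma eq_zero_of_act₂_eq_zero {x : ℤ → ℤ → E} {m n : ℤ} {M : ℕ} (h : VanishesBeyond x m n M)
    (h0 : ∀ k l : ℤ, m ≤ k → n ≤ l → ∃ j j' : ℤ, act₂ (negBin j) (negBin j') x k l = 0) :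
    x m n = 0 := by
  have key : ∀ s : ℕ, ∀ k l : ℤ, m ≤ k → n ≤ l → (m + M) + (n + M) - s ≤ k + l → x k l = 0 := by
    intro s
    induction s with
    | zero => intro k l hk hl hs; exact h k l hk hl (by push_cast at hs; omega)
    | succ s ih =>
      intro k l hk hl hs
      obtain ⟨j, j', hj⟩ := h0 k l hk hl
      rw [act₂, act_eq_sum _ (N := 1), Finset.sum_range_one,
        act_eq_sum _ (N := 1), Finset.sum_range_one] at hj
      · simpa using hj
      · intro l' hl'
        simp only [Nat.cast_zero, add_zero]
        exact ih _ _ hk (by omega) (by push_cast at hl' hs; omega)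
      · intro k' hk'
        exact act_eq_zero _ fun l' hl' => ih _ _ (by omega) (by omega) (by push_cast at hk' hs; omega)
  exact key (2 * M) m n le_rfl le_rfl (by push_cast; omega)

end DoubleAction

lemma exists_uniform_bound {P : ℤ → ℤ → Prop} (h : ∀ q, ∃ N, ∀ N', N ≤ N' → P q N')
    (h' : ∃ S, ∀ q, S ≤ q → ∀ N', P q N') (n : ℤ) : ∃ N, ∀ q, n ≤ q → ∀ N', N ≤ N' → P q N' := by
  obtain ⟨S, hS⟩ := h'
  have key : ∀ k : ℕ, ∃ N, ∀ q, S - k ≤ q → ∀ N', N ≤ N' → P q N' := by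
    intro k
    induction k with
    | zero => exact ⟨0, fun q hq N' _ => hS q (by simpa using hq) N'⟩
    | succ k ih =>
      obtain ⟨N, hN⟩ := ih
      obtain ⟨N₁, hN₁⟩ := h (S - (k + 1 : ℕ))
      refine ⟨max N N₁, fun q hq N' hN' => ?_⟩
      rcases eq_or_lt_of_le hq with rfl | hlt
      · exact hN₁ N' (by omega)
      · exact hN q (by push_cast at hlt; omega) N' (by omega)
  obtain ⟨N, hN⟩ := key (S - n).toNat
  exact ⟨N, fun q hq => hN q (by omega)⟩

variable {V : Type u} [AddCommGroup V] [Module ℂ V] [VertexOperatorAlgebra V]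
  {g : V ≃ₗ[ℂ] V}

lemma isExpansion_of_mem (hT : IsOfFinOrder g) {f : Module.Dual ℂ V} (hf : f ∈ regularDual g)
    {a : V} {n : ℚ} (ha : a ∈ sector g n) :
    IsExpansion f a n (fun k => dualMode g a (n + k) f) := by
  have := isExpansion_dualMode hf a n
  rwa [proj_of_mem hT ha] at this

lemma dualMode_zero (a : V) (n : ℚ) : dualMode g a n 0 = 0 := by
  have := dualMode_smul (Submodule.zero_mem (regularDual g)) (0 : ℂ) a n
  rwa [zero_smul, zero_smul] at this

lemma dualMode_dualMode_truncation (hg : IsAutomorphism g) {f : Module.Dual ℂ V}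
    (hf : f ∈ regularDual g) (a b : V) (m₀ n₀ : ℚ) (n : ℤ) :
    ∃ R : ℤ, ∀ q, n ≤ q → ∀ k, R ≤ k →
      dualMode g a (m₀ + k) (dualMode g b (n₀ + q) f) = 0 := by
  refine exists_uniform_bound (P := fun q k => dualMode g a (m₀ + k) (dualMode g b (n₀ + q) f) = 0)
    (fun q => ?_) ?_ n
  · obtain ⟨⟨R, hR⟩, -⟩ := isExpansion_dualMode (dualMode_mem hg hf b (n₀ + q)) a m₀
    exact ⟨R, hR⟩
  · obtain ⟨⟨S, hS⟩, -⟩ := isExpansion_dualMode hf b n₀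
    exact ⟨S, fun q hq k => by
      have : dualMode g b (n₀ + q) f = 0 := hS q hq
      rw [this, dualMode_zero]⟩

/-- The first sum in the Jacobi identity. -/
def jacobiSum (g : V ≃ₗ[ℂ] V) (a b : V) (m₀ n₀ : ℚ) (f : Module.Dual ℂ V) (l m n : ℤ) :
    Module.Dual ℂ V :=
  ∑ᶠ i : ℕ, ((-1 : ℂ) ^ i * Ring.choose (l : ℂ) i) •
    dualMode g a (m₀ + (m + l - i : ℤ)) (dualMode g b (n₀ + (n + i : ℤ)) f)

lemma jacobiSum_vanishesBeyond (hg : IsAutomorphism g) {f : Module.Dual ℂ V}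
    (hf : f ∈ regularDual g) (a b : V) (m₀ n₀ : ℚ) (l m n : ℤ) :
    ∃ M, VanishesBeyond (jacobiSum g a b m₀ n₀ f l) m n M := by
  obtain ⟨R, hR⟩ := dualMode_dualMode_truncation hg hf a b m₀ n₀ n
  obtain ⟨⟨S, hS⟩, -⟩ := isExpansion_dualMode hf b n₀
  refine ⟨(S - n).toNat + (R + (S - n).toNat - l - m).toNat, fun k q hk hq h => ?_⟩
  rw [jacobiSum, finsum_eq_zero_of_forall_eq_zero]
  intro i
  by_cases hi : S ≤ q + i
  · have : dualMode g b (n₀ + (q + i : ℤ)) f = 0 := hS _ hi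
    rw [this, dualMode_zero, smul_zero]
  · rw [hR (q + i) (by omega) (k + l - i) (by omega), smul_zero]

lemma act_negBin_mul_sum {E : Type*} [AddCommGroup E] [Module ℂ E] (j k : ℂ) {x : ℤ → E} {p : ℤ}
    {N : ℕ} (h : ∀ n, p + N ≤ n → x n = 0) : act (negBin (j + k)) x p =
      ∑ r ∈ Finset.range N, ∑ s ∈ Finset.range N,
        (PowerSeries.coeff r (negBin j) * PowerSeries.coeff s (negBin k)) • x (p + r + s) := by
  rw [negBin_add, act_mul _ _ ⟨p + N, h⟩,
    act_eq_sum _ (N := N) fun n hn => act_eq_zero _ fun m hm => h m (by omega)]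
  refine Finset.sum_congr rfl fun r _ => ?_
  rw [act_eq_sum _ (N := N) fun n hn => h n (by omega), Finset.smul_sum]
  exact Finset.sum_congr rfl fun s _ => smul_smul _ _ _

/-- The sum on the left pairs (z₁-z₂)^l, expanded in powers of z₁/z₂, with f(Y(b,z₂)Y(a,z₁)v).
Moving both residues to y = 0 turns it into (y₁-y₂)^l expanded in powers of y₂/y₁. The order of the
operators is reversed, since b acts on f first. The signs from the two residues cancel. -/
lemma apply_bra_bra (hg : IsAutomorphism g) (hT : IsOfFinOrder g) {f : Module.Dual ℂ V}
    (hf : f ∈ regularDual g) {a b : V} {m₀ n₀ : ℚ} (ha : a ∈ sector g m₀) (hb : b ∈ sector g n₀)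
    (l m n : ℤ) : ∃ J : ℤ, ∀ j j' : ℤ, J ≤ j → J ≤ j' → ∀ v,
      f (∑ᶠ i : ℕ, ((-1 : ℂ) ^ (l + i) * Ring.choose (l : ℂ) i) •
        bra b ((n₀ : ℂ) + n) (-j' + l - i) (bra a ((m₀ : ℂ) + m) (-j + i) v)) =
      (-1 : ℂ) ^ (j + j') *
        act₂ (negBin j) (negBin j') (jacobiSum g a b m₀ n₀ f l) m n v := by
  obtain ⟨M₀, hM₀⟩ := jacobiSum_vanishesBeyond hg hf a b m₀ n₀ l m n
  obtain ⟨⟨S, hS⟩, N, hN⟩ := isExpansion_of_mem hT hf hb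
  obtain ⟨R, hR⟩ := dualMode_dualMode_truncation hg hf a b m₀ n₀ n
  -- Only finitely many q ≥ n give b_{n₀+q} f ≠ 0, so the expansions of all these functionals along
  -- a share one range of validity.
  obtain ⟨N₁, hN₁⟩ := exists_uniform_bound (P := fun q N' => ∀ p j : ℤ, N' = j - p →
      dualMode g b (n₀ + q) f ∘ₗ bra a ((m₀ : ℂ) + p) (-j) = (-(-1 : ℂ) ^ j) •
        act (negBin j) (fun k => dualMode g a (m₀ + k) (dualMode g b (n₀ + q) f)) p)
    (fun q => by
      obtain ⟨-, N₂, hN₂⟩ := isExpansion_of_mem hT (dualMode_mem hg hf b (n₀ + q)) ha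
      exact ⟨N₂, fun N' hN' p j h => hN₂ p j (h ▸ hN')⟩)
    ⟨S, fun q hq N' p j _ => by
      have h0 : dualMode g b (n₀ + q) f = 0 := hS q hq
      simp only [h0, dualMode_zero, LinearMap.zero_comp]
      rw [act_eq_zero _ fun _ _ => rfl, smul_zero]⟩ n
  obtain ⟨M, hM, hMS, hMR⟩ : ∃ M : ℕ, M₀ ≤ M ∧ S ≤ n + M ∧ R + (S - n).toNat ≤ m + l + M :=
    ⟨M₀ + (S - n).toNat + (R + (S - n).toNat - m - l).toNat, by omega, by omega, by omega⟩
  set K := (S - n).toNat with hK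
  refine ⟨max (N + n + l) (N₁ + m + l), fun j j' hj hj' v => ?_⟩
  have hg0 : ∀ q : ℤ, n + K ≤ q → dualMode g b (n₀ + q) f = 0 := fun q hq => hS q (by omega)
  obtain ⟨I, hI⟩ : ∃ I : ℕ, ∀ k, -j + (I : ℤ) ≤ k → mode a k v = 0 := by
    obtain ⟨I, hI⟩ := mode_truncation a v
    exact ⟨(I + j).toNat, fun k hk => hI k (by omega)⟩
  set w : ℕ → V := fun i => bra a ((m₀ : ℂ) + m) (-j + i) v with hw
  have hw0 : ∀ i, I ≤ i → w i = 0 := fun i hi => bra_eq_zero (fun k hk => hI k (by omega)) _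
  set G : ℕ → Module.Dual ℂ V := fun s => dualMode g b (n₀ + (n + s : ℤ)) f with hG
  -- the left-hand side
  have hL : f (∑ᶠ i : ℕ, ((-1 : ℂ) ^ (l + i) * Ring.choose (l : ℂ) i) •
        bra b ((n₀ : ℂ) + n) (-j' + l - i) (w i)) =
      ∑ r ∈ Finset.range K, ∑ s ∈ Finset.range K, (-(-1 : ℂ) ^ j' *
        (((-1) ^ r * Ring.choose (l : ℂ) r) * PowerSeries.coeff s (negBin (j' : ℂ)))) •
        G (r + s) (bra a ((m₀ : ℂ) + (m + l - r : ℤ)) (-j) v) := by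
    rw [finsum_eq_sum_range (N := I) fun i hi => by rw [hw0 i hi, map_zero, smul_zero], map_sum]
    have h1 : ∀ i ∈ Finset.range I, f (((-1 : ℂ) ^ (l + i) * Ring.choose (l : ℂ) i) •
        bra b ((n₀ : ℂ) + n) (-j' + l - i) (w i)) =
        ∑ r ∈ Finset.range K, ∑ s ∈ Finset.range K, (-(-1 : ℂ) ^ j' *
        (((-1) ^ r * Ring.choose (l : ℂ) r) * PowerSeries.coeff s (negBin (j' : ℂ)))) •
        Ring.choose ((l : ℂ) - r) i • G (r + s) (w i) := by
      intro i _
      have h2 := LinearMap.congr_fun (hN n (j' + i - l) (by omega)) (w i)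
      rw [show ((j' + i - l : ℤ) : ℂ) = ((i : ℂ) - l) + j' by push_cast; ring,
        act_negBin_mul_sum _ _ (N := K) fun q hq => hg0 q hq, LinearMap.comp_apply] at h2
      rw [map_smul, show -j' + l - (i : ℤ) = -(j' + i - l) by ring, h2]
      simp only [LinearMap.smul_apply, LinearMap.sum_apply, Finset.smul_sum]
      refine Finset.sum_congr rfl fun r _ => Finset.sum_congr rfl fun s _ => ?_
      rw [show n + (r : ℤ) + s = n + (r + s : ℕ) by push_cast; ring, smul_smul, smul_smul, smul_smul]
      congr 1
      rw [coeff_negBin, neg_sub]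
      -- The factor (1-y₂)^(l-i) contributes (l-i choose r). Trading (l choose i)(l-i choose r) for
      -- (l choose r)(l-r choose i) leaves a sum over i that is the expansion of (1+z₁)^(l-r).
      have h3 := choose_mul_choose_sub (l : ℂ) i r
      have h4 : (-1 : ℂ) ^ (l + i) * (-1) ^ (j' + i - l) = (-1) ^ j' := by
        rw [← zpow_add₀ (by norm_num), show l + (i : ℤ) + (j' + i - l) = j' + 2 * i by ring,
          zpow_add₀ (by norm_num), zpow_mul]
        norm_num
      linear_combination (-(-1) ^ r * PowerSeries.coeff s (negBin (j' : ℂ)) *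
        (-1 : ℂ) ^ (l + i) * (-1) ^ (j' + i - l)) * h3 - (-1) ^ r *
        PowerSeries.coeff s (negBin (j' : ℂ)) * Ring.choose (l : ℂ) r *
          Ring.choose ((l : ℂ) - r) i * h4
    rw [Finset.sum_congr rfl h1, Finset.sum_comm]
    refine Finset.sum_congr rfl fun r _ => ?_
    rw [Finset.sum_comm]
    refine Finset.sum_congr rfl fun s _ => ?_
    rw [← Finset.smul_sum, show (m₀ : ℂ) + (m + l - r : ℤ) = ((l : ℂ) - r) + (m₀ + m) by
      push_cast; ring, bra_add_exponent, act_eq_sum _ (N := I) fun k hk =>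
        bra_eq_zero (fun k' hk' => hI k' (by omega)) _, map_sum]
    congr 1
    refine Finset.sum_congr rfl fun i _ => ?_
    rw [map_smul, coeff_bin]
  have hsign : (-1 : ℂ) ^ (j + j') * (-(-1) ^ j) = -(-1) ^ j' := by
    rw [mul_neg, ← zpow_add₀ (by norm_num), show j + j' + j = j' + 2 * j by ring,
      zpow_add₀ (by norm_num), zpow_mul]
    norm_num
  rw [hL, act₂_swap _ _ hM₀, act₂]
  have hS1 : ∀ k q : ℤ, n ≤ q → jacobiSum g a b m₀ n₀ f l k q = ∑ r ∈ Finset.range K,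
      ((-1 : ℂ) ^ r * Ring.choose (l : ℂ) r) •
        dualMode g a (m₀ + (k + l - r : ℤ)) (dualMode g b (n₀ + (q + r : ℤ)) f) := fun k q hq =>
    finsum_eq_sum_range fun r hr => by rw [hg0 _ (by omega), dualMode_zero, smul_zero]
  have hS2 : ∀ q : ℤ, n ≤ q → act (negBin j) (fun k => jacobiSum g a b m₀ n₀ f l k q) m =
      ∑ r ∈ Finset.range K, ((-1 : ℂ) ^ r * Ring.choose (l : ℂ) r) • (-(-1 : ℂ) ^ j) •
        (dualMode g b (n₀ + (q + r : ℤ)) f ∘ₗ bra a ((m₀ : ℂ) + (m + l - r : ℤ)) (-j)) := by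
    intro q hq
    have h1 : ∀ r ∈ Finset.range K, dualMode g b (n₀ + (q + r : ℤ)) f ∘ₗ
        bra a ((m₀ : ℂ) + (m + l - r : ℤ)) (-j) = (-(-1 : ℂ) ^ j) • ∑ i ∈ Finset.range (M + K),
          PowerSeries.coeff i (negBin (j : ℂ)) • dualMode g a (m₀ + (m + i + l - r : ℤ))
            (dualMode g b (n₀ + (q + r : ℤ)) f) := by
      intro r hr
      rw [Finset.mem_range] at hr
      rw [hN₁ (q + r) (by omega) _ (by omega) _ _ rfl,
        act_eq_sum _ (N := M + K) fun k hk => hR _ (by omega) _ (by push_cast at hk; omega)]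
      congr 1
      refine Finset.sum_congr rfl fun i _ => ?_
      rw [show m + l - (r : ℤ) + i = m + i + l - r by ring]
    have hs2 : (-(-1 : ℂ) ^ j) * (-(-1 : ℂ) ^ j) = 1 := by
      rw [neg_mul_neg, ← zpow_add₀ (by norm_num), ← two_mul, zpow_mul]; norm_num
    rw [Finset.sum_congr rfl fun r hr => by rw [h1 r hr, smul_smul (-(-1 : ℂ) ^ j), hs2, one_smul],
      act_eq_sum _ (N := M + K) fun k hk => ?_]
    · simp only [Finset.smul_sum]
      rw [Finset.sum_comm]
      refine Finset.sum_congr rfl fun i _ => ?_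
      rw [hS1 _ _ hq, Finset.smul_sum]
      exact Finset.sum_congr rfl fun r _ => smul_comm _ _ _
    · rw [hS1 _ _ hq]
      refine Finset.sum_eq_zero fun r hr => ?_
      rw [Finset.mem_range] at hr
      rw [hR _ (by omega) _ (by push_cast at hk; omega), smul_zero]
  rw [act_eq_sum _ (N := K) fun q hq => ?_]
  · have hS3 := fun s : ℕ => hS2 (n + s) (by omega)
    simp only [hS3, LinearMap.sum_apply, LinearMap.smul_apply, Finset.smul_sum, Finset.mul_sum]
    rw [Finset.sum_comm]
    refine Finset.sum_congr rfl fun s _ => Finset.sum_congr rfl fun r _ => ?_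
    rw [LinearMap.comp_apply, hG]
    simp only
    rw [show n + ((r + s : ℕ) : ℤ) = n + s + r by push_cast; ring, ← hsign]
    simp only [smul_eq_mul]
    ring
  · rw [hS2 q (by omega)]
    refine Finset.sum_eq_zero fun r _ => ?_
    rw [hg0 _ (by omega), LinearMap.zero_comp, smul_zero, smul_zero]

end

/-! ### Iterates and the Jacobi identity on the regular dual. -/

section

section DoubleAction

variable {E : Type*} [AddCommGroup E] [Module ℂ E]

lemma act₂_sub (c d : PowerSeries ℂ) {x y : ℤ → ℤ → E} {m n : ℤ} {M : ℕ}
    (hx : VanishesBeyond x m n M) (hy : VanishesBeyond y m n M) :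
    act₂ c d (fun k l => x k l - y k l) m n = act₂ c d x m n - act₂ c d y m n := by
  rw [act₂_eq_sum c d hx, act₂_eq_sum c d hy, act₂_eq_sum (M := M) c d
    fun k l hk hl h => by rw [hx k l hk hl h, hy k l hk hl h, sub_zero]]
  simp only [smul_sub, Finset.sum_sub_distrib]

lemma act₂_smul (b : ℂ) (c d : PowerSeries ℂ) {x : ℤ → ℤ → E} {m n : ℤ} {M : ℕ}
    (hx : VanishesBeyond x m n M) :
    act₂ c d (fun k l => b • x k l) m n = b • act₂ c d x m n := by
  rw [act₂_eq_sum c d hx, act₂_eq_sum (M := M) c d fun k l hk hl h => by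
    rw [hx k l hk hl h, smul_zero]]
  simp only [Finset.smul_sum]
  exact Finset.sum_congr rfl fun i _ => Finset.sum_congr rfl fun k _ => smul_comm _ _ _

end DoubleAction

variable {V : Type u} [AddCommGroup V] [Module ℂ V] [VertexOperatorAlgebra V]
  {g : V ≃ₗ[ℂ] V}

lemma dualMode_zero_vector (n : ℚ) (f : Module.Dual ℂ V) : dualMode g 0 n f = 0 := by
  have h1 := IsExpansion.zero_vector f n
  rw [← map_zero (proj g n)] at h1
  exact h1.dualMode_eq_zero

/-- The right-hand side of the Jacobi identity. -/
def iterateSum (g : V ≃ₗ[ℂ] V) (a b : V) (m₀ n₀ : ℚ) (f : Module.Dual ℂ V) (l m n : ℤ) :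
    Module.Dual ℂ V :=
  ∑ᶠ i : ℕ, Ring.choose ((m₀ : ℂ) + m) i •
    dualMode g (mode a (l + i) b) (m₀ + n₀ + (m + n - i : ℤ)) f

lemma exists_bound_iterate {f : Module.Dual ℂ V} (hf : f ∈ regularDual g) (a b : V) (n₀ : ℚ)
    (l : ℤ) : ∃ S : ℤ, ∀ q, l ≤ q → ∀ k : ℤ, S ≤ k → dualMode g (mode a q b) (n₀ + k) f = 0 := by
  obtain ⟨I, hI⟩ := mode_truncation a b
  refine exists_uniform_bound (P := fun q k => dualMode g (mode a q b) (n₀ + k) f = 0)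
    (fun q => ?_) ⟨I, fun q hq k => by rw [hI q hq, dualMode_zero_vector]⟩ l
  obtain ⟨⟨S, hS⟩, -⟩ := isExpansion_dualMode hf (mode a q b) n₀
  exact ⟨S, hS⟩

lemma iterateSum_vanishesBeyond {f : Module.Dual ℂ V}
    (hf : f ∈ regularDual g) (a b : V) (m₀ n₀ : ℚ) (l m n : ℤ) :
    ∃ M, VanishesBeyond (iterateSum g a b m₀ n₀ f l) m n M := by
  obtain ⟨S, hS⟩ := exists_bound_iterate hf a b (m₀ + n₀) l
  obtain ⟨I, hI⟩ := mode_truncation a b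
  refine ⟨(S - m - n + (I - l).toNat).toNat, fun k q hk hq h => ?_⟩
  rw [iterateSum, finsum_eq_zero_of_forall_eq_zero]
  intro i
  by_cases hi : I ≤ l + i
  · rw [hI _ hi, dualMode_zero_vector, smul_zero]
  · rw [hS (l + i) (by omega) _ (by omega), smul_zero]

/-- This is `mk_choose_mul_choose` after X ↦ -X: the product rule for a divided derivative of y^m
(1-y)^(-j), now expanded at y = 0. -/
lemma rescale_mk_choose (m : ℂ) (j : ℂ) (i : ℕ) :
    PowerSeries.mk (fun c : ℕ => (-1) ^ c * Ring.choose (-j) c * Ring.choose (m + c) i) =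
      ∑ x ∈ Finset.HasAntidiagonal.antidiagonal i,
        PowerSeries.C (Ring.choose m x.1 * Ring.choose (-j) x.2 * (-1) ^ x.2) *
          (PowerSeries.X ^ x.2 * negBin (j + x.2)) := by
  have h := congrArg (PowerSeries.rescale (-1 : ℂ)) (mk_choose_mul_choose (-j) m i)
  have h0 : PowerSeries.mk (fun c : ℕ => (-1) ^ c * Ring.choose (-j) c * Ring.choose (m + c) i) =
      PowerSeries.rescale (-1 : ℂ)
        (PowerSeries.mk fun c : ℕ => Ring.choose (-j) c * Ring.choose (m + c) i) := by
    ext c; simp [PowerSeries.coeff_rescale, mul_assoc]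
  rw [h0, h, map_sum, ← Finset.Nat.sum_antidiagonal_swap]
  refine Finset.sum_congr rfl fun x _ => ?_
  have h1 : PowerSeries.rescale (-1 : ℂ) (PowerSeries.X ^ x.2) =
      PowerSeries.C ((-1 : ℂ) ^ x.2) * PowerSeries.X ^ x.2 := by
    rw [map_pow, PowerSeries.rescale_X, mul_pow, ← map_pow]
  have h2 : ∀ t : ℂ, PowerSeries.rescale (-1 : ℂ) (PowerSeries.C t) = PowerSeries.C t := fun t => by
    ext c
    rw [PowerSeries.coeff_rescale, PowerSeries.coeff_C]
    split_ifs with h <;> simp [h]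
  simp only [Prod.fst_swap, Prod.snd_swap]
  rw [map_mul (PowerSeries.rescale (-1 : ℂ)), map_mul (PowerSeries.rescale (-1 : ℂ)), h1, h2, negBin,
    show -j - (x.2 : ℂ) = -(j + x.2) by ring]
  simp only [map_mul PowerSeries.C]
  ring

/-- The coefficients on the left come from the i-th divided derivative of (1+z)^(m₀+m) z^(-j), which
is the same function of y = 1+z. Only one residue is moved, so one minus sign remains. -/
lemma apply_bra_mode (hg : IsAutomorphism g) (hT : IsOfFinOrder g) {f : Module.Dual ℂ V}
    (hf : f ∈ regularDual g) {a b : V} {m₀ n₀ : ℚ} (ha : a ∈ sector g m₀) (hb : b ∈ sector g n₀)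
    (l m n : ℤ) : ∃ J : ℤ, ∀ j j' : ℤ, J ≤ j → J ≤ j' → ∀ v,
      f (∑ᶠ i : ℕ, ∑ x ∈ Finset.HasAntidiagonal.antidiagonal i,
        (Ring.choose ((m₀ : ℂ) + m) x.1 * Ring.choose ((-j : ℤ) : ℂ) x.2) •
          bra (mode a (l + i) b) ((m₀ : ℂ) + m + (n₀ + n) - x.1) (-j + -j' - x.2) v) =
      -(-1 : ℂ) ^ (j + j') *
        act₂ (negBin j) (negBin j') (iterateSum g a b m₀ n₀ f l) m n v := by
  obtain ⟨M₀, hM₀⟩ := iterateSum_vanishesBeyond hf a b m₀ n₀ l m n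
  obtain ⟨S, hS⟩ := exists_bound_iterate hf a b (m₀ + n₀) l
  obtain ⟨I, hI⟩ : ∃ I : ℕ, ∀ i : ℕ, I ≤ i → mode a (l + i) b = 0 := by
    obtain ⟨I, hI⟩ := mode_truncation a b
    exact ⟨(I - l).toNat, fun i hi => hI _ (by omega)⟩
  obtain ⟨N, hN⟩ := exists_uniform_bound (P := fun q N' => ∀ p j : ℤ, N' = j - p →
      f ∘ₗ bra (mode a q b) (((m₀ + n₀ : ℚ) : ℂ) + p) (-j) = (-(-1 : ℂ) ^ j) •
        act (negBin j) (fun k => dualMode g (mode a q b) (m₀ + n₀ + k) f) p)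
    (fun q => by
      obtain ⟨-, N₂, hN₂⟩ := isExpansion_of_mem hT hf (mode_mem_sector hg ha hb q)
      exact ⟨N₂, fun N' hN' p j h => hN₂ p j (h ▸ hN')⟩)
    (by
      obtain ⟨K, hK⟩ := mode_truncation a b
      refine ⟨K, fun q hq N' p j _ => ?_⟩
      simp only [hK q hq, bra_zero_left, LinearMap.comp_zero, dualMode_zero_vector]
      rw [act_eq_zero _ fun _ _ => rfl, smul_zero]) l
  refine ⟨max 0 (N + m + n), fun j j' hj hj' v => ?_⟩
  rw [finsum_eq_sum_range (N := I) fun i hi => Finset.sum_eq_zero fun x _ => by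
    rw [hI i hi, bra_zero_left, LinearMap.zero_apply, smul_zero], map_sum]
  obtain ⟨M, hM, hMS⟩ : ∃ M : ℕ, M₀ ≤ M ∧ S ≤ m + n - I + M :=
    ⟨M₀ + (S - m - n + I).toNat, by omega, by omega⟩
  rw [act₂_eq_sum _ _ (hM₀.mono hM)]
  have hT3 : ∀ k q : ℤ, iterateSum g a b m₀ n₀ f l k q = ∑ i ∈ Finset.range I,
      Ring.choose ((m₀ : ℂ) + k) i •
        dualMode g (mode a (l + i) b) (m₀ + n₀ + (k + q - i : ℤ)) f := fun k q =>
    finsum_eq_sum_range fun i hi => by rw [hI i hi, dualMode_zero_vector, smul_zero]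
  have h1 : ∀ i ∈ Finset.range I, f (∑ x ∈ Finset.HasAntidiagonal.antidiagonal i,
        (Ring.choose ((m₀ : ℂ) + m) x.1 * Ring.choose ((-j : ℤ) : ℂ) x.2) •
          bra (mode a (l + i) b) ((m₀ : ℂ) + m + (n₀ + n) - x.1) (-j + -j' - x.2) v) =
      (-(-1 : ℂ) ^ (j + j')) * (∑ r ∈ Finset.range M, ∑ s ∈ Finset.range M,
        (PowerSeries.coeff r (negBin (j : ℂ)) * PowerSeries.coeff s (negBin (j' : ℂ))) •
          Ring.choose ((m₀ : ℂ) + (m + r : ℤ)) i • dualMode g (mode a (l + i) b)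
            (m₀ + n₀ + (m + r + (n + s) - i : ℤ)) f) v := by
    intro i hi
    rw [Finset.mem_range] at hi
    have hv : ∀ k, m + n - i + (M : ℤ) ≤ k →
        dualMode g (mode a (l + i) b) (m₀ + n₀ + k) f = 0 := fun k hk =>
      hS (l + i) (by omega) k (by omega)
    have ht : ∃ P, ∀ k, P ≤ k → (fun k : ℤ => dualMode g (mode a (l + i) b) (m₀ + n₀ + k) f) k = 0 :=
      ⟨_, hv⟩
    have h2 : act (PowerSeries.mk (fun c : ℕ => (-1) ^ c * Ring.choose (-(j : ℂ)) c *
          Ring.choose ((m₀ : ℂ) + m + c) i) * negBin (j' : ℂ))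
        (fun k : ℤ => dualMode g (mode a (l + i) b) (m₀ + n₀ + k) f) (m + n - i) =
        ∑ r ∈ Finset.range M, ∑ s ∈ Finset.range M,
        (PowerSeries.coeff r (negBin (j : ℂ)) * PowerSeries.coeff s (negBin (j' : ℂ))) •
          Ring.choose ((m₀ : ℂ) + (m + r : ℤ)) i • dualMode g (mode a (l + i) b)
            (m₀ + n₀ + (m + r + (n + s) - i : ℤ)) f := by
      rw [act_mul _ _ ht, act_eq_sum _ (N := M) fun k hk => act_eq_zero _ fun k' hk' => hv k' (by omega)]
      refine Finset.sum_congr rfl fun r _ => ?_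
      rw [act_eq_sum _ (N := M) fun k hk => hv k (by omega), Finset.smul_sum]
      refine Finset.sum_congr rfl fun s _ => ?_
      rw [PowerSeries.coeff_mk, smul_smul, smul_smul, coeff_negBin (j : ℂ) r,
        show m + n - (i : ℤ) + r + s = m + r + (n + s) - i by ring]
      congr 1
      push_cast
      ring_nf
    rw [← h2, rescale_mk_choose, Finset.sum_mul, act_sum_left _ _ ht, map_sum,
      LinearMap.sum_apply, Finset.mul_sum]
    refine Finset.sum_congr rfl fun x hx => ?_
    rw [Finset.HasAntidiagonal.mem_antidiagonal] at hx
    rw [mul_assoc, act_C_mul _ _ ht, mul_assoc (PowerSeries.X ^ x.2), act_X_pow_mul _ _ ht, ← negBin_add]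
    have h3 := LinearMap.congr_fun (hN (l + i) (by omega) (j + j' + x.2 - (m + n - x.1)) (by omega)
      (m + n - x.1) (j + j' + x.2) rfl) v
    rw [LinearMap.comp_apply, show ((m₀ + n₀ : ℚ) : ℂ) + (m + n - x.1 : ℤ) =
      (m₀ : ℂ) + m + (n₀ + n) - x.1 by push_cast; ring,
      show -(j + j' + (x.2 : ℤ)) = -j + -j' - x.2 by ring] at h3
    rw [map_smul, h3, show m + n - (i : ℤ) + x.2 = m + n - x.1 by omega,
      show (j : ℂ) + x.2 + j' = (j + j' + x.2 : ℤ) by push_cast; ring,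
      zpow_add₀ (by norm_num) (j + j'), zpow_natCast]
    simp only [LinearMap.smul_apply, smul_eq_mul]
    push_cast
    ring
  rw [Finset.sum_congr rfl h1, ← Finset.mul_sum, ← LinearMap.sum_apply, Finset.sum_comm]
  congr 2
  refine Finset.sum_congr rfl fun r _ => ?_
  rw [Finset.sum_comm]
  refine Finset.sum_congr rfl fun s _ => ?_
  rw [hT3, Finset.smul_sum]

/-- Apply f to the Jacobi identity on V paired with z₁^(-j) z₂^(-j), for j so large that all three
terms can be moved to y = 0. This gives the identity after multiplication by (1-y₁)^(-j)(1-y₂)^(-j),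
and `eq_zero_of_act₂_eq_zero` removes these factors. -/
lemma dual_jacobi (hg : IsAutomorphism g) (hT : IsOfFinOrder g) {f : Module.Dual ℂ V}
    (hf : f ∈ regularDual g) {a b : V} {m₀ n₀ : ℚ} (ha : a ∈ sector g m₀) (hb : b ∈ sector g n₀)
    (l m n : ℤ) : jacobiSum g a b m₀ n₀ f l m n - (-1 : ℂ) ^ l • jacobiSum g b a n₀ m₀ f l n m =
      iterateSum g a b m₀ n₀ f l m n := by
  have hv : ∀ m n : ℤ, ∃ M, VanishesBeyond (jacobiSum g a b m₀ n₀ f l) m n M ∧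
      VanishesBeyond (fun m n => (-1 : ℂ) ^ l • jacobiSum g b a n₀ m₀ f l n m) m n M ∧
      VanishesBeyond (jacobiSum g b a n₀ m₀ f l) n m M ∧
      VanishesBeyond (iterateSum g a b m₀ n₀ f l) m n M := by
    intro m n
    obtain ⟨M₁, h1⟩ := jacobiSum_vanishesBeyond hg hf a b m₀ n₀ l m n
    obtain ⟨M₂, h2⟩ := jacobiSum_vanishesBeyond hg hf b a n₀ m₀ l n m
    obtain ⟨M₃, h3⟩ := iterateSum_vanishesBeyond hf a b m₀ n₀ l m n
    refine ⟨M₁ + M₂ + M₃, h1.mono (by omega), fun k q hk hq h => ?_, h2.mono (by omega),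
      h3.mono (by omega)⟩
    simp only
    rw [h2 q k hq hk (by omega), smul_zero]
  have hv2 : ∀ {m n : ℤ} {M : ℕ}, VanishesBeyond (jacobiSum g a b m₀ n₀ f l) m n M →
      VanishesBeyond (fun m n => (-1 : ℂ) ^ l • jacobiSum g b a n₀ m₀ f l n m) m n M →
      VanishesBeyond (fun m n => jacobiSum g a b m₀ n₀ f l m n -
        (-1 : ℂ) ^ l • jacobiSum g b a n₀ m₀ f l n m) m n M := fun h1 h2 k q hk hq h => by
    have e1 := h1 k q hk hq h
    have e2 := h2 k q hk hq h
    simp only at e2 ⊢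
    rw [e1, e2, sub_zero]
  rw [← sub_eq_zero]
  obtain ⟨M, h1, h2, h3, h4⟩ := hv m n
  refine eq_zero_of_act₂_eq_zero (M := M) (x := fun m n => jacobiSum g a b m₀ n₀ f l m n -
    (-1 : ℂ) ^ l • jacobiSum g b a n₀ m₀ f l n m - iterateSum g a b m₀ n₀ f l m n) ?_ ?_
  · intro k q hk hq h
    have e1 := hv2 h1 h2 k q hk hq h
    have e4 := h4 k q hk hq h
    simp only at e1 ⊢
    rw [e1, e4, sub_zero]
  · intro m n _ _
    obtain ⟨M, h1, h2, h3, h4⟩ := hv m n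
    obtain ⟨J₁, hJ₁⟩ := apply_bra_bra hg hT hf ha hb l m n
    obtain ⟨J₂, hJ₂⟩ := apply_bra_bra hg hT hf hb ha l n m
    obtain ⟨J₃, hJ₃⟩ := apply_bra_mode hg hT hf ha hb l m n
    set j := max J₁ (max J₂ J₃) with hj
    refine ⟨j, j, ?_⟩
    rw [act₂_sub _ _ (hv2 h1 h2) h4, act₂_sub _ _ h1 h2]
    have hsm : act₂ (negBin (j : ℂ)) (negBin (j : ℂ))
        (fun m n => (-1 : ℂ) ^ l • jacobiSum g b a n₀ m₀ f l n m) m n =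
        (-1 : ℂ) ^ l • act₂ (negBin (j : ℂ)) (negBin (j : ℂ)) (jacobiSum g b a n₀ m₀ f l) n m := by
      rw [act₂_swap _ _ h2, act₂_smul _ _ _ h3]
    rw [hsm]
    ext v
    have hjac := congrArg f (bra_jacobi a b v l (-j) (-j) ((m₀ : ℂ) + m) ((n₀ : ℂ) + n))
    -- `apply_bra_bra` with a and b exchanged applies once the sign (-1)^i is rewritten as (-1)^l
    -- (-1)^(l+i).
    have hfirst : ∑ᶠ i : ℕ, ((-1 : ℂ) ^ i * Ring.choose (l : ℂ) i) •
        bra a ((m₀ : ℂ) + m) (-j + l - i) (bra b ((n₀ : ℂ) + n) (-j + i) v) =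
        (-1 : ℂ) ^ l • ∑ᶠ i : ℕ, ((-1 : ℂ) ^ (l + i) * Ring.choose (l : ℂ) i) •
        bra a ((m₀ : ℂ) + m) (-j + l - i) (bra b ((n₀ : ℂ) + n) (-j + i) v) := by
      rw [smul_finsum]
      refine finsum_congr fun i => ?_
      rw [smul_smul, ← mul_assoc, ← zpow_add₀ (by norm_num), ← add_assoc, ← two_mul,
        zpow_add₀ (by norm_num), zpow_mul, zpow_natCast]
      norm_num
    rw [map_sub, hfirst, map_smul, hJ₂ j j (by omega) (by omega), hJ₁ j j (by omega) (by omega),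
      hJ₃ j j (by omega) (by omega), smul_eq_mul] at hjac
    have h0 : (-1 : ℂ) ^ (j + j) ≠ 0 := zpow_ne_zero _ (by norm_num)
    simp only [LinearMap.sub_apply, LinearMap.smul_apply, LinearMap.zero_apply, smul_eq_mul]
    apply mul_left_cancel₀ h0
    linear_combination -hjac

end

/-! ### The weak twisted module structure on the regular dual. -/

section

lemma finite_support_of_vanishes {E : Type*} [AddCommGroup E] {x : ℕ → E} {N : ℕ}
    (h : ∀ i, N ≤ i → x i = 0) : (Function.support x).Finite :=
  (Set.finite_lt_nat N).subset fun i hi => not_le.mp fun h' => hi (h i h')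

variable {V : Type u} [AddCommGroup V] [Module ℂ V] [VertexOperatorAlgebra V]
  {g : V ≃ₗ[ℂ] V}

lemma mode_vacuum (n : ℤ) : mode (vacuum : V) n = if n = -1 then 1 else 0 := vacuum_mode n

lemma vacuum_mem_sector (hg : IsAutomorphism g) : (vacuum : V) ∈ sector g 0 := by
  rw [mem_sector, hg.map_vacuum, root_zero, one_smul]

lemma omega_mem_sector (hg : IsAutomorphism g) : (omega : V) ∈ sector g 0 := by
  rw [mem_sector, hg.map_omega, root_zero, one_smul]

lemma bra_vacuum (α : ℂ) (i : ℕ) (v : V) :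
    bra vacuum α (-1 - i) v = Ring.choose α i • v := by
  rw [bra_apply, act_eq_sum _ (N := i + 1) fun n hn => by rw [mode_vacuum, if_neg (by omega)]; rfl,
    Finset.sum_range_succ, Finset.sum_eq_zero fun k hk => ?_, zero_add]
  · rw [coeff_bin, mode_vacuum, if_pos (by ring)]; rfl
  · rw [Finset.mem_range] at hk
    rw [mode_vacuum, if_neg (by omega), LinearMap.zero_apply, smul_zero]

lemma bra_vacuum_of_nonneg (α : ℂ) {q : ℤ} (hq : 0 ≤ q) : bra (vacuum : V) α q = 0 := by
  ext v
  exact bra_eq_zero (fun n hn => by rw [mode_vacuum, if_neg (by omega)]; rfl) _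

/-- The form is the constant f(v): for p ≥ 0 the polynomial (1+z)^p has no term z^(j-1) when j - 1 >
p. -/
lemma isBounded_vacuum (f : Module.Dual ℂ V) : IsBounded f vacuum 0 0 2 := by
  intro p j hp hj
  ext v
  obtain ⟨i, rfl⟩ : ∃ i : ℕ, j = 1 + i := ⟨(j - 1).toNat, by omega⟩
  obtain ⟨p, rfl⟩ := Int.eq_ofNat_of_zero_le hp
  rw [LinearMap.comp_apply, show -(1 + (i : ℤ)) = -1 - i by ring, bra_vacuum,
    show ((0 : ℚ) : ℂ) + ((p : ℤ) : ℂ) = (p : ℂ) by push_cast; ring, Ring.choose_natCast,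
    Nat.choose_eq_zero_of_lt (by omega)]
  simp

lemma dualMode_vacuum (hg : IsAutomorphism g) (hT : IsOfFinOrder g) (f : Module.Dual ℂ V) (n : ℚ) :
    dualMode g vacuum n f = if n = -1 then f else 0 := by
  by_cases hn : ∃ k : ℤ, n = 0 + k
  · obtain ⟨k, rfl⟩ := hn
    obtain ⟨e, he, he0, hstar⟩ := (isBounded_vacuum f).exists_expansion
    rw [← proj_of_mem hT (vacuum_mem_sector hg)] at he
    rw [he.dualMode_eq k]
    -- The mode is isolated by the exponent of z: for k < -1 take j = 0, where the residue at z = 0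
    -- vanishes; for k = -1 take j = 1, where it is f itself.
    rcases lt_trichotomy k (-1) with hk | rfl | hk
    · have h := hstar k 0 (by omega)
      rw [neg_zero, bra_vacuum_of_nonneg _ le_rfl, LinearMap.comp_zero, Int.cast_zero, negBin_zero,
        act_one _ ⟨0, he0⟩] at h
      rw [if_neg (by rw [zero_add]; exact_mod_cast hk.ne)]
      simpa using h.symm
    · have h := hstar (-1) 1 (by omega)
      rw [act_eq_sum _ (N := 1) fun m hm => he0 m (by omega), Finset.sum_range_one] at h
      rw [if_pos (by push_cast; ring)]
      have h1 : f ∘ₗ bra vacuum (((0 : ℚ) : ℂ) + ((-1 : ℤ) : ℂ)) (-1) = f := by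
        ext v
        have := bra_vacuum (((0 : ℚ) : ℂ) + ((-1 : ℤ) : ℂ)) 0 v
        rw [Nat.cast_zero, sub_zero, Ring.choose_zero_right, one_smul] at this
        rw [LinearMap.comp_apply, this]
      rw [h1] at h
      simpa using h.symm
    · rw [he0 k (by omega), if_neg]
      rw [zero_add]; exact_mod_cast hk.ne'
  · push Not at hn
    rw [dualMode_eq_zero (vacuum_mem_sector hg) hn, if_neg]
    rintro rfl
    exact hn (-1) (by push_cast; ring)

lemma dualMode_truncation (hT : IsOfFinOrder g) {f : Module.Dual ℂ V} (hf : f ∈ regularDual g)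
    (v : V) : ∃ N : ℚ, ∀ l : ℚ, N ≤ l → dualMode g v l f = 0 := by
  let P : Submodule ℂ V :=
    { carrier := {v | ∃ N : ℚ, ∀ l : ℚ, N ≤ l → dualMode g v l f = 0}
      zero_mem' := ⟨0, fun l _ => dualMode_zero_vector l f⟩
      add_mem' := by
        rintro a b ⟨N, hN⟩ ⟨M, hM⟩
        exact ⟨max N M, fun l hl => by
          rw [dualMode_add_vector hf, hN l (le_trans (le_max_left _ _) hl),
            hM l (le_trans (le_max_right _ _) hl), add_zero]⟩
      smul_mem' := by
        rintro c a ⟨N, hN⟩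
        exact ⟨N, fun l hl => by rw [dualMode_smul_vector hf, hN l hl, smul_zero]⟩ }
  refine sector_induction hT P (fun n a ha => ?_) v
  obtain ⟨⟨S, hS⟩, -⟩ := isExpansion_of_mem hT hf ha
  refine ⟨n + S, fun l hl => ?_⟩
  by_cases h : ∃ k : ℤ, l = n + k
  · obtain ⟨k, rfl⟩ := h
    exact hS k (by exact_mod_cast (add_le_add_iff_left n).mp hl)
  · push Not at h
    exact dualMode_eq_zero ha h f

lemma dualMode_truncation_nat (hT : IsOfFinOrder g) {f : Module.Dual ℂ V} (hf : f ∈ regularDual g)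
    (v : V) (n : ℚ) : ∃ N : ℕ, ∀ i : ℕ, N ≤ i → dualMode g v (n + i) f = 0 := by
  obtain ⟨N, hN⟩ := dualMode_truncation hT hf v
  refine ⟨⌈N - n⌉₊, fun i hi => hN _ ?_⟩
  have := Nat.ceil_le.mp hi
  linarith

lemma mode_truncation_nat (a v : V) (n : ℤ) : ∃ N : ℕ, ∀ i : ℕ, N ≤ i → mode a (n + i) v = 0 := by
  obtain ⟨N, hN⟩ := mode_truncation a v
  exact ⟨(N - n).toNat, fun i hi => hN _ (by omega)⟩

lemma dual_jacobi_of_mem (hg : IsAutomorphism g) (hT : IsOfFinOrder g) {f : Module.Dual ℂ V}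
    (hf : f ∈ regularDual g) {u v : V} {m n₀ : ℚ} (hu : u ∈ sector g m) (hv : v ∈ sector g n₀)
    (l : ℤ) (n : ℚ) :
    (∑ᶠ i : ℕ, ((-1 : ℂ) ^ i * Ring.choose (l : ℂ) i) •
        dualMode g u (m + l - i) (dualMode g v (n + i) f))
      - (∑ᶠ i : ℕ, ((-1 : ℂ) ^ (l + i) * Ring.choose (l : ℂ) i) •
        dualMode g v (n + l - i) (dualMode g u (m + i) f))
      = ∑ᶠ i : ℕ, Ring.choose (m : ℂ) i • dualMode g (mode u (l + i) v) (m + n - i) f := by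
  by_cases hn : ∃ k : ℤ, n = n₀ + k
  · obtain ⟨k, rfl⟩ := hn
    have h := dual_jacobi hg hT hf hu hv l 0 k
    rw [jacobiSum, jacobiSum, iterateSum, smul_finsum] at h
    convert h using 2
    · refine finsum_congr fun i => ?_
      congr 2
      · push_cast; ring
      · congr 1; push_cast; ring
    · refine finsum_congr fun i => ?_
      rw [smul_smul, zpow_add₀ (by norm_num), mul_assoc, zpow_natCast]
      congr 2
      · push_cast; ring
      · congr 1; push_cast; ring
    · funext i
      rw [show m + (n₀ + (k : ℚ)) - (i : ℚ) = m + n₀ + (0 + k - i : ℤ) by push_cast; ring]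
      simp
  · push Not at hn
    have h1 : ∀ i : ℤ, dualMode g v (n + i) = 0 := fun i => funext fun f =>
      dualMode_eq_zero hv (fun k hk => hn (k - i) (by push_cast; linarith)) f
    rw [finsum_eq_zero_of_forall_eq_zero, finsum_eq_zero_of_forall_eq_zero,
      finsum_eq_zero_of_forall_eq_zero, sub_zero]
    · intro i
      rw [dualMode_eq_zero (mode_mem_sector hg hu hv _), smul_zero]
      exact fun k hk => hn (k + i) (by push_cast; linarith)
    · intro i
      have := h1 (l - i)
      push_cast at this
      rw [add_sub_assoc, this]
      simp
    · intro i
      have := h1 i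
      push_cast at this
      rw [this, Pi.zero_apply, dualMode_zero, smul_zero]

lemma dual_jacobi_of_mem_left (hg : IsAutomorphism g) (hT : IsOfFinOrder g) {f : Module.Dual ℂ V}
    (hf : f ∈ regularDual g) {u : V} {m : ℚ} (hu : u ∈ sector g m) (l : ℤ) (n : ℚ) (v : V) :
    (∑ᶠ i : ℕ, ((-1 : ℂ) ^ i * Ring.choose (l : ℂ) i) •
        dualMode g u (m + l - i) (dualMode g v (n + i) f))
      - (∑ᶠ i : ℕ, ((-1 : ℂ) ^ (l + i) * Ring.choose (l : ℂ) i) •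
        dualMode g v (n + l - i) (dualMode g u (m + i) f))
      = ∑ᶠ i : ℕ, Ring.choose (m : ℂ) i • dualMode g (mode u (l + i) v) (m + n - i) f := by
  have hmem := fun a n => dualMode_mem hg hf a n
  obtain ⟨N₂, hN₂⟩ := dualMode_truncation_nat hT hf u m
  have s1 : ∀ v : V, (Function.support fun i : ℕ => ((-1 : ℂ) ^ i * Ring.choose (l : ℂ) i) •
        dualMode g u (m + l - i) (dualMode g v (n + i) f)).Finite := fun v => by
    obtain ⟨N, hN⟩ := dualMode_truncation_nat hT hf v n
    exact finite_support_of_vanishes fun i hi => by rw [hN i hi, dualMode_zero, smul_zero]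
  have s2 : ∀ v : V, (Function.support fun i : ℕ => ((-1 : ℂ) ^ (l + i) * Ring.choose (l : ℂ) i) •
        dualMode g v (n + l - i) (dualMode g u (m + i) f)).Finite := fun v =>
    finite_support_of_vanishes fun i hi => by rw [hN₂ i hi, dualMode_zero, smul_zero]
  have s3 : ∀ v : V, (Function.support fun i : ℕ => Ring.choose (m : ℂ) i •
        dualMode g (mode u (l + i) v) (m + n - i) f).Finite := fun v => by
    obtain ⟨N, hN⟩ := mode_truncation_nat u v l
    exact finite_support_of_vanishes fun i hi => by rw [hN i hi, dualMode_zero_vector, smul_zero]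
  let P : Submodule ℂ V :=
    { carrier := {v | (∑ᶠ i : ℕ, ((-1 : ℂ) ^ i * Ring.choose (l : ℂ) i) •
        dualMode g u (m + l - i) (dualMode g v (n + i) f))
      - (∑ᶠ i : ℕ, ((-1 : ℂ) ^ (l + i) * Ring.choose (l : ℂ) i) •
        dualMode g v (n + l - i) (dualMode g u (m + i) f))
      = ∑ᶠ i : ℕ, Ring.choose (m : ℂ) i • dualMode g (mode u (l + i) v) (m + n - i) f}
      zero_mem' := by simp [dualMode_zero_vector, dualMode_zero]
      add_mem' := by
        intro a b ha hb
        simp only [Set.mem_ofPred_eq] at ha hb ⊢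
        simp only [map_add, dualMode_add_vector hf, dualMode_add (hmem a _) (hmem b _),
          dualMode_add_vector (hmem u _), smul_add]
        rw [finsum_add_distrib (s1 a) (s1 b), finsum_add_distrib (s2 a) (s2 b),
          finsum_add_distrib (s3 a) (s3 b), ← ha, ← hb]
        abel
      smul_mem' := by
        intro c a ha
        simp only [Set.mem_ofPred_eq] at ha ⊢
        simp only [map_smul, dualMode_smul_vector hf, dualMode_smul (hmem a _),
          dualMode_smul_vector (hmem u _), smul_comm _ c]
        rw [← smul_finsum, ← smul_finsum, ← smul_finsum, ← ha, smul_sub] }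
  exact sector_induction hT P (fun n₀ v hv => dual_jacobi_of_mem hg hT hf hu hv l n) v

/-- The mode `aₙ` acting on the regular dual. -/
def regularMode (hg : IsAutomorphism g) : V →ₗ[ℂ] (ℚ → Module.End ℂ (regularDual g)) where
  toFun a n :=
    { toFun f := ⟨dualMode g a n f, dualMode_mem hg f.2 a n⟩
      map_add' f f' := Subtype.ext (dualMode_add f.2 f'.2 a n)
      map_smul' c f := Subtype.ext (dualMode_smul f.2 c a n) }
  map_add' a b := by
    funext n; ext1 f; exact Subtype.ext (dualMode_add_vector f.2 a b n)
  map_smul' c a := by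
    funext n; ext1 f; exact Subtype.ext (dualMode_smul_vector f.2 c a n)

lemma coe_regularMode (hg : IsAutomorphism g) (a : V) (n : ℚ) (f : regularDual g) :
    (regularMode hg a n f : Module.Dual ℂ V) = dualMode g a n f := rfl

lemma coe_finsum {E : Type*} [AddCommGroup E] [Module ℂ E] {W : Submodule ℂ E} (x : ℕ → W) :
    ((∑ᶠ i, x i : W) : E) = ∑ᶠ i, (x i : E) :=
  AddMonoidHom.map_finsum_of_injective W.subtype.toAddMonoidHom W.subtype_injective x

/-- The weak `g`-twisted module structure on the regular dual. -/
def regularModule (hg : IsAutomorphism g) (hT : IsOfFinOrder g) :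
    WeakTwistedModule g (regularDual g) where
  mode := regularMode hg
  mode_eq_zero r _ u hu n hn := by
    rw [twistedSector_eq] at hu
    ext1 f
    exact Subtype.ext (dualMode_eq_zero hu hn f)
  truncation v w := by
    obtain ⟨N, hN⟩ := dualMode_truncation hT w.2 v
    exact ⟨N, fun l hl => Subtype.ext (hN l hl)⟩
  vacuum_mode n := by
    ext1 f
    refine Subtype.ext ?_
    rw [coe_regularMode, dualMode_vacuum hg hT]
    split_ifs <;> rfl
  jacobi r _ u hu v w l k m n hm := by
    rw [twistedSector_eq] at hu
    have hu' : u ∈ sector g m := by rw [hm, sector_add_int]; exact hu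
    refine Subtype.ext ?_
    simp only [Submodule.coe_sub, coe_finsum, Submodule.coe_smul, coe_regularMode, intCast_choose]
    exact dual_jacobi_of_mem_left hg hT w.2 hu' l n v

end

/-! ### Weights and submodules generated by a vector or a functional. -/

section

variable {V : Type u} [AddCommGroup V] [Module ℂ V] [VertexOperatorAlgebra V]
  {g : V ≃ₗ[ℂ] V}

section Weights

lemma choose_one_of_two_le {i : ℕ} (hi : 2 ≤ i) : Ring.choose (1 : ℂ) i = 0 := by
  have h := Ring.choose_natCast (R := ℂ) 1 i
  rw [Nat.cast_one] at h
  rw [h, Nat.choose_eq_zero_of_lt (by omega), Nat.cast_zero]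

lemma mem_weightSpace {d : ℤ} {u : V} : u ∈ weightSpace V d ↔ mode omega 1 u = (d : ℂ) • u :=
  Module.End.mem_eigenspace_iff

lemma mode_omega_zero (u : V) (n : ℤ) :
    mode (mode omega 0 u) n = (-(n : ℂ)) • mode u (n - 1) := derivative u n

lemma mode_creation (u : V) : mode u (-1) vacuum = u := creation u

lemma mode_creation_of_nonneg (u : V) {n : ℤ} (hn : 0 ≤ n) : mode u n vacuum = 0 :=
  creation_of_nonneg u n hn

lemma mode_neg_two_vacuum (u : V) : mode u (-2) vacuum = mode omega 0 u := by
  have h := LinearMap.congr_fun (mode_omega_zero u (-1)) vacuum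
  rw [mode_creation] at h
  rw [h]; norm_num

lemma mode_commutator (u v w : V) (m n : ℤ) : mode u m (mode v n w) - mode v n (mode u m w) =
    ∑ᶠ i : ℕ, Ring.choose (m : ℂ) i • mode (mode u i v) (m + n - i) w := by
  have h := jacobi u v w 0 m n
  simp only [intCast_choose] at h
  rw [finsum_eq_single _ 0, finsum_eq_single _ 0] at h
  · simpa [mode] using h
  · intro i hi
    rw [Int.cast_zero, Ring.choose_zero_pos ℂ (Nat.pos_of_ne_zero hi)]; simp
  · intro i hi
    rw [Int.cast_zero, Ring.choose_zero_pos ℂ (Nat.pos_of_ne_zero hi)]; simp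

lemma mode_mem_weightSpace {d e : ℤ} {u v : V} (hu : u ∈ weightSpace V d)
    (hv : v ∈ weightSpace V e) (n : ℤ) : mode u n v ∈ weightSpace V (d + e - n - 1) := by
  rw [mem_weightSpace] at *
  have h := mode_commutator omega u v 1 n
  rw [finsum_eq_sum_range (N := 2) fun i hi => by
    rw [Int.cast_one, choose_one_of_two_le hi, zero_smul]] at h
  simp only [Finset.sum_range_succ, Finset.sum_range_zero, zero_add, Ring.choose_zero_right,
    Ring.choose_one_right, one_smul, Int.cast_one, Nat.cast_zero, Nat.cast_one, sub_zero] at h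
  rw [hv, mode_omega_zero, hu, mode_smul_left, show 1 + n - 1 = n by ring] at h
  rw [sub_eq_iff_eq_add.mp h]
  simp only [LinearMap.smul_apply, map_smul]
  push_cast
  module

lemma vacuum_mem_weightSpace : (vacuum : V) ∈ weightSpace V 0 := by
  rw [mem_weightSpace, mode_creation_of_nonneg _ (by norm_num)]; simp

lemma omega_mem_weightSpace : (omega : V) ∈ weightSpace V 2 := by
  rw [mem_weightSpace]
  have h := virasoro 0 (-2) (vacuum : V)
  change mode omega (0 + 1) (mode omega (-2 + 1) vacuum) -
    mode omega (-2 + 1) (mode omega (0 + 1) vacuum) = _ • mode omega (0 + -2 + 1) vacuum + _ at h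
  norm_num at h
  rw [mode_creation, mode_creation_of_nonneg _ (by norm_num), map_zero, sub_zero] at h
  rw [h]; norm_num

end Weights

namespace WeakTwistedModule

variable {M : Type u} [AddCommGroup M] [Module ℂ M] (X : WeakTwistedModule g M)

lemma mode_eq_zero_of_mem (hT : IsOfFinOrder g) {m n : ℚ} {u : V} (hu : u ∈ sector g m)
    (hn : ∀ k : ℤ, n ≠ m + k) : X.mode u n = 0 := by
  rcases exists_eq_of_mem_sector hT hu with rfl | ⟨r, k, hr, hur, rfl⟩
  · simp
  · exact X.mode_eq_zero r hr u hur n fun l hl => hn (l - k) (by rw [hl]; push_cast; ring)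

lemma truncation_nat (v : V) (w : M) (n : ℚ) :
    ∃ N : ℕ, ∀ i : ℕ, N ≤ i → X.mode v (n + i) w = 0 := by
  obtain ⟨N, hN⟩ := X.truncation v w
  refine ⟨⌈N - n⌉₊, fun i hi => hN _ ?_⟩
  have := Nat.ceil_le.mp hi
  linarith

lemma jacobi_of_mem (hT : IsOfFinOrder g) {m : ℚ} {u : V} (hu : u ∈ sector g m) (v : V) (w : M)
    (l : ℤ) (n : ℚ) :
    (∑ᶠ i : ℕ, ((-1 : ℂ) ^ i * Ring.choose (l : ℂ) i) •
        X.mode u (m + l - i) (X.mode v (n + i) w))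
      - (∑ᶠ i : ℕ, ((-1 : ℂ) ^ (l + i) * Ring.choose (l : ℂ) i) •
        X.mode v (n + l - i) (X.mode u (m + i) w))
      = ∑ᶠ i : ℕ, Ring.choose (m : ℂ) i •
        X.mode (VertexOperatorAlgebra.mode u (l + i) v) (m + n - i) w := by
  rcases exists_eq_of_mem_sector hT hu with rfl | ⟨r, k, hr, hur, hm⟩
  · simp [VertexOperatorAlgebra.mode]
  · have h := X.jacobi r hr u hur v w l k m n hm
    simpa only [intCast_choose] using h

/-- The derivative property of the vertex operators on a twisted module. -/
lemma mode_derivative (hg : IsAutomorphism g) (hT : IsOfFinOrder g) (u : V) (n : ℚ) :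
    X.mode (VertexOperatorAlgebra.mode omega 0 u) n = (-(n : ℂ)) • X.mode u (n - 1) := by
  let P : Submodule ℂ V := LinearMap.ker
    ((LinearMap.proj n ∘ₗ X.mode ∘ₗ VertexOperatorAlgebra.mode (omega : V) 0) +
      (n : ℂ) • (LinearMap.proj (n - 1) ∘ₗ X.mode) : V →ₗ[ℂ] Module.End ℂ M)
  have hP : ∀ u, u ∈ P ↔ X.mode (VertexOperatorAlgebra.mode omega 0 u) n =
      (-(n : ℂ)) • X.mode u (n - 1) := fun u => by
    rw [LinearMap.mem_ker, LinearMap.add_apply, add_eq_zero_iff_eq_neg, neg_smul]; rfl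
  rw [← hP]
  refine sector_induction hT P (fun m u hu => ?_) u
  rw [hP]
  by_cases hn : ∃ k : ℤ, n = m + k
  · obtain ⟨k, rfl⟩ := hn
    rw [← sector_add_int m k] at hu
    ext w
    -- With the vacuum and l = -2 both products vanish, since mode -1 of the vacuum never occurs. On
    -- the right only u_{-2}𝟏 = L(-1)u and u_{-1}𝟏 = u remain.
    have h := X.jacobi_of_mem hT hu vacuum w (-2) 0
    rw [finsum_eq_zero_of_forall_eq_zero, finsum_eq_zero_of_forall_eq_zero,
      finsum_eq_sum_range (N := 2)] at h
    · simp only [Finset.sum_range_succ, Finset.sum_range_zero, zero_add, Ring.choose_zero_right,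
        Ring.choose_one_right, one_smul, Nat.cast_zero, Nat.cast_one, sub_zero, add_zero] at h
      rw [mode_neg_two_vacuum, show (-2 : ℤ) + 1 = -1 by norm_num, mode_creation] at h
      rw [LinearMap.smul_apply, neg_smul, eq_neg_iff_add_eq_zero, ← h]
    · intro i hi
      rw [mode_creation_of_nonneg _ (by omega)]; simp
    · intro i
      rw [X.vacuum_mode, if_neg, LinearMap.zero_apply, smul_zero]
      intro h
      have : (i : ℚ) = ((-1 : ℤ) : ℚ) := by push_cast at h ⊢; linarith
      have : (i : ℤ) = -1 := by exact_mod_cast this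
      omega
    · intro i
      rw [X.vacuum_mode, if_neg, LinearMap.zero_apply, map_zero, smul_zero]
      intro h
      have : (i : ℚ) = ((-1 : ℤ) : ℚ) := by push_cast at h ⊢; linarith
      have : (i : ℤ) = -1 := by exact_mod_cast this
      omega
  · push Not at hn
    have h1 : VertexOperatorAlgebra.mode omega 0 u ∈ sector g m := by
      have := mode_mem_sector hg (omega_mem_sector hg) hu 0
      rwa [zero_add] at this
    rw [X.mode_eq_zero_of_mem hT h1 hn, X.mode_eq_zero_of_mem hT hu, smul_zero]
    intro k hk
    exact hn (k + 1) (by push_cast; linarith)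

lemma mem_weightSpace {c : ℂ} {w : M} : w ∈ X.weightSpace c ↔ X.mode omega 1 w = c • w :=
  Module.End.mem_eigenspace_iff

lemma omega_mem_sector_int (hg : IsAutomorphism g) (k : ℤ) : (omega : V) ∈ sector g (k : ℚ) := by
  rw [← zero_add (k : ℚ), sector_add_int]; exact omega_mem_sector hg

lemma mode_mem_weightSpace (hg : IsAutomorphism g) (hT : IsOfFinOrder g) {d : ℤ} {u : V}
    (hu : u ∈ VertexOperatorAlgebra.weightSpace V d) {c : ℂ} {w : M} (hw : w ∈ X.weightSpace c)
    (n : ℚ) : X.mode u n w ∈ X.weightSpace (c + d - n - 1) := by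
  rw [X.mem_weightSpace] at hw ⊢
  rw [VertexOperatorAlgebra.mem_weightSpace] at hu
  have h := X.jacobi_of_mem hT (omega_mem_sector_int hg 1) u w 0 n
  rw [finsum_eq_single _ 0, finsum_eq_single _ 0, finsum_eq_sum_range (N := 2)] at h
  · simp only [Finset.sum_range_succ, Finset.sum_range_zero, zero_add, Ring.choose_zero_right,
      Ring.choose_one_right, one_smul, Nat.cast_zero, Nat.cast_one, sub_zero, add_zero,
      Int.cast_zero, Int.cast_one, pow_zero, zpow_zero, mul_one, Rat.cast_one] at h
    rw [X.mode_derivative hg hT, hu, hw, map_smul, map_smul, show 1 + n - 1 = n by ring] at h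
    rw [sub_eq_iff_eq_add.mp h]
    simp only [LinearMap.smul_apply, Pi.smul_apply]
    push_cast
    module
  · intro i hi
    rw [Int.cast_one, Rat.cast_one, choose_one_of_two_le hi, zero_smul]
  · intro i hi
    rw [Int.cast_zero, Ring.choose_zero_pos ℂ (Nat.pos_of_ne_zero hi)]; simp
  · intro i hi
    rw [Int.cast_zero, Ring.choose_zero_pos ℂ (Nat.pos_of_ne_zero hi)]; simp

/-- The span of all `uₙ w`, for fixed `w`. -/
def orbit (w : M) : Submodule ℂ M := Submodule.span ℂ {y | ∃ (u : V) (n : ℚ), y = X.mode u n w}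

lemma mode_mem_orbit (w : M) (u : V) (n : ℚ) : X.mode u n w ∈ X.orbit w :=
  Submodule.subset_span ⟨u, n, rfl⟩

lemma self_mem_orbit (w : M) : w ∈ X.orbit w := by
  have := X.mode_mem_orbit w vacuum (-1)
  rwa [X.vacuum_mode, if_pos rfl] at this

/-- The exponent m+K is chosen so that a_{m+K+j} w = 0 for all j ≥ 0, which removes one of the
products in the Jacobi identity. The other has the desired product as leading term; its remaining
terms have b-modes of higher index, treated by descending induction. -/
lemma mode_mode_mem_orbit (hT : IsOfFinOrder g) (w : M) (a b : V) (p q : ℚ) :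
    X.mode a p (X.mode b q w) ∈ X.orbit w := by
  let P : Submodule ℂ V := (X.orbit w).comap
    (LinearMap.applyₗ (X.mode b q w) ∘ₗ LinearMap.proj p ∘ₗ X.mode : V →ₗ[ℂ] M)
  change a ∈ P
  refine sector_induction hT P (fun m a ha => ?_) a
  change X.mode a p (X.mode b q w) ∈ X.orbit w
  by_cases hp : ∃ k : ℤ, p = m + k
  · obtain ⟨k, rfl⟩ := hp
    obtain ⟨N, hN⟩ := X.truncation_nat b w q
    obtain ⟨K, hK⟩ := X.truncation_nat a w m
    have key : ∀ s : ℕ, ∀ i : ℕ, N ≤ i + s → ∀ k : ℤ,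
        X.mode a (m + k) (X.mode b (q + i) w) ∈ X.orbit w := by
      intro s
      induction s with
      | zero =>
        intro i hi k
        rw [hN i (by omega), map_zero]; exact Submodule.zero_mem _
      | succ s ih =>
        intro i hi k
        have ha' := ha
        rw [← sector_add_int m K] at ha'
        have h := X.jacobi_of_mem hT ha' b w (k - K) (q + i)
        obtain ⟨I, hI⟩ := mode_truncation_nat a b (k - K)
        rw [finsum_eq_sum_range (N := N + 1) fun j hj => by
            rw [add_assoc q, ← Nat.cast_add, hN (i + j) (by omega), map_zero, smul_zero],
          finsum_eq_zero_of_forall_eq_zero (fun j => by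
            have := hK (K + j) (by omega)
            rw [Nat.cast_add, ← add_assoc] at this
            rw [Int.cast_natCast, this, map_zero, smul_zero]), sub_zero,
          finsum_eq_sum_range (N := I) fun j hj => by rw [hI j hj]; simp,
          Finset.sum_range_succ'] at h
        have h3 : X.mode a (m + (K : ℤ) + (k - K : ℤ) - (0 : ℕ)) (X.mode b (q + i + (0 : ℕ)) w) =
            X.mode a (m + k) (X.mode b (q + i) w) := by
          rw [show m + ((K : ℤ) : ℚ) + (k - K : ℤ) - (0 : ℕ) = m + k by push_cast; ring,
            Nat.cast_zero, add_zero]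
        rw [h3, pow_zero, Ring.choose_zero_right, one_mul, one_smul, ← eq_sub_iff_add_eq'] at h
        rw [h]
        refine Submodule.sub_mem _ (Submodule.sum_mem _ fun j _ => Submodule.smul_mem _ _
          (X.mode_mem_orbit _ _ _)) (Submodule.sum_mem _ fun j _ => Submodule.smul_mem _ _ ?_)
        have := ih (i + (j + 1)) (by omega) (k - (j + 1 : ℕ))
        rw [show m + ((K : ℤ) : ℚ) + (k - K : ℤ) - (j + 1 : ℕ) = m + (k - (j + 1 : ℕ) : ℤ) by
          push_cast; ring, add_assoc q, ← Nat.cast_add]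
        exact this
    have := key N 0 (by omega) k
    simpa using this
  · push Not at hp
    rw [X.mode_eq_zero_of_mem hT ha hp]; exact Submodule.zero_mem _

lemma orbit_stable (hT : IsOfFinOrder g) (w : M) (v : V) (n : ℚ) {x : M} (hx : x ∈ X.orbit w) :
    X.mode v n x ∈ X.orbit w := by
  refine Submodule.span_le (p := (X.orbit w).comap (X.mode v n)) |>.mpr ?_ hx
  rintro _ ⟨u, m, rfl⟩
  exact X.mode_mode_mem_orbit hT w v u n m

/-- The span of all `φ ∘ uₙ`, for a fixed functional `φ`. -/
def dualOrbit (φ : Module.Dual ℂ M) : Submodule ℂ (Module.Dual ℂ M) :=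
  Submodule.span ℂ {y | ∃ (u : V) (n : ℚ), y = φ ∘ₗ X.mode u n}

lemma comp_mode_mem_dualOrbit (φ : Module.Dual ℂ M) (u : V) (n : ℚ) :
    φ ∘ₗ X.mode u n ∈ X.dualOrbit φ := Submodule.subset_span ⟨u, n, rfl⟩

/-- The mirror image of `mode_mode_mem_orbit`: φ kills modes of very negative index, so l = -L with
L large removes the products in which the mode of a acts last. In those that remain, the leading
term is the desired one and the others have b-modes of lower index, which φ eventually kills. -/
lemma comp_mode_mode_mem_dualOrbit (hT : IsOfFinOrder g) {φ : Module.Dual ℂ M}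
    (hφ : ∀ u : V, ∃ K : ℚ, ∀ n, n ≤ K → φ ∘ₗ X.mode u n = 0) (a b : V) (p q : ℚ) :
    φ ∘ₗ X.mode b q ∘ₗ X.mode a p ∈ X.dualOrbit φ := by
  have hφ' : ∀ (u : V) (n : ℚ), ∃ N : ℕ, ∀ i : ℕ, N ≤ i → φ ∘ₗ X.mode u (n - i) = 0 := fun u n => by
    obtain ⟨K, hK⟩ := hφ u
    refine ⟨⌈n - K⌉₊, fun i hi => hK _ ?_⟩
    have := Nat.ceil_le.mp hi
    linarith
  let P : Submodule ℂ V := (X.dualOrbit φ).comap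
    ((LinearMap.llcomp ℂ M M ℂ (φ ∘ₗ X.mode b q)) ∘ₗ LinearMap.proj p ∘ₗ X.mode :
      V →ₗ[ℂ] Module.Dual ℂ M)
  change a ∈ P
  refine sector_induction hT P (fun m a ha => ?_) a
  change φ ∘ₗ X.mode b q ∘ₗ X.mode a p ∈ X.dualOrbit φ
  by_cases hp : ∃ k : ℤ, p = m + k
  · obtain ⟨k, rfl⟩ := hp
    obtain ⟨N, hN⟩ := hφ' b q
    have key : ∀ s : ℕ, ∀ i : ℕ, N ≤ i + s → ∀ k : ℤ,
        φ ∘ₗ X.mode b (q - i) ∘ₗ X.mode a (m + k) ∈ X.dualOrbit φ := by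
      intro s
      induction s with
      | zero =>
        intro i hi k
        rw [← LinearMap.comp_assoc, hN i (by omega), LinearMap.zero_comp]
        exact Submodule.zero_mem _
      | succ s ih =>
        intro i hi k
        obtain ⟨L, hL⟩ := hφ' a (m + k)
        have ha' := ha
        rw [← sector_add_int m k] at ha'
        obtain ⟨I, hI⟩ := mode_truncation_nat a b (-(L : ℤ))
        have h : ∀ w, -(∑ j ∈ Finset.range (N + 1),
            ((-1 : ℂ) ^ (-(L : ℤ) + j) * Ring.choose ((-(L : ℤ) : ℤ) : ℂ) j) •
              (φ ∘ₗ X.mode b (q - (i + j : ℕ)) ∘ₗ X.mode a (m + (k + j : ℤ))) w) =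
            ∑ j ∈ Finset.range I, Ring.choose ((m + k : ℚ) : ℂ) j • (φ ∘ₗ
              X.mode (VertexOperatorAlgebra.mode a (-(L : ℤ) + j) b)
                (m + k + (q - i + L) - j)) w := by
          intro w
          have h := X.jacobi_of_mem hT ha' b w (-(L : ℤ)) (q - i + L)
          obtain ⟨N₁, hN₁⟩ := X.truncation_nat b w (q - i + L)
          obtain ⟨N₂, hN₂⟩ := X.truncation_nat a w (m + k)
          -- N₂ depends on w; since φ kills the terms beyond N, the excess is dropped below and the
          -- range becomes independent of w.
          rw [finsum_eq_sum_range (N := N₁) fun j hj => by rw [hN₁ j hj, map_zero, smul_zero],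
            finsum_eq_sum_range (N := N + 1 + N₂) fun j hj => by
              rw [hN₂ j (by omega), map_zero, smul_zero],
            finsum_eq_sum_range (N := I) fun j hj => by rw [hI j hj]; simp] at h
          replace h := congrArg φ h
          simp only [map_sub, map_sum, map_smul] at h
          rw [Finset.sum_eq_zero fun j _ => ?_, zero_sub, Finset.sum_range_add,
            Finset.sum_eq_zero (s := Finset.range N₂) fun j _ => ?_, add_zero] at h
          · simp only [LinearMap.comp_apply]
            rw [← h]
            congr 1
            refine Finset.sum_congr rfl fun j _ => ?_
            rw [show q - (i : ℚ) + L + (-(L : ℤ) : ℤ) - j = q - (i + j : ℕ) by push_cast; ring,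
              show m + (k : ℚ) + j = m + (k + j : ℤ) by push_cast; ring]
          · rw [show q - (i : ℚ) + L + (-(L : ℤ) : ℤ) - (N + 1 + j : ℕ) = q - (i + (N + 1 + j) : ℕ) by
              push_cast; ring]
            have := LinearMap.congr_fun (hN (i + (N + 1 + j)) (by omega))
              (X.mode a (m + k + (N + 1 + j : ℕ)) w)
            rw [LinearMap.comp_apply] at this
            rw [this, LinearMap.zero_apply, smul_zero]
          · rw [show m + (k : ℚ) + (-(L : ℤ) : ℤ) - j = m + k - (L + j : ℕ) by push_cast; ring]
            have := LinearMap.congr_fun (hL (L + j) (by omega)) (X.mode b (q - i + L + j) w)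
            rw [LinearMap.comp_apply] at this
            rw [this, LinearMap.zero_apply, smul_zero]
        have h' : ∑ j ∈ Finset.range (N + 1),
            ((-1 : ℂ) ^ (-(L : ℤ) + j) * Ring.choose ((-(L : ℤ) : ℤ) : ℂ) j) •
              (φ ∘ₗ X.mode b (q - (i + j : ℕ)) ∘ₗ X.mode a (m + (k + j : ℤ))) ∈ X.dualOrbit φ := by
          rw [← Submodule.neg_mem_iff, show -(∑ j ∈ Finset.range (N + 1),
            ((-1 : ℂ) ^ (-(L : ℤ) + j) * Ring.choose ((-(L : ℤ) : ℤ) : ℂ) j) •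
              (φ ∘ₗ X.mode b (q - (i + j : ℕ)) ∘ₗ X.mode a (m + (k + j : ℤ)))) =
            ∑ j ∈ Finset.range I, Ring.choose ((m + k : ℚ) : ℂ) j • (φ ∘ₗ
              X.mode (VertexOperatorAlgebra.mode a (-(L : ℤ) + j) b)
                (m + k + (q - i + L) - j)) from LinearMap.ext fun w => by
              rw [LinearMap.neg_apply, LinearMap.sum_apply, LinearMap.sum_apply]; exact h w]
          exact Submodule.sum_mem _ fun j _ => Submodule.smul_mem _ _
            (X.comp_mode_mem_dualOrbit _ _ _)
        rw [Finset.sum_range_succ', Submodule.add_mem_iff_right _ (Submodule.sum_mem _ fun j _ =>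
          Submodule.smul_mem _ _ (ih (i + (j + 1)) (by omega) (k + (j + 1 : ℕ)))),
          Ring.choose_zero_right, mul_one, Submodule.smul_mem_iff _ (zpow_ne_zero _ (by norm_num))]
          at h'
        simpa using h'
    have := key N 0 (by omega) k
    simpa using this
  · push Not at hp
    rw [X.mode_eq_zero_of_mem hT ha hp, LinearMap.comp_zero, LinearMap.comp_zero]
    exact Submodule.zero_mem _

lemma dualOrbit_stable (hT : IsOfFinOrder g) {φ : Module.Dual ℂ M}
    (hφ : ∀ u : V, ∃ K : ℚ, ∀ n, n ≤ K → φ ∘ₗ X.mode u n = 0) (v : V) (n : ℚ)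
    {ψ : Module.Dual ℂ M} (hψ : ψ ∈ X.dualOrbit φ) : ψ ∘ₗ X.mode v n ∈ X.dualOrbit φ := by
  refine Submodule.span_le (p := (X.dualOrbit φ).comap
    (LinearMap.lcomp ℂ ℂ (X.mode v n))) |>.mpr ?_ hψ
  rintro _ ⟨u, m, rfl⟩
  exact X.comp_mode_mode_mem_dualOrbit hT hφ v u n m

end WeakTwistedModule

end

/-! ### Submodules, quotients and simple subquotients. -/

section

namespace WeakTwistedModule

variable {V : Type u} [AddCommGroup V] [Module ℂ V] [VertexOperatorAlgebra V]
  {g : V ≃ₗ[ℂ] V} {M : Type u} [AddCommGroup M] [Module ℂ M] (X : WeakTwistedModule g M)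

/-- The structure induced on a subspace stable under all modes. -/
def restrict (W : Submodule ℂ M) (hW : ∀ (v : V) (n : ℚ), ∀ w ∈ W, X.mode v n w ∈ W) :
    WeakTwistedModule g W where
  mode :=
    { toFun v n := (X.mode v n).restrict (hW v n)
      map_add' a b := by
        funext n; ext w
        simp [map_add]
      map_smul' c a := by
        funext n; ext w
        simp [map_smul] }
  mode_eq_zero r hr u hu n hn := by
    ext w
    have := LinearMap.congr_fun (X.mode_eq_zero r hr u hu n hn) w
    simpa using this
  truncation v w := by
    obtain ⟨N, hN⟩ := X.truncation v w
    exact ⟨N, fun l hl => Subtype.ext (hN l hl)⟩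
  vacuum_mode n := by
    ext w
    have := LinearMap.congr_fun (X.vacuum_mode n) w
    simp only [LinearMap.coe_mk, AddHom.coe_mk, LinearMap.coe_restrict_apply, this]
    split_ifs <;> rfl
  jacobi r hr u hu v w l k m n hm := by
    refine Subtype.ext ?_
    simp only [Submodule.coe_sub, coe_finsum, Submodule.coe_smul]
    exact X.jacobi r hr u hu v w l k m n hm

/-- The structure induced on the quotient by a subspace stable under all modes. -/
def quotient (K : Submodule ℂ M) (hK : ∀ (v : V) (n : ℚ), ∀ w ∈ K, X.mode v n w ∈ K) :
    WeakTwistedModule g (M ⧸ K) where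
  mode :=
    { toFun v n := K.mapQ K (X.mode v n) (hK v n)
      map_add' a b := by
        funext n; ext w
        simp [map_add]
      map_smul' c a := by
        funext n; ext w
        simp [map_smul] }
  mode_eq_zero r hr u hu n hn := by
    ext w
    have := LinearMap.congr_fun (X.mode_eq_zero r hr u hu n hn) w
    simp [this]
  truncation v w := by
    obtain ⟨w, rfl⟩ := K.mkQ_surjective w
    obtain ⟨N, hN⟩ := X.truncation v w
    exact ⟨N, fun l hl => by simp [hN l hl]⟩
  vacuum_mode n := by
    ext w
    have := LinearMap.congr_fun (X.vacuum_mode n) w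
    simp only [LinearMap.coe_mk, AddHom.coe_mk, LinearMap.comp_apply, Submodule.mkQ_apply,
      Submodule.mapQ_apply, this]
    split_ifs <;> rfl
  jacobi r hr u hu v w l k m n hm := by
    obtain ⟨w, rfl⟩ := K.mkQ_surjective w
    have h := congrArg K.mkQ (X.jacobi r hr u hu v w l k m n hm)
    obtain ⟨N₁, h₁⟩ := X.truncation_nat v w n
    obtain ⟨N₂, h₂⟩ := X.truncation_nat u w m
    obtain ⟨N₃, h₃⟩ := mode_truncation_nat u v l
    rw [finsum_eq_sum_range (N := N₁) fun i hi => by rw [h₁ i hi, map_zero, smul_zero],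
      finsum_eq_sum_range (N := N₂) fun i hi => by rw [h₂ i hi, map_zero, smul_zero],
      finsum_eq_sum_range (N := N₃) fun i hi => by rw [h₃ i hi]; simp] at h
    rw [finsum_eq_sum_range (N := N₁), finsum_eq_sum_range (N := N₂), finsum_eq_sum_range (N := N₃)]
    · simpa [map_sub, map_sum, map_smul] using h
    · intro i hi
      rw [h₃ i hi]; simp
    · intro i hi
      simp [h₂ i hi]
    · intro i hi
      simp [h₁ i hi]

/-- A nonzero vector of a weak twisted module has a nonzero image in a simple subquotient. -/
lemma exists_simple_subquotient (hT : IsOfFinOrder g) {w : M} (hw : w ≠ 0) :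
    ∃ (S : Type u) (_ : AddCommGroup S) (_ : Module ℂ S) (Z : WeakTwistedModule g S) (s : S),
      s ≠ 0 ∧ Z.IsSimple ∧ ∀ (v : V) (n : ℚ) (c : ℂ), X.mode v n w = c • w →
        Z.mode v n s = c • s := by
  -- Zorn gives a stable K maximal among those avoiding w. In M/K every nonzero stable subspace
  -- contains the image of w, so the submodule generated by that image is simple.
  obtain ⟨K, ⟨hK, hwK⟩, hmax⟩ : ∃ K : Submodule ℂ M, ((∀ (v : V) (n : ℚ), ∀ x ∈ K,
      X.mode v n x ∈ K) ∧ w ∉ K) ∧ ∀ K' : Submodule ℂ M, ((∀ (v : V) (n : ℚ), ∀ x ∈ K',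
      X.mode v n x ∈ K') ∧ w ∉ K') → K ≤ K' → K' = K := by
    obtain ⟨K, -, hK⟩ := zorn_le_nonempty₀ {K : Submodule ℂ M | (∀ (v : V) (n : ℚ), ∀ x ∈ K,
      X.mode v n x ∈ K) ∧ w ∉ K} (fun c hc hchain K₀ hK₀ => by
        refine ⟨sSup c, ⟨fun v n x hx => ?_, fun hx => ?_⟩, fun K hK => le_sSup hK⟩
        · obtain ⟨K, hKc, hxK⟩ := (Submodule.mem_sSup_of_directed ⟨K₀, hK₀⟩
            hchain.directedOn).mp hx
          exact le_sSup hKc ((hc hKc).1 v n x hxK)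
        · obtain ⟨K, hKc, hxK⟩ := (Submodule.mem_sSup_of_directed ⟨K₀, hK₀⟩
            hchain.directedOn).mp hx
          exact (hc hKc).2 hxK) ⊥ ⟨fun v n x hx => by
            rw [Submodule.mem_bot] at hx ⊢
            rw [hx, map_zero], by simpa using hw⟩
    exact ⟨K, hK.prop, fun K' hK' hle => le_antisymm (hK.le_of_ge hK' hle) hle⟩
  set Q := X.quotient K hK with hQ
  have hQm : ∀ (v : V) (n : ℚ) (x : M), Q.mode v n (K.mkQ x) = K.mkQ (X.mode v n x) :=
    fun v n x => rfl
  set q : M ⧸ K := K.mkQ w with hq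
  have hq0 : q ≠ 0 := fun h => hwK ((Submodule.Quotient.mk_eq_zero K).mp h)
  set Z := Q.restrict (Q.orbit q) (fun v n x hx => Q.orbit_stable hT q v n hx) with hZ
  have hZm : ∀ (v : V) (n : ℚ) (x : Q.orbit q), ((Z.mode v n x : Q.orbit q) : M ⧸ K) =
    Q.mode v n x := fun v n x => rfl
  have hs0 : (⟨q, Q.self_mem_orbit q⟩ : Q.orbit q) ≠ 0 := fun h => hq0 (congrArg Subtype.val h)
  refine ⟨Q.orbit q, inferInstance, inferInstance, Z, ⟨q, Q.self_mem_orbit q⟩, hs0, ⟨⟨_, _, hs0⟩,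
    fun U hU => ?_⟩, fun v n c h => ?_⟩
  · by_cases hwU : w ∈ (U.map (Q.orbit q).subtype).comap K.mkQ
    · right
      obtain ⟨x, hxU, hx⟩ := hwU
      rw [eq_top_iff]
      rintro ⟨y, hy⟩ -
      have hle : Q.orbit q ≤ U.map (Q.orbit q).subtype := by
        refine Submodule.span_le.mpr ?_
        rintro _ ⟨u, n, rfl⟩
        refine ⟨Z.mode u n x, hU u n x hxU, ?_⟩
        change Q.mode u n ((Q.orbit q).subtype x) = _
        rw [hx]
      obtain ⟨z, hzU, hz⟩ := hle hy
      have : z = ⟨y, hy⟩ := Subtype.ext hz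
      rwa [← this]
    · left
      have h1 := hmax ((U.map (Q.orbit q).subtype).comap K.mkQ) ⟨fun v n x hx => ?_, hwU⟩
        (fun x hx => ?_)
      · rw [eq_bot_iff]
        intro x hx
        obtain ⟨y, hy⟩ := K.mkQ_surjective (x : M ⧸ K)
        have hyK : y ∈ K := by
          rw [← h1]
          exact ⟨x, hx, hy.symm⟩
        rw [Submodule.mem_bot]
        refine Subtype.ext ?_
        rw [← hy]
        exact (Submodule.Quotient.mk_eq_zero K).mpr hyK
      · obtain ⟨y, hyU, hy⟩ := hx
        refine ⟨Z.mode v n y, hU v n y hyU, ?_⟩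
        change Q.mode v n ((Q.orbit q).subtype y) = _
        rw [hy]; rfl
      · have : K.mkQ x = 0 := (Submodule.Quotient.mk_eq_zero K).mpr hx
        rw [Submodule.mem_comap, this]
        exact Submodule.zero_mem _
  · refine Subtype.ext ?_
    rw [hZm]
    change Q.mode v n (K.mkQ w) = c • K.mkQ w
    rw [hQm, h, map_smul]

end WeakTwistedModule

end

/-! ### The dual of A_g(V) inside the regular dual. -/

section

variable {V : Type u} [AddCommGroup V] [Module ℂ V] [VertexOperatorAlgebra V]
  {g : V ≃ₗ[ℂ] V}

/-- Integration by parts. -/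
lemma bra_omega_zero (u : V) (α : ℂ) (q : ℤ) : bra (mode omega 0 u) α q =
    (-α) • bra u (α - 1) q + (-(q : ℂ)) • bra u α (q - 1) := by
  ext v
  obtain ⟨N, hN⟩ := exists_bound (mode_truncation u v) (q - 1)
  have h0 := hN N le_rfl
  simp only [LinearMap.add_apply, LinearMap.smul_apply, bra_apply, mode_omega_zero]
  rw [act_eq_sum _ (N := N + 1) fun n hn => by rw [h0 _ (by push_cast at hn; omega), smul_zero],
    act_eq_sum _ (N := N) (p := q) fun n hn => h0 _ (by omega),
    act_eq_sum _ (N := N + 1) (p := q - 1) fun n hn => h0 _ (by push_cast at hn; omega)]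
  simp only [coeff_bin, smul_smul]
  have h1 : ∀ i : ℕ, (Ring.choose α i * -((q + i : ℤ) : ℂ)) • mode u (q + i - 1) v =
      (-((i : ℂ) * Ring.choose α i)) • mode u (q + i - 1) v +
        (-(q : ℂ)) • Ring.choose α i • mode u (q - 1 + i) v := fun i => by
    rw [show q - 1 + (i : ℤ) = q + i - 1 by ring]
    push_cast
    module
  rw [Finset.sum_congr rfl fun i _ => h1 i, Finset.sum_add_distrib, ← Finset.smul_sum]
  congr 1
  rw [Finset.sum_range_succ', Finset.smul_sum]
  simp only [Nat.cast_zero, zero_mul, neg_zero, zero_smul, add_zero]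
  refine Finset.sum_congr rfl fun i _ => ?_
  have h2 := Ring.choose_smul_choose α (n := i + 1) (k := 1) (by omega)
  rw [Nat.choose_one_right, nsmul_eq_mul, Ring.choose_one_right, Nat.add_sub_cancel,
    Nat.cast_one] at h2
  rw [h2, smul_smul, show q + ((i + 1 : ℕ) : ℤ) - 1 = q + i by push_cast; ring, neg_mul]

/-- The number `δ_r`. -/
def delta (r : ℕ) : ℤ := if r = 0 then 1 else 0

lemma delta_nonneg (r : ℕ) : 0 ≤ delta r := by unfold delta; split_ifs <;> norm_num

lemma circ_eq_bra (g : V ≃ₗ[ℂ] V) (d : ℤ) (r : ℕ) (u v : V) : circ g d r u v =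
    bra u ((d : ℂ) - 1 + delta r + (((r : ℚ) / orderOf g : ℚ) : ℂ)) (-1 - delta r) v := by
  rw [circ, bra_apply, act]
  refine finsum_congr fun i => ?_
  rw [coeff_bin, delta]
  congr 2
  · split_ifs <;> push_cast <;> rfl
  · split_ifs <;> push_cast <;> ring_nf

lemma apply_circ {f : Module.Dual ℂ V} (hf : f ∈ (twistedO g).dualAnnihilator) {r : ℕ} {d : ℤ}
    {u : V} (hr : r < orderOf g) (hu : u ∈ twistedSector g r) (hd : u ∈ weightSpace V d) (v : V) :
    f (bra u ((d : ℂ) - 1 + delta r + (((r : ℚ) / orderOf g : ℚ) : ℂ)) (-1 - delta r) v) = 0 := by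
  rw [← circ_eq_bra]
  exact (Submodule.mem_dualAnnihilator f).mp hf _
    (Submodule.subset_span ⟨r, d, u, v, hr, hu, hd, rfl⟩)

lemma mem_dualAnnihilator_twistedO {f : Module.Dual ℂ V} (h : ∀ (r : ℕ) (d : ℤ) (u v : V),
    r < orderOf g → u ∈ twistedSector g r → u ∈ weightSpace V d →
    f (bra u ((d : ℂ) - 1 + delta r + (((r : ℚ) / orderOf g : ℚ) : ℂ)) (-1 - delta r) v) = 0) :
    f ∈ (twistedO g).dualAnnihilator := by
  rw [Submodule.mem_dualAnnihilator]
  intro w hw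
  refine Submodule.span_le (p := LinearMap.ker f) |>.mpr ?_ hw
  rintro _ ⟨r, d, u, v, hr, hu, hd, rfl⟩
  rw [circ_eq_bra]
  exact h r d u v hr hu hd

lemma mode_mem_twistedSector (hg : IsAutomorphism g) {r : ℕ} {a u : V} (ha : a ∈ sector g 0)
    (hu : u ∈ twistedSector g r) (i : ℤ) : mode a i u ∈ twistedSector g r := by
  rw [twistedSector_eq] at *
  have := mode_mem_sector hg ha hu i
  rwa [zero_add] at this

/-- Zhu's argument. Replacing u by L(-1)u raises the weight by one and, after integration by parts,
the order of the pole at z = 0 as well; this proves x = 0 for all k. A factor 1+z is then split as 1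
+ z, so x can grow as long as it does not exceed k. -/
lemma apply_bra_of_le (hg : IsAutomorphism g) {f : Module.Dual ℂ V}
    (hf : f ∈ (twistedO g).dualAnnihilator) {r : ℕ} (hr : r < orderOf g) {d : ℤ} {u : V}
    (hu : u ∈ twistedSector g r) (hd : u ∈ weightSpace V d) {x k : ℕ} (hx : x ≤ k) (v : V) :
    f (bra u ((d : ℂ) - 1 + delta r + (((r : ℚ) / orderOf g : ℚ) : ℂ) + x)
      (-1 - delta r - k) v) = 0 := by
  induction x generalizing k with
  | zero =>
    clear hx
    rw [Nat.cast_zero, add_zero]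
    induction k generalizing u d with
    | zero =>
      have := apply_circ hf hr hu hd v
      rwa [Nat.cast_zero, sub_zero]
    | succ k ih =>
      have h1 := ih hu hd
      have hu' := mode_mem_twistedSector hg (omega_mem_sector hg) hu 0
      have hd' := mode_mem_weightSpace omega_mem_weightSpace hd 0
      have h2 := ih hu' hd'
      set A := (d : ℂ) - 1 + delta r + (((r : ℚ) / orderOf g : ℚ) : ℂ) with hA
      rw [show ((2 + d - 0 - 1 : ℤ) : ℂ) - 1 + delta r + (((r : ℚ) / orderOf g : ℚ) : ℂ) = 1 + A by
        rw [hA]; push_cast; ring, bra_omega_zero, bra_one_add_exponent,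
        show (1 : ℂ) + A - 1 = A by ring,
        show (-1 - delta r - k - 1 + 1 : ℤ) = -1 - delta r - k by ring] at h2
      simp only [LinearMap.add_apply, LinearMap.smul_apply, map_add, map_smul, h1, smul_zero,
        zero_add, add_zero] at h2
      rw [show (-1 - delta r - (k : ℤ) - 1) = -1 - delta r - (k + 1 : ℕ) by push_cast; ring] at h2
      -- The scalar is 1 + δ_r + k, which is positive.
      refine (smul_eq_zero.mp h2).resolve_left ?_
      rw [neg_eq_zero, Int.cast_eq_zero]
      have := delta_nonneg r
      omega
  | succ x ih =>
    obtain ⟨k, rfl⟩ : ∃ k', k = k' + 1 := ⟨k - 1, by omega⟩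
    have h1 := ih (k := k + 1) (by omega)
    have h2 := ih (k := k) (by omega)
    rw [show ((x + 1 : ℕ) : ℂ) = 1 + x by push_cast; ring, add_left_comm, bra_one_add_exponent,
      LinearMap.add_apply, map_add, h1,
      show -1 - delta r - ((k + 1 : ℕ) : ℤ) + 1 = -1 - delta r - k by push_cast; ring, h2, add_zero]

/-- The bounds translate 0 ≤ x ≤ k of `apply_bra_of_le`: x = k+p-d+1-δ_r is the excess power of 1+z,
and j-1-δ_r the excess order of the pole at 0. -/
lemma isBounded_of_mem (hg : IsAutomorphism g) {f : Module.Dual ℂ V}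
    (hf : f ∈ (twistedO g).dualAnnihilator) {r : ℕ} (hr : r < orderOf g) {d : ℤ} {u : V}
    (hu : u ∈ twistedSector g r) (hd : u ∈ weightSpace V d) (k : ℤ) :
    IsBounded f u ((r : ℚ) / orderOf g + k) (d - 1 + delta r - k) (2 - d + k) := by
  intro p j hp hj
  ext v
  have h := apply_bra_of_le hg hf hr hu hd (x := (k + p - d + 1 - delta r).toNat)
    (k := (j - 1 - delta r).toNat) (by omega) v
  rw [LinearMap.comp_apply, LinearMap.zero_apply, ← h]
  have h1 : (((k + p - d + 1 - delta r).toNat : ℤ) : ℂ) = ((k + p - d + 1 - delta r : ℤ) : ℂ) := by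
    rw [Int.toNat_of_nonneg (by omega)]
  have h2 : (((j - 1 - delta r).toNat : ℤ)) = j - 1 - delta r := Int.toNat_of_nonneg (by omega)
  rw [Int.cast_natCast] at h1
  rw [h1, h2]
  congr 3
  · push_cast; ring
  · ring

lemma proj_mem_weightSpace (hg : IsAutomorphism g) {d : ℤ} {u : V} (hu : u ∈ weightSpace V d)
    (n : ℚ) : proj g n u ∈ weightSpace V d := by
  by_cases hn : ∃ k : ℤ, n * orderOf g = k
  · rw [proj_apply hn]
    refine Submodule.smul_mem _ _ (Submodule.sum_mem _ fun j hj => Submodule.smul_mem _ _ ?_)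
    clear hj
    induction j with
    | zero => simpa using hu
    | succ j ih =>
      rw [pow_succ', LinearEquiv.mul_apply, mem_weightSpace]
      have h := congrArg g (mem_weightSpace.mp ih)
      rwa [hg.map_mode, hg.map_omega, map_smul] at h
  · rw [proj, if_neg hn]; exact Submodule.zero_mem _

lemma weight_induction (P : Submodule ℂ V) (h : ∀ d : ℤ, weightSpace V d ≤ P) (a : V) : a ∈ P := by
  have h1 : (⨆ d : ℤ, weightSpace V d) = ⊤ := (grading (V := V)).submodule_iSup_eq_top
  have h2 : (⨆ d : ℤ, weightSpace V d) ≤ P := iSup_le h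
  rw [h1] at h2
  exact h2 trivial

lemma dualAnnihilator_le_regularDual (hg : IsAutomorphism g) (hT : IsOfFinOrder g) :
    (twistedO g).dualAnnihilator ≤ regularDual g := by
  intro f hf n a ha
  let P : Submodule ℂ V :=
    { carrier := {a | ∃ P J, IsBounded f (proj g n a) n P J}
      zero_mem' := ⟨0, 0, fun p j _ _ => by rw [map_zero, bra_zero_left, LinearMap.comp_zero]⟩
      add_mem' := by
        rintro a b ⟨P, J, h⟩ ⟨P', J', h'⟩
        refine ⟨max P P', max J J', ?_⟩
        rw [map_add]
        exact (h.mono (le_max_left _ _) (le_max_left _ _)).add_vector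
          (h'.mono (le_max_right _ _) (le_max_right _ _))
      smul_mem' := by
        rintro c a ⟨P, J, h⟩
        refine ⟨P, J, fun p j hp hj => ?_⟩
        rw [map_smul, bra_smul_left, LinearMap.comp_smul, h p j hp hj, smul_zero] }
  have h := weight_induction P (fun d u hu => ?_) a
  · obtain ⟨P, J, h⟩ := h
    rw [proj_of_mem hT ha] at h
    exact ⟨P, J, h⟩
  · rcases exists_eq_of_mem_sector hT (proj_mem (g := g) n u) with
      h0 | ⟨r, k, hr, hur, hn⟩
    · refine ⟨0, 0, fun p j _ _ => ?_⟩
      rw [h0, bra_zero_left, LinearMap.comp_zero]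
    · have h1 := isBounded_of_mem hg hf hr hur (proj_mem_weightSpace hg hu n) k
      rw [← hn] at h1
      exact ⟨_, _, h1⟩

/-- Functionals killing `O_g(V)` are lowest weight vectors. -/
lemma dualMode_eq_zero_of_lt (hg : IsAutomorphism g) (hT : IsOfFinOrder g) {f : Module.Dual ℂ V}
    (hf : f ∈ (twistedO g).dualAnnihilator) {d : ℤ} {u : V} (hu : u ∈ weightSpace V d) {n : ℚ}
    (hn : (d : ℚ) - 1 < n) : dualMode g u n f = 0 := by
  have hpos : (0 : ℚ) < orderOf g := by exact_mod_cast hT.orderOf_pos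
  rcases exists_eq_of_mem_sector hT (proj_mem (g := g) n u) with
    h0 | ⟨r, k, hr, hur, hnr⟩
  · have h := IsExpansion.zero_vector f n
    rw [← h0] at h
    exact h.dualMode_eq_zero
  · have h1 := isBounded_of_mem hg hf hr hur (proj_mem_weightSpace hg hu n) k
    rw [← hnr] at h1
    obtain ⟨e, he, he0, -⟩ := h1.exists_expansion
    rw [he.dualMode_eq_zero, he0]
    -- For r = 0 the mode index is the integer k ≥ d and δ_r = 1; for r > 0 one has r/T < 1, hence k
    -- ≥ d-1, and δ_r = 0. In both cases the bound P is at most 0.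
    rw [delta]
    split_ifs with h
    · rw [hnr, h, Nat.cast_zero, zero_div, zero_add] at hn
      have : d - 1 < k := by exact_mod_cast hn
      omega
    · have h2 : (r : ℚ) / orderOf g < 1 := by
        rw [div_lt_one hpos]; exact_mod_cast hr
      have h3 : (d : ℚ) - 2 < k := by linarith
      have : d - 2 < k := by exact_mod_cast h3
      omega

/-- The action of `L(0)` on functionals killing `O_g(V)`. -/
lemma dualMode_omega (hg : IsAutomorphism g) (hT : IsOfFinOrder g) {f : Module.Dual ℂ V}
    (hf : f ∈ (twistedO g).dualAnnihilator) :
    dualMode g omega 1 f = f ∘ₗ bra omega 1 (-1) := by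
  have h0 : (omega : V) ∈ twistedSector g 0 := by
    rw [twistedSector_eq, Nat.cast_zero, zero_div]; exact omega_mem_sector hg
  have h1 := isBounded_of_mem hg hf hT.orderOf_pos h0 omega_mem_weightSpace 0
  rw [Nat.cast_zero, zero_div, zero_add, Int.cast_zero, delta, if_pos rfl] at h1
  obtain ⟨e, he, he0, hstar⟩ := h1.exists_expansion
  rw [← proj_of_mem hT (omega_mem_sector hg)] at he
  -- Here P = 2 and J = 0, so at p = j = 1 the expansion reduces to the single coefficient e 1.
  have h2 := hstar 1 1 (by norm_num)
  rw [act_eq_sum _ (N := 1) fun n hn => he0 n (by push_cast at hn; omega)] at h2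
  have h3 := he.dualMode_eq 1
  rw [zero_add, Int.cast_one] at h3
  rw [h3]
  simpa using h2.symm

/-- Left multiplication by ω preserves O_g(V): in the commutator with u ∘_g, the term of ω_i u has x
= x₂ and k = x₂ + 1 in the notation of `apply_bra_of_le`. -/
lemma comp_bra_omega_mem (hg : IsAutomorphism g) {f : Module.Dual ℂ V}
    (hf : f ∈ (twistedO g).dualAnnihilator) :
    f ∘ₗ bra omega 1 (-1) ∈ (twistedO g).dualAnnihilator := by
  refine mem_dualAnnihilator_twistedO fun r d u v hr hu hd => ?_
  rw [LinearMap.comp_apply]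
  have h := congrArg f (bra_commutator omega u v (-1) (-1 - delta r) 1
    ((d : ℂ) - 1 + delta r + (((r : ℚ) / orderOf g : ℚ) : ℂ)))
  rw [map_sub, apply_circ hf hr hu hd, sub_zero] at h
  rw [h]
  obtain ⟨N, hN⟩ := mode_truncation (omega : V) u
  rw [finsum_eq_sum_range (N := N.toNat) fun i hi => Finset.sum_eq_zero fun x _ => by
    rw [hN i (by omega), bra_zero_left, LinearMap.zero_apply, smul_zero], map_sum]
  refine Finset.sum_eq_zero fun i _ => ?_
  rw [map_sum]
  refine Finset.sum_eq_zero fun x hx => ?_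
  rw [Finset.HasAntidiagonal.mem_antidiagonal] at hx
  have h1 := apply_bra_of_le hg hf hr (mode_mem_twistedSector hg (omega_mem_sector hg) hu i)
    (mode_mem_weightSpace omega_mem_weightSpace hd i) (x := x.2) (k := x.2 + 1) (by omega) v
  rw [map_smul, smul_eq_zero]
  right
  rw [← h1]
  congr 3
  · rw [← hx]; push_cast; ring
  · push_cast; ring

/-- The transpose of `v ↦ ω * v` on the dual of `A_g(V)`. -/
def zhuOmega (hg : IsAutomorphism g) : Module.End ℂ (twistedO g).dualAnnihilator :=
  (LinearMap.lcomp ℂ ℂ (bra (omega : V) 1 (-1))).restrict fun _ hf => comp_bra_omega_mem hg hf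

/-- There is an eigenvalue `c` of the transpose of `v ↦ ω * v` on the dual of `A_g(V)` such that
no `c + x` with `x > 0` is an eigenvalue. -/
lemma exists_extremal_eigenvector (hg : IsAutomorphism g)
    (hfin : FiniteDimensional ℂ (TwistedZhu g)) (hne : Nontrivial (TwistedZhu g)) :
    ∃ (c : ℂ) (f : Module.Dual ℂ V), f ∈ (twistedO g).dualAnnihilator ∧ f ≠ 0 ∧
      f ∘ₗ bra omega 1 (-1) = c • f ∧
      ∀ (x : ℝ) (F : Module.Dual ℂ V), 0 < x → F ∈ (twistedO g).dualAnnihilator →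
        F ∘ₗ bra omega 1 (-1) = (c + x) • F → F = 0 := by
  have e := (twistedO g).dualQuotEquivDualAnnihilator
  have : FiniteDimensional ℂ (twistedO g).dualAnnihilator := e.finiteDimensional
  have : Nontrivial (twistedO g).dualAnnihilator := e.symm.toEquiv.nontrivial
  obtain ⟨c₀, hc₀⟩ := Module.End.exists_eigenvalue (zhuOmega hg)
  -- Among the finitely many eigenvalues, one of maximal real part excludes c + x for every real x >
  -- 0.
  obtain ⟨c, hc, hmax⟩ := Set.exists_max_image {c | (zhuOmega hg).HasEigenvalue c} Complex.re
    (Module.End.finite_hasEigenvalue _) ⟨c₀, hc₀⟩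
  obtain ⟨f, hf⟩ := hc.exists_hasEigenvector
  refine ⟨c, f, f.2, fun h => hf.2 (Subtype.ext h),
    congrArg Subtype.val hf.apply_eq_smul, fun x F hx hF h => ?_⟩
  by_contra hF0
  have h1 : (zhuOmega hg).HasEigenvalue (c + x) := by
    refine Module.End.hasEigenvalue_of_hasEigenvector (x := ⟨F, hF⟩) ⟨?_, fun h' => hF0
      (congrArg Subtype.val h')⟩
    rw [Module.End.mem_eigenspace_iff]
    exact Subtype.ext h
  have h2 := hmax _ h1
  simp at h2
  linarith

end

/-! ### Zero modes and functionals on A_g(V). -/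

section

namespace WeakTwistedModule

variable {V : Type u} [AddCommGroup V] [Module ℂ V] [VertexOperatorAlgebra V]
  {g : V ≃ₗ[ℂ] V} {M : Type u} [AddCommGroup M] [Module ℂ M] (X : WeakTwistedModule g M)

/-- The decomposition of `V` into weight spaces. -/
def weightDecomposition (V : Type u) [AddCommGroup V] [Module ℂ V] [VertexOperatorAlgebra V] :
    (DirectSum ℤ fun d => VertexOperatorAlgebra.weightSpace V d) ≃ₗ[ℂ] V :=
  LinearEquiv.ofBijective (DirectSum.coeLinearMap fun d : ℤ =>
    VertexOperatorAlgebra.weightSpace V d)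
    (show DirectSum.IsInternal fun d : ℤ => VertexOperatorAlgebra.weightSpace V d from grading)

/-- The zero mode `o(v)`, equal to `v_{d-1}` for `v` of weight `d`. -/
def zeroMode : V →ₗ[ℂ] Module.End ℂ M :=
  DirectSum.toModule ℂ ℤ (Module.End ℂ M) (fun d : ℤ =>
    (LinearMap.proj ((d : ℚ) - 1) ∘ₗ X.mode) ∘ₗ
      (VertexOperatorAlgebra.weightSpace V d).subtype) ∘ₗ
  (weightDecomposition V).symm.toLinearMap

lemma zeroMode_of_mem {d : ℤ} {v : V} (hv : v ∈ VertexOperatorAlgebra.weightSpace V d) :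
    X.zeroMode v = X.mode v ((d : ℚ) - 1) := by
  have h : (weightDecomposition V).symm v =
      DirectSum.lof ℂ ℤ (fun d : ℤ => VertexOperatorAlgebra.weightSpace V d) d ⟨v, hv⟩ := by
    rw [LinearEquiv.symm_apply_eq]
    exact (DirectSum.coeLinearMap_lof (fun d : ℤ => VertexOperatorAlgebra.weightSpace V d) d
      ⟨v, hv⟩).symm
  rw [zeroMode, LinearMap.comp_apply, LinearEquiv.coe_coe, h, DirectSum.toModule_lof]
  rfl

variable {E : Type u} [AddCommGroup E] [Module ℂ E] (ι : E →ₗ[ℂ] M)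

/-- The Jacobi identity as an identity of operators on a subspace on which the truncation is
uniform. -/
lemma jacobi_comp (hT : IsOfFinOrder g) {m : ℚ} {u : V} (hu : u ∈ sector g m) (v : V) (l : ℤ)
    (n : ℚ) {N : ℕ} (h₁ : ∀ i : ℕ, N ≤ i → X.mode v (n + i) ∘ₗ ι = 0)
    (h₂ : ∀ i : ℕ, N ≤ i → X.mode u (m + i) ∘ₗ ι = 0)
    (h₃ : ∀ i : ℕ, N ≤ i → VertexOperatorAlgebra.mode u (l + i) v = 0) :
    (∑ i ∈ Finset.range N, ((-1 : ℂ) ^ i * Ring.choose (l : ℂ) i) •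
        (X.mode u (m + l - i) ∘ₗ X.mode v (n + i) ∘ₗ ι))
      - (∑ i ∈ Finset.range N, ((-1 : ℂ) ^ (l + i) * Ring.choose (l : ℂ) i) •
        (X.mode v (n + l - i) ∘ₗ X.mode u (m + i) ∘ₗ ι))
      = ∑ i ∈ Finset.range N, Ring.choose (m : ℂ) i •
        (X.mode (VertexOperatorAlgebra.mode u (l + i) v) (m + n - i) ∘ₗ ι) := by
  ext w
  have h := X.jacobi_of_mem hT hu v (ι w) l n
  rw [finsum_eq_sum_range (N := N) fun i hi => by
      rw [← LinearMap.comp_apply (X.mode v (n + i)), h₁ i hi, LinearMap.zero_apply, map_zero,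
        smul_zero],
    finsum_eq_sum_range (N := N) fun i hi => by
      rw [← LinearMap.comp_apply (X.mode u (m + i)), h₂ i hi, LinearMap.zero_apply, map_zero,
        smul_zero],
    finsum_eq_sum_range (N := N) fun i hi => by rw [h₃ i hi]; simp] at h
  simpa [LinearMap.sum_apply] using h

/-- The functional `v ↦ Φ(o(v))`. -/
def zeroModeForm (Φ : Module.Dual ℂ (E →ₗ[ℂ] M)) : Module.Dual ℂ V :=
  Φ ∘ₗ LinearMap.lcomp ℂ M ι ∘ₗ X.zeroMode

lemma zeroModeForm_apply (Φ : Module.Dual ℂ (E →ₗ[ℂ] M)) (v : V) :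
    X.zeroModeForm ι Φ v = Φ (X.zeroMode v ∘ₗ ι) := rfl

/-- Modes that lower the weight sufficiently far vanish on the range of `ι`. -/
def UniformlyTruncated : Prop :=
  ∃ B : ℚ, ∀ (e : ℤ) (v : V), v ∈ VertexOperatorAlgebra.weightSpace V e →
    ∀ k : ℚ, e + B ≤ k → X.mode v k ∘ₗ ι = 0

/-- `Φ` vanishes on products of two modes of which the first to act lowers the weight. -/
def KillsLowering (Φ : Module.Dual ℂ (E →ₗ[ℂ] M)) : Prop :=
  ∀ (a : V) (m : ℚ) (e : ℤ) (v : V), v ∈ VertexOperatorAlgebra.weightSpace V e →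
    ∀ k : ℚ, (e : ℚ) - 1 < k → Φ (X.mode a m ∘ₗ X.mode v k ∘ₗ ι) = 0

variable {ι} {Φ : Module.Dual ℂ (E →ₗ[ℂ] M)}

lemma exists_uniform_truncation (hι : X.UniformlyTruncated ι) {e : ℤ} {v : V}
    (hv : v ∈ VertexOperatorAlgebra.weightSpace V e) (n : ℚ) :
    ∃ N : ℕ, ∀ i : ℕ, N ≤ i → X.mode v (n + i) ∘ₗ ι = 0 := by
  obtain ⟨B, hB⟩ := hι
  refine ⟨⌈e + B - n⌉₊, fun i hi => hB e v hv _ ?_⟩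
  have := Nat.ceil_le.mp hi
  linarith

/-- If `Φ` vanishes on operators that start with a lowering mode, then the zero mode of
`Res_z (1+z)^m z^l Y(u,z)v` is computed by the second term of the Jacobi identity. -/
lemma zeroModeForm_bra (hι : X.UniformlyTruncated ι) (hT : IsOfFinOrder g) {m : ℚ} {u v : V} (hu : u ∈ sector g m) {d e : ℤ}
    (hd : u ∈ VertexOperatorAlgebra.weightSpace V d)
    (he : v ∈ VertexOperatorAlgebra.weightSpace V e) (l : ℤ) :
    ∃ N : ℕ, 0 < N ∧ X.zeroModeForm ι Φ (bra u (m : ℂ) l v) =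
      (∑ i ∈ Finset.range N, ((-1 : ℂ) ^ i * Ring.choose (l : ℂ) i) •
        Φ (X.mode u (m + l - i) ∘ₗ X.mode v (d + e - l - m - 2 + i) ∘ₗ ι))
      - (∑ i ∈ Finset.range N, ((-1 : ℂ) ^ (l + i) * Ring.choose (l : ℂ) i) •
        Φ (X.mode v (d + e - l - m - 2 + l - i) ∘ₗ X.mode u (m + i) ∘ₗ ι)) := by
  obtain ⟨N₁, h₁⟩ := X.exists_uniform_truncation hι he (d + e - l - m - 2)
  obtain ⟨N₂, h₂⟩ := X.exists_uniform_truncation hι hd m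
  obtain ⟨N₃, h₃⟩ := mode_truncation_nat u v l
  refine ⟨max (max N₁ N₂) N₃ + 1, Nat.succ_pos _, ?_⟩
  -- The index n = d+e-l-m-2 makes every iterate a zero mode: u_{l+i} v has weight d+e-l-i-1, and
  -- m+n-i is one less.
  have h := congrArg Φ (X.jacobi_comp ι hT hu v l (d + e - l - m - 2)
    (N := max (max N₁ N₂) N₃ + 1) (fun i hi => h₁ i (by omega)) (fun i hi => h₂ i (by omega))
    (fun i hi => h₃ i (by omega)))
  simp only [map_sub, map_sum, map_smul] at h
  rw [h, bra_apply, act_eq_sum _ (N := max (max N₁ N₂) N₃ + 1) fun n hn => by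
    have := h₃ (n - l).toNat (by omega)
    rwa [show l + ((n - l).toNat : ℤ) = n by omega] at this, map_sum]
  refine Finset.sum_congr rfl fun i _ => ?_
  rw [coeff_bin, map_smul, zeroModeForm_apply, X.zeroMode_of_mem
    (VertexOperatorAlgebra.mode_mem_weightSpace hd he (l + i))]
  rw [show (((d + e - (l + i) - 1 : ℤ) : ℚ) - 1) = m + (d + e - l - m - 2) - i by push_cast; ring]

/-- With m = d-1+δ_r+r/T and l = -1-δ_r the first modes to act are v_{e-r/T+i} and u_{m+i}. Both
lower the weight, because r/T < 1 and δ_r + r/T > 0. -/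
lemma zeroModeForm_mem_dualAnnihilator (hι : X.UniformlyTruncated ι)
    (hΦ : X.KillsLowering ι Φ) (hT : IsOfFinOrder g) :
    X.zeroModeForm ι Φ ∈ (twistedO g).dualAnnihilator := by
  refine mem_dualAnnihilator_twistedO fun r d u v hr hu hd => ?_
  let P : Submodule ℂ V := LinearMap.ker (X.zeroModeForm ι Φ ∘ₗ
    bra u ((d : ℂ) - 1 + delta r + (((r : ℚ) / orderOf g : ℚ) : ℂ)) (-1 - delta r))
  refine weight_induction P (fun e v hv => ?_) v
  change X.zeroModeForm ι Φ (bra u _ _ v) = 0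
  have hpos : (0 : ℚ) < orderOf g := by exact_mod_cast hT.orderOf_pos
  have hlt : (r : ℚ) / orderOf g < 1 := by
    rw [div_lt_one hpos]; exact_mod_cast hr
  have h0 : (0 : ℚ) < delta r + (r : ℚ) / orderOf g := by
    rw [delta]
    split_ifs with h
    · rw [h]; simp
    · have : (0 : ℚ) < r := by exact_mod_cast Nat.pos_of_ne_zero h
      rw [Int.cast_zero, zero_add]; positivity
  rw [twistedSector_eq, ← sector_add_int _ (d - 1 + delta r)] at hu
  obtain ⟨N, -, h⟩ := X.zeroModeForm_bra hι (Φ := Φ) hT hu hd hv (-1 - delta r)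
  rw [show (d : ℂ) - 1 + delta r + (((r : ℚ) / orderOf g : ℚ) : ℂ) =
    (((r : ℚ) / orderOf g + (d - 1 + delta r : ℤ) : ℚ) : ℂ) by push_cast; ring, h,
    Finset.sum_eq_zero fun i _ => ?_, Finset.sum_eq_zero fun i _ => ?_, sub_zero]
  · rw [hΦ _ _ d u hd _ (by push_cast; linarith [(Nat.cast_nonneg i : (0 : ℚ) ≤ i)]), smul_zero]
  · rw [hΦ _ _ e v hv _ (by push_cast; linarith [(Nat.cast_nonneg i : (0 : ℚ) ≤ i)]), smul_zero]

/-- With m = 1 and l = -1 the first modes to act are v_{e+i} and ω_{1+i} = L(i). All lower the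
weight except L(0), which acts by c and leaves o(v). -/
lemma zeroModeForm_comp_bra_omega (hι : X.UniformlyTruncated ι)
    (hΦ : X.KillsLowering ι Φ) (hg : IsAutomorphism g) (hT : IsOfFinOrder g) {c : ℂ}
    (hc : X.mode omega 1 ∘ₗ ι = c • ι) :
    X.zeroModeForm ι Φ ∘ₗ bra omega 1 (-1) = c • X.zeroModeForm ι Φ := by
  rw [← sub_eq_zero]
  ext v
  let P : Submodule ℂ V := LinearMap.ker
    (X.zeroModeForm ι Φ ∘ₗ bra omega 1 (-1) - c • X.zeroModeForm ι Φ)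
  refine weight_induction P (fun e v hv => ?_) v
  change X.zeroModeForm ι Φ (bra omega 1 (-1) v) - c * X.zeroModeForm ι Φ v = 0
  obtain ⟨N, hN, h⟩ := X.zeroModeForm_bra hι (Φ := Φ) hT (omega_mem_sector_int hg 1)
    omega_mem_weightSpace hv (-1)
  rw [Int.cast_one, Rat.cast_one] at h
  obtain ⟨N, rfl⟩ : ∃ k, N = k + 1 := ⟨N - 1, by omega⟩
  rw [h, Finset.sum_eq_zero fun i _ => ?_, Finset.sum_range_succ', Finset.sum_eq_zero fun i _ => ?_]
  · rw [show ((2 : ℤ) : ℚ) + e - (-1 : ℤ) - 1 - 2 + (-1 : ℤ) - (0 : ℕ) = e - 1 by push_cast; ring]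
    simp only [Nat.cast_zero, add_zero]
    rw [zeroModeForm_apply, X.zeroMode_of_mem hv, hc, LinearMap.comp_smul,
      map_smul, Ring.choose_zero_right]
    simp
  · rw [hΦ _ _ 2 omega omega_mem_weightSpace _ (by push_cast; linarith), smul_zero]
  · rw [hΦ _ _ e v hv _ (by push_cast; linarith), smul_zero]

end WeakTwistedModule

end

/-! ### Levels of a simple module with a lowest weight vector. -/

section

/-- Countable dimension of V enters only through the cardinality argument in
`rank_restrictedDualOrbit_le`. -/
lemma exists_countable_span (V : Type u) [AddCommGroup V] [Module ℂ V] [VertexOperatorAlgebra V] :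
    ∃ B : Set V, B.Countable ∧ Submodule.span ℂ B = ⊤ := by
  have h : ∀ d : ℤ, ∃ s : Set V, s.Finite ∧ Submodule.span ℂ s = weightSpace V d := fun d => by
    have : FiniteDimensional ℂ (weightSpace V d) := finite_weight d
    exact Submodule.fg_def.mp (Module.Finite.iff_fg.mp this)
  choose s hs hspan using h
  refine ⟨⋃ d, s d, Set.countable_iUnion fun d => (hs d).countable, ?_⟩
  rw [Submodule.span_iUnion, iSup_congr hspan]
  exact (grading (V := V)).submodule_iSup_eq_top

namespace WeakTwistedModule

variable {V : Type u} [AddCommGroup V] [Module ℂ V] [VertexOperatorAlgebra V]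
  {g : V ≃ₗ[ℂ] V} {M : Type u} [AddCommGroup M] [Module ℂ M] {X : WeakTwistedModule g M}

lemma IsSimple.orbit_eq_top (hX : X.IsSimple) (hT : IsOfFinOrder g) {s : M} (hs : s ≠ 0) :
    X.orbit s = ⊤ :=
  (hX.eq_bot_or_eq_top _ fun v n _ hw => X.orbit_stable hT s v n hw).resolve_left fun h =>
    hs ((Submodule.mem_bot ℂ).mp (h ▸ X.self_mem_orbit s))

variable (X) in
/-- A nonzero eigenvector of `L(0)` killed by all weight-lowering modes. -/
structure IsLowestWeightVector (s : M) (c : ℂ) : Prop where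
  ne_zero : s ≠ 0
  mem : s ∈ X.weightSpace c
  lowering (d : ℤ) (u : V) (hu : u ∈ VertexOperatorAlgebra.weightSpace V d) (n : ℚ)
    (hn : (d : ℚ) - 1 < n) : X.mode u n s = 0

variable (X) in
lemma iSupIndep_weightSpace : iSupIndep X.weightSpace := Module.End.eigenspaces_iSupIndep _

variable (X) in
/-- The weight space of weight `c + k/T`. -/
def level (c : ℂ) (k : ℕ) : Submodule ℂ M := X.weightSpace (c + (k : ℂ) / orderOf g)

variable (X) in
lemma level_zero (c : ℂ) : X.level c 0 = X.weightSpace c := by simp [level]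

variable {s : M} {c : ℂ}

/-- The orbit of s is everything; modes of index above d-1 kill s, and the others raise its weight
by d-1-n, a nonnegative multiple of 1/T. -/
lemma iSup_level (hX : X.IsSimple) (hg : IsAutomorphism g) (hT : IsOfFinOrder g)
    (hs : X.IsLowestWeightVector s c) : ⨆ k, X.level c k = ⊤ := by
  have hT0 : (orderOf g : ℚ) ≠ 0 := Nat.cast_ne_zero.mpr hT.orderOf_pos.ne'
  have hpos : (0 : ℚ) < orderOf g := by exact_mod_cast hT.orderOf_pos
  rw [eq_top_iff, ← hX.orbit_eq_top hT hs.ne_zero]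
  refine Submodule.span_le.mpr ?_
  rintro _ ⟨u, n, rfl⟩
  let P : Submodule ℂ V := (⨆ k, X.level c k).comap
    (LinearMap.applyₗ s ∘ₗ LinearMap.proj n ∘ₗ X.mode : V →ₗ[ℂ] M)
  refine weight_induction P (fun d u hu => ?_) u
  rw [← sum_proj hT u]
  refine Submodule.sum_mem _ fun r _ => ?_
  have hu' := proj_mem_weightSpace hg hu ((r : ℚ) / orderOf g)
  change X.mode (proj g ((r : ℚ) / orderOf g) u) n s ∈ ⨆ k, X.level c k
  by_cases hn : ∃ k : ℤ, n = (r : ℚ) / orderOf g + k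
  · obtain ⟨k, rfl⟩ := hn
    by_cases hk : (d : ℚ) - 1 < (r : ℚ) / orderOf g + k
    · rw [hs.lowering d _ hu' _ hk]; exact Submodule.zero_mem _
    · push Not at hk
      have h0 : 0 ≤ (d - 1 - k) * orderOf g - r := by
        have h1 : (r : ℚ) / orderOf g ≤ d - 1 - k := by linarith
        rw [div_le_iff₀ hpos] at h1
        have : (r : ℤ) ≤ (d - 1 - k) * orderOf g := by exact_mod_cast h1
        omega
      obtain ⟨j, hj⟩ := Int.eq_ofNat_of_zero_le h0
      refine le_iSup (X.level c) j ?_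
      have h := X.mode_mem_weightSpace hg hT hu' hs.mem ((r : ℚ) / orderOf g + k)
      have hj' : (((d - 1 - k) * orderOf g - r : ℤ) : ℂ) = (j : ℂ) := by rw [hj]; simp
      have hT0' : (orderOf g : ℂ) ≠ 0 := Nat.cast_ne_zero.mpr hT.orderOf_pos.ne'
      rw [level, show c + (j : ℂ) / orderOf g =
        c + d - (((r : ℚ) / orderOf g + k : ℚ) : ℂ) - 1 by
          rw [← hj']; push_cast; field_simp; ring]
      exact h
  · push Not at hn
    rw [X.mode_eq_zero_of_mem hT (proj_mem _ _) hn]; exact Submodule.zero_mem _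

lemma exists_level_of_ne_bot (hX : X.IsSimple) (hg : IsAutomorphism g) (hT : IsOfFinOrder g)
    (hs : X.IsLowestWeightVector s c) {b : ℂ} (hb : X.weightSpace b ≠ ⊥) :
    ∃ k : ℕ, b = c + (k : ℂ) / orderOf g := by
  by_contra! h
  refine hb ?_
  have h1 := X.iSupIndep_weightSpace b
  have h2 : (⨆ k, X.level c k) ≤ ⨆ j, ⨆ (_ : j ≠ b), X.weightSpace j :=
    iSup_le fun k => le_iSup₂_of_le (c + (k : ℂ) / orderOf g) (h k).symm le_rfl
  rw [iSup_level hX hg hT hs, top_le_iff] at h2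
  rw [h2, disjoint_top] at h1
  exact h1

/-- The target weight either does not occur or is again a level; in the first case the mode is zero,
so no negative levels need to be considered. -/
lemma mode_level (hX : X.IsSimple) (hg : IsAutomorphism g) (hT : IsOfFinOrder g)
    (hs : X.IsLowestWeightVector s c) {e : ℤ} {v : V}
    (hv : v ∈ VertexOperatorAlgebra.weightSpace V e) (k : ℕ) (n : ℚ) :
    (∀ w ∈ X.level c k, X.mode v n w = 0) ∨
      ∃ m : ℕ, (m : ℚ) = k + orderOf g * (e - n - 1) ∧ ∀ w ∈ X.level c k,
        X.mode v n w ∈ X.level c m := by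
  have hT0 : (orderOf g : ℂ) ≠ 0 := Nat.cast_ne_zero.mpr hT.orderOf_pos.ne'
  by_cases hb : X.weightSpace (c + (k : ℂ) / orderOf g + e - n - 1) = ⊥
  · left
    intro w hw
    have := X.mode_mem_weightSpace hg hT hv hw n
    rwa [hb, Submodule.mem_bot] at this
  · right
    obtain ⟨m, hm⟩ := exists_level_of_ne_bot hX hg hT hs hb
    refine ⟨m, ?_, fun w hw => ?_⟩
    · have : (m : ℂ) = k + orderOf g * (e - n - 1) := by
        field_simp at hm
        linear_combination -hm
      exact_mod_cast this
    · rw [level, ← hm]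
      exact X.mode_mem_weightSpace hg hT hv hw n

lemma uniformlyTruncated_level (hX : X.IsSimple) (hg : IsAutomorphism g) (hT : IsOfFinOrder g)
    (hs : X.IsLowestWeightVector s c) (k : ℕ) :
    X.UniformlyTruncated (X.level c k).subtype := by
  refine ⟨k, fun e v hv n hn => ?_⟩
  ext ⟨w, hw⟩
  rcases mode_level hX hg hT hs hv k n with h | ⟨m, hm, -⟩
  · exact h w hw
  · exfalso
    have h1 : (1 : ℚ) ≤ orderOf g := by exact_mod_cast hT.orderOf_pos
    have h2 : (0 : ℚ) ≤ m := Nat.cast_nonneg m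
    have h3 : (0 : ℚ) ≤ k := Nat.cast_nonneg k
    nlinarith

lemma mode_mem_iSup_ne (hg : IsAutomorphism g) (hT : IsOfFinOrder g)
    (hs : X.IsLowestWeightVector s c) (u : V) (n : ℚ) :
    X.mode u n s ∈ LinearMap.range (LinearMap.applyₗ s ∘ₗ X.zeroMode) ⊔
      ⨆ j, ⨆ (_ : j ≠ c), X.weightSpace j := by
  let P : Submodule ℂ V := (LinearMap.range (LinearMap.applyₗ s ∘ₗ X.zeroMode) ⊔
    ⨆ j, ⨆ (_ : j ≠ c), X.weightSpace j).comap
      (LinearMap.applyₗ s ∘ₗ LinearMap.proj n ∘ₗ X.mode : V →ₗ[ℂ] M)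
  refine weight_induction P (fun d u hu => ?_) u
  change X.mode u n s ∈ LinearMap.range (LinearMap.applyₗ s ∘ₗ X.zeroMode : V →ₗ[ℂ] M) ⊔
    ⨆ j, ⨆ (_ : j ≠ c), X.weightSpace j
  by_cases hn : n = d - 1
  · refine Submodule.mem_sup_left ⟨u, ?_⟩
    rw [hn, ← X.zeroMode_of_mem hu]; rfl
  · refine Submodule.mem_sup_right ?_
    have h := X.mode_mem_weightSpace hg hT hu hs.mem n
    refine le_iSup₂_of_le (f := fun j (_ : j ≠ c) => X.weightSpace j) (c + d - n - 1)
      (fun h' => hn ?_) le_rfl h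
    have : (n : ℂ) = d - 1 := by linear_combination -h'
    exact_mod_cast this

lemma zeroMode_mem (hg : IsAutomorphism g) (hT : IsOfFinOrder g) {w : M}
    (hw : w ∈ X.weightSpace c) (v : V) : X.zeroMode v w ∈ X.weightSpace c := by
  let P : Submodule ℂ V := (X.weightSpace c).comap (LinearMap.applyₗ w ∘ₗ X.zeroMode : V →ₗ[ℂ] M)
  refine weight_induction P (fun d u hu => ?_) v
  change X.zeroMode u w ∈ X.weightSpace c
  rw [X.zeroMode_of_mem hu]
  have h := X.mode_mem_weightSpace hg hT hu hw ((d : ℚ) - 1)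
  rwa [show c + d - ((d - 1 : ℚ) : ℂ) - 1 = c by push_cast; ring] at h

/-- The lowest weight space is a quotient of `A_g(V)`. -/
lemma finiteDimensional_weightSpace (hX : X.IsSimple) (hg : IsAutomorphism g) (hT : IsOfFinOrder g)
    (hfin : FiniteDimensional ℂ (TwistedZhu g)) (hs : X.IsLowestWeightVector s c) :
    FiniteDimensional ℂ (X.weightSpace c) := by
  have hlow : ∀ (e : ℤ) (v : V), v ∈ VertexOperatorAlgebra.weightSpace V e → ∀ k : ℚ,
      (e : ℚ) - 1 < k → X.mode v k ∘ₗ (ℂ ∙ s).subtype = 0 := fun e v hv k hk => by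
    ext ⟨w, hw⟩
    obtain ⟨a, rfl⟩ := Submodule.mem_span_singleton.mp hw
    simp [hs.lowering e v hv k hk]
  -- `zeroModeForm_mem_dualAnnihilator` is used on the line through s, where every lowering mode is
  -- zero, and tested against all functionals η on M.
  have hO : twistedO g ≤ LinearMap.ker (LinearMap.applyₗ s ∘ₗ X.zeroMode : V →ₗ[ℂ] M) := by
    intro v hv
    rw [LinearMap.mem_ker, ← Module.forall_dual_apply_eq_zero_iff ℂ]
    intro η
    let Φ : Module.Dual ℂ ((ℂ ∙ s) →ₗ[ℂ] M) :=
      η ∘ₗ LinearMap.applyₗ (⟨s, Submodule.mem_span_singleton_self s⟩ : ℂ ∙ s)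
    have h := X.zeroModeForm_mem_dualAnnihilator (ι := (ℂ ∙ s).subtype) (Φ := Φ)
      ⟨0, fun e v hv k hk => hlow e v hv k (by linarith)⟩
      (fun a m e v hv k hk => by rw [hlow e v hv k hk, LinearMap.comp_zero, map_zero]) hT
    exact (Submodule.mem_dualAnnihilator _).mp h v hv
  have hR : FiniteDimensional ℂ
      (LinearMap.range (LinearMap.applyₗ s ∘ₗ X.zeroMode : V →ₗ[ℂ] M)) := by
    rw [← Submodule.range_liftQ _ _ hO]
    exact inferInstance
  -- A vector of M_c lies in the orbit of s; modulo the other weight spaces each uₙs is a zero mode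
  -- applied to s, so independence of the weight spaces gives M_c = {o(v)s}.
  refine Submodule.finiteDimensional_of_le
    (S₂ := LinearMap.range (LinearMap.applyₗ s ∘ₗ X.zeroMode : V →ₗ[ℂ] M)) fun w hw => ?_
  have h1 : w ∈ LinearMap.range (LinearMap.applyₗ s ∘ₗ X.zeroMode : V →ₗ[ℂ] M) ⊔
      ⨆ j, ⨆ (_ : j ≠ c), X.weightSpace j := by
    have h2 : w ∈ X.orbit s := by rw [hX.orbit_eq_top hT hs.ne_zero]; trivial
    refine Submodule.span_le.mpr ?_ h2
    rintro _ ⟨u, n, rfl⟩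
    exact mode_mem_iSup_ne hg hT hs u n
  obtain ⟨y, hy, z, hz, rfl⟩ := Submodule.mem_sup.mp h1
  have hyc : y ∈ X.weightSpace c := by
    obtain ⟨v, rfl⟩ := hy
    exact zeroMode_mem hg hT hs.mem v
  have hzc : z ∈ X.weightSpace c := by
    have := Submodule.sub_mem _ hw hyc
    rwa [add_sub_cancel_left] at this
  have := Submodule.disjoint_def.mp (X.iSupIndep_weightSpace c) z hzc hz
  rwa [this, add_zero]

/-- A functional supported on the lowest weight space is killed by all modes of sufficiently
small index. -/
lemma exists_comp_mode_eq_zero (hX : X.IsSimple) (hg : IsAutomorphism g) (hT : IsOfFinOrder g)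
    (hs : X.IsLowestWeightVector s c) {φ : Module.Dual ℂ M}
    (hφ : ⨆ j, ⨆ (_ : j ≠ c), X.weightSpace j ≤ LinearMap.ker φ) (u : V) :
    ∃ K : ℚ, ∀ n, n ≤ K → φ ∘ₗ X.mode u n = 0 := by
  let P : Submodule ℂ V :=
    { carrier := {u | ∃ K : ℚ, ∀ n, n ≤ K → φ ∘ₗ X.mode u n = 0}
      zero_mem' := ⟨0, fun n _ => by simp⟩
      add_mem' := by
        rintro a b ⟨K, hK⟩ ⟨L, hL⟩
        exact ⟨min K L, fun n hn => by
          rw [map_add, Pi.add_apply, LinearMap.comp_add, hK n (le_trans hn (min_le_left _ _)),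
            hL n (le_trans hn (min_le_right _ _)), add_zero]⟩
      smul_mem' := by
        rintro a b ⟨K, hK⟩
        exact ⟨K, fun n hn => by
          rw [map_smul, Pi.smul_apply, LinearMap.comp_smul, hK n hn, smul_zero]⟩ }
  -- A mode of index n ≤ d-2 raises the weight by at least 1, hence its image avoids M_c.
  refine weight_induction P (fun d u hu => ⟨d - 2, fun n hn => ?_⟩) u
  have hle : (⨆ k, X.level c k) ≤ LinearMap.ker (φ ∘ₗ X.mode u n) := by
    refine iSup_le fun k w hw => ?_
    rcases mode_level hX hg hT hs hu k n with h | ⟨m, hm, h⟩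
    · rw [LinearMap.mem_ker, LinearMap.comp_apply, h w hw, map_zero]
    · refine hφ (le_iSup₂_of_le (f := fun j (_ : j ≠ c) => X.weightSpace j)
        (c + (m : ℂ) / orderOf g) (fun h0 => ?_) le_rfl (h w hw))
      have h1 : (m : ℂ) / orderOf g = 0 := by linear_combination h0
      rw [div_eq_zero_iff, Nat.cast_eq_zero, Nat.cast_eq_zero] at h1
      have h2 := h1.resolve_right hT.orderOf_pos.ne'
      rw [h2, Nat.cast_zero] at hm
      have h3 : (1 : ℚ) ≤ orderOf g := by exact_mod_cast hT.orderOf_pos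
      have h4 : (0 : ℚ) ≤ k := Nat.cast_nonneg k
      nlinarith
  rw [iSup_level hX hg hT hs, top_le_iff, LinearMap.ker_eq_top] at hle
  exact hle

end WeakTwistedModule

end

/-! ### Finite-dimensionality of the levels. -/

section

namespace WeakTwistedModule

variable {V : Type u} [AddCommGroup V] [Module ℂ V] [VertexOperatorAlgebra V]
  {g : V ≃ₗ[ℂ] V} {M : Type u} [AddCommGroup M] [Module ℂ M] {X : WeakTwistedModule g M}
  {s : M} {c : ℂ}

variable (X) in
/-- The space of restrictions to `W` of functionals in the dual orbit of `φ`. -/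
def restrictedDualOrbit (φ : Module.Dual ℂ M) (W : Submodule ℂ M) :
    Submodule ℂ (Module.Dual ℂ W) :=
  (X.dualOrbit φ).map W.subtype.dualMap

/-- It is spanned by the restrictions of φ ∘ bₙ with b in a countable spanning set of V and n ∈ ℚ.
-/
lemma rank_restrictedDualOrbit_le (φ : Module.Dual ℂ M) (W : Submodule ℂ M) :
    Module.rank ℂ (X.restrictedDualOrbit φ W) ≤ Cardinal.aleph0 := by
  obtain ⟨B, hB, hspan⟩ := exists_countable_span V
  set G : Set (Module.Dual ℂ W) :=
    (fun p : V × ℚ => (φ ∘ₗ X.mode p.1 p.2) ∘ₗ W.subtype) '' (B ×ˢ Set.univ) with hG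
  have hle : X.restrictedDualOrbit φ W ≤ Submodule.span ℂ G := by
    rw [restrictedDualOrbit, Submodule.map_le_iff_le_comap, dualOrbit, Submodule.span_le]
    rintro _ ⟨u, n, rfl⟩
    let P : Submodule ℂ V := (Submodule.span ℂ G).comap
      ((LinearMap.lcomp ℂ ℂ W.subtype ∘ₗ LinearMap.compRight ℂ φ) ∘ₗ LinearMap.proj n ∘ₗ X.mode)
    have hP : Submodule.span ℂ B ≤ P := Submodule.span_le.mpr fun b hb =>
      Submodule.subset_span ⟨(b, n), ⟨hb, trivial⟩, rfl⟩
    rw [hspan] at hP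
    exact hP (x := u) trivial
  calc Module.rank ℂ (X.restrictedDualOrbit φ W) ≤ Module.rank ℂ (Submodule.span ℂ G) :=
        Submodule.rank_mono hle
    _ ≤ Cardinal.mk G := rank_span_le G
    _ ≤ Cardinal.aleph0 := ((hB.prod Set.countable_univ).image _).le_aleph0

/-- The dual of an infinite-dimensional space has strictly larger dimension than the space, hence
uncountable dimension. -/
lemma finiteDimensional_of_restrictedDualOrbit_eq_top {φ : Module.Dual ℂ M} {W : Submodule ℂ M}
    (h : X.restrictedDualOrbit φ W = ⊤) : FiniteDimensional ℂ W := by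
  by_contra hW
  have h1 : Cardinal.aleph0 ≤ Module.rank ℂ W := by
    rwa [← not_lt, Module.rank_lt_aleph0_iff]
  have h2 := lift_rank_lt_rank_dual h1
  have h3 := X.rank_restrictedDualOrbit_le φ W
  rw [h, rank_top] at h3
  exact absurd (h1.trans_lt (by simpa using h2)) (not_lt.mpr h3)

/-- The dual orbit of a nonzero functional on a simple module separates points. -/
lemma eq_zero_of_dualOrbit_apply_eq_zero (hX : X.IsSimple) (hT : IsOfFinOrder g)
    {φ : Module.Dual ℂ M} (hφ0 : φ ≠ 0) (hφ : ∀ u : V, ∃ K : ℚ, ∀ n, n ≤ K → φ ∘ₗ X.mode u n = 0)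
    {w : M} (hw : ∀ ψ ∈ X.dualOrbit φ, ψ w = 0) : w = 0 := by
  have hφmem : φ ∈ X.dualOrbit φ := by
    have h := X.comp_mode_mem_dualOrbit φ vacuum (-1)
    rwa [X.vacuum_mode, if_pos rfl] at h
  rcases hX.eq_bot_or_eq_top (X.dualOrbit φ).dualCoannihilator (fun v n w hw => by
    rw [Submodule.mem_dualCoannihilator] at hw ⊢
    exact fun ψ hψ => hw _ (X.dualOrbit_stable hT hφ v n hψ)) with h | h
  · rw [← Submodule.mem_bot ℂ, ← h, Submodule.mem_dualCoannihilator]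
    exact hw
  · refine absurd (LinearMap.ext fun x => ?_) hφ0
    have hx : x ∈ (X.dualOrbit φ).dualCoannihilator := h ▸ Submodule.mem_top
    exact (Submodule.mem_dualCoannihilator x).mp hx φ hφmem

/-- The dual orbit separates the points of M by simplicity, and a separating subspace of the dual of
a finite-dimensional space is the whole dual. -/
lemma restrictedDualOrbit_eq_top (hX : X.IsSimple) (hT : IsOfFinOrder g) {φ : Module.Dual ℂ M}
    (hφ0 : φ ≠ 0) (hφ : ∀ u : V, ∃ K : ℚ, ∀ n, n ≤ K → φ ∘ₗ X.mode u n = 0)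
    (W : Submodule ℂ M) [FiniteDimensional ℂ W] : X.restrictedDualOrbit φ W = ⊤ := by
  have h : (X.restrictedDualOrbit φ W).dualCoannihilator = ⊥ := by
    rw [eq_bot_iff]
    intro w hw
    rw [Submodule.mem_dualCoannihilator] at hw
    rw [Submodule.mem_bot]
    exact Subtype.ext (X.eq_zero_of_dualOrbit_apply_eq_zero hX hT hφ0 hφ fun ψ hψ =>
      hw _ (Submodule.mem_map_of_mem hψ))
  have h2 := Subspace.dualCoannihilator_dualAnnihilator_eq (W := X.restrictedDualOrbit φ W)
  rw [← h2, h, Submodule.dualAnnihilator_bot]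

/-- A level of a simple module all of whose lower levels are finite-dimensional is
finite-dimensional, provided that no functional on `A_g(V)` is an eigenvector of the
corresponding weight. -/
lemma finiteDimensional_level_of_lt (hX : X.IsSimple) (hg : IsAutomorphism g) (hT : IsOfFinOrder g)
    (hs : X.IsLowestWeightVector s c) {k : ℕ}
    (hmax : ∀ F : Module.Dual ℂ V, F ∈ (twistedO g).dualAnnihilator →
      F ∘ₗ bra omega 1 (-1) = (c + (k : ℂ) / orderOf g) • F → F = 0)
    (ih : ∀ m < k, FiniteDimensional ℂ (X.level c m)) : FiniteDimensional ℂ (X.level c k) := by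
  obtain ⟨φ, hφs, hφ⟩ := Submodule.exists_le_ker_of_notMem
    (p := ⨆ j, ⨆ (_ : j ≠ c), X.weightSpace j) (v := s) fun h =>
      hs.ne_zero (Submodule.disjoint_def.mp (X.iSupIndep_weightSpace c) s hs.mem h)
  have hφ0 : φ ≠ 0 := fun h => hφs (by rw [h, LinearMap.zero_apply])
  have hφ' := exists_comp_mode_eq_zero hX hg hT hs hφ
  by_contra hk
  obtain ⟨η, hη⟩ : ∃ η, η ∉ X.restrictedDualOrbit φ (X.level c k) := by
    by_contra! h
    exact hk (finiteDimensional_of_restrictedDualOrbit_eq_top (X := X) (φ := φ)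
      (Submodule.eq_top_iff'.mpr h))
  -- ξ lives on the dual of level k and vanishes on the restricted orbit but not on η, which is then
  -- extended to a functional ψ on M.
  obtain ⟨ξ, hξη, hξ⟩ := Submodule.exists_le_ker_of_notMem hη
  obtain ⟨ψ, rfl⟩ := LinearMap.dualMap_surjective_of_injective
    (Submodule.injective_subtype (X.level c k)) η
  let Φ : Module.Dual ℂ (X.level c k →ₗ[ℂ] M) := ξ ∘ₗ LinearMap.compRight ℂ ψ
  have hΦ : X.KillsLowering (X.level c k).subtype Φ := by
    intro a m e v hv n hn
    change ξ (ψ ∘ₗ X.mode a m ∘ₗ X.mode v n ∘ₗ (X.level c k).subtype) = 0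
    rcases mode_level hX hg hT hs hv k n with h | ⟨j, hj, h⟩
    · have : X.mode v n ∘ₗ (X.level c k).subtype = 0 := LinearMap.ext fun w => h w w.2
      rw [this, LinearMap.comp_zero, LinearMap.comp_zero, map_zero]
    · have hpos : (0 : ℚ) < orderOf g := by exact_mod_cast hT.orderOf_pos
      have hjk : (j : ℚ) < k := by nlinarith
      have := ih j (by exact_mod_cast hjk)
      -- The lowering mode lands in a finite-dimensional level j < k, where ψ ∘ a_m agrees with some
      -- χ in the dual orbit. Then χ ∘ v_n is again in the dual orbit, so ξ kills its restriction.
      have htop := restrictedDualOrbit_eq_top hX hT hφ0 hφ' (X.level c j)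
      obtain ⟨χ, hχ, hχ'⟩ : (X.level c j).subtype.dualMap (ψ ∘ₗ X.mode a m) ∈
        X.restrictedDualOrbit φ (X.level c j) := htop ▸ Submodule.mem_top
      refine hξ ⟨χ ∘ₗ X.mode v n, X.dualOrbit_stable hT hφ' v n hχ, LinearMap.ext fun w => ?_⟩
      exact LinearMap.congr_fun hχ' ⟨_, h w w.2⟩
  have hι := uniformlyTruncated_level hX hg hT hs k
  have h0 := hmax _ (X.zeroModeForm_mem_dualAnnihilator hι hΦ hT)
    (X.zeroModeForm_comp_bra_omega hι hΦ hg hT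
      (LinearMap.ext fun w => X.mem_weightSpace.mp w.2))
  refine hξη ?_
  -- The zero mode of the vacuum is the identity, so the value there is ξ(η) ≠ 0.
  have h1 := LinearMap.congr_fun h0 vacuum
  rw [zeroModeForm_apply, X.zeroMode_of_mem vacuum_mem_weightSpace, X.vacuum_mode,
    if_pos (by norm_num)] at h1
  exact h1

/-- A simple module generated by a lowest weight vector whose weight is extremal among the
eigenvalues on the dual of `A_g(V)` is ordinary. -/
lemma IsSimple.isOrdinary (hX : X.IsSimple) (hg : IsAutomorphism g) (hT : IsOfFinOrder g)
    (hfin : FiniteDimensional ℂ (TwistedZhu g)) (hs : X.IsLowestWeightVector s c)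
    (hmax : ∀ (x : ℝ) (F : Module.Dual ℂ V), 0 < x → F ∈ (twistedO g).dualAnnihilator →
      F ∘ₗ bra omega 1 (-1) = (c + x) • F → F = 0) : X.IsOrdinary where
  grading := by
    classical
    rw [DirectSum.isInternal_submodule_iff_iSupIndep_and_iSup_eq_top]
    refine ⟨X.iSupIndep_weightSpace, ?_⟩
    rw [eq_top_iff, ← iSup_level hX hg hT hs]
    exact iSup_le fun k => le_iSup X.weightSpace (c + (k : ℂ) / orderOf g)
  finite_weight b := by
    have h : ∀ k, FiniteDimensional ℂ (X.level c k) := fun k => by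
      induction k using Nat.strong_induction_on with
      | _ k ih =>
        rcases Nat.eq_zero_or_pos k with rfl | hk
        · rw [X.level_zero]
          exact finiteDimensional_weightSpace hX hg hT hfin hs
        · refine finiteDimensional_level_of_lt hX hg hT hs (fun F hF h => ?_) ih
          have h1 : (0 : ℝ) < k := by exact_mod_cast hk
          have h2 : (0 : ℝ) < orderOf g := by exact_mod_cast hT.orderOf_pos
          exact hmax (k / orderOf g) F (by positivity) hF (by push_cast; exact h)
    by_cases hb : X.weightSpace b = ⊥
    · rw [hb]; infer_instance
    · obtain ⟨k, rfl⟩ := exists_level_of_ne_bot hX hg hT hs hb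
      exact h k
  bounded_below b := by
    -- A weight b + n/T equal to c + k/T has n = T·Re(c-b) + k with k ≥ 0.
    refine ⟨⌊(orderOf g : ℝ) * (c - b).re⌋, fun n hn => ?_⟩
    by_contra h
    obtain ⟨k, hk⟩ := exists_level_of_ne_bot hX hg hT hs h
    have hT0 : (orderOf g : ℂ) ≠ 0 := Nat.cast_ne_zero.mpr hT.orderOf_pos.ne'
    have h1 : (n : ℂ) = orderOf g * (c - b) + k := by
      field_simp at hk
      linear_combination hk
    have h2 := congrArg Complex.re h1
    simp only [Complex.intCast_re, Complex.add_re, Complex.mul_re, Complex.natCast_re,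
      Complex.natCast_im, zero_mul, sub_zero] at h2
    have h3 : (0 : ℝ) ≤ k := Nat.cast_nonneg k
    have h4 : (orderOf g : ℝ) * (c - b).re ≤ n := by linarith
    exact absurd (Int.floor_mono h4) (by rw [Int.floor_intCast]; omega)

end WeakTwistedModule

end

end VertexOperatorAlgebra

end

/-! ### Assembly of the theorem. -/

theorem theorem9p1 {V : Type u} [AddCommGroup V] [Module ℂ V] [VertexOperatorAlgebra V]
    (g : V ≃ₗ[ℂ] V) (hg : VertexOperatorAlgebra.IsAutomorphism g) (hT : IsOfFinOrder g)
    (hfin : FiniteDimensional ℂ (VertexOperatorAlgebra.TwistedZhu g))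
    (hne : Nontrivial (VertexOperatorAlgebra.TwistedZhu g)) :
    ∃ (M : Type u) (_ : AddCommGroup M) (_ : Module ℂ M)
      (X : VertexOperatorAlgebra.WeakTwistedModule g M), X.IsOrdinary ∧ X.IsSimple := by
  obtain ⟨c, f, hf, hf0, hfc, hmax⟩ :=
    VertexOperatorAlgebra.exists_extremal_eigenvector hg hfin hne
  have hreg := VertexOperatorAlgebra.dualAnnihilator_le_regularDual hg hT hf
  -- The equations uₙf = af pass to the image s of f; applied to L(0) with a = c and to the lowering
  -- modes with a = 0, they make s a lowest weight vector.
  obtain ⟨S, _, _, X, s, hs0, hX, hs⟩ :=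
    (VertexOperatorAlgebra.regularModule hg hT).exists_simple_subquotient hT
      (w := ⟨f, hreg⟩) fun h => hf0 (congrArg Subtype.val h)
  have hlow : X.IsLowestWeightVector s c :=
    { ne_zero := hs0
      mem := X.mem_weightSpace.mpr (hs _ _ _ (Subtype.ext
        ((VertexOperatorAlgebra.dualMode_omega hg hT hf).trans hfc)))
      lowering := fun d u hu n hn => by
        have h := hs u n 0 (Subtype.ext
          ((VertexOperatorAlgebra.dualMode_eq_zero_of_lt hg hT hf hu hn).trans
            (zero_smul ℂ f).symm))
        rwa [zero_smul] at h }
  exact ⟨S, _, _, X, hX.isOrdinary hg hT hfin hlow hmax, hX⟩
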